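/- Let $\beta_1,\beta_2\in\mathbb{C}$ with $\beta_1\neq\pm1$, let $q:[0,1]\to\mathbb{C}$ be absolutely continuous with $\int_0^1 q(x)\,dx=0$, and let $T_1^1(q)$ be the operator in $L_2[0,1]$ generated by the differential expression $-y''+q(x)y$ and the boundary conditions $$y'(0)+\beta_1y'(1)+\beta_2y(1)=0,\qquad y(0)-y(1)=0 .$$ Suppose that $q(0)-q(1)\neq \dfrac{2\beta_2^2}{1-\beta_1^2}$, and put $D=2(1-\beta_1^2)\,[q(0)-q(1)]-(2\beta_2)^2$. Then: (a) All eigenvalues of $T_1^1(q)$ of sufficiently large modulus are simple (their algebraic multiplicity is one). For either choice of $\sqrt D$, the square roots with nonnegative real part of the large eigenvalues consist of two sequences $\{\mu_{n,1}(q)\}$ and $\{\mu_{n,2}(q)\}$, enumerated without repetition by all sufficiently large $n$, such that as $n\to\infty$ $$\mu_{n,1}(q)=2\pi n+\frac{2\beta_2-i\sqrt D}{4(\beta_1-1)\pi n}+o\Big(\frac1n\Big),\qquad \mu_{n,2}(q)=2\pi n+\frac{2\beta_2+i\sqrt D}{4(\beta_1-1)\pi n}+o\Big(\frac1n\Big).$$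 (b) The system of root functions (eigenfunctions and associated functions) of $T_1^1(q)$ does not form a Riesz basis of $L_2[0,1]$, whatever the choice and normalization of the root functions. -/

import Mathlib

open MeasureTheory Set Filter Asymptotics

noncomputable section

namespace SturmLiouville

/-- The complex Hilbert space `L₂[0,1]`. -/
abbrev L2 : Type := Lp ℂ 2 (volume.restrict (Icc (0 : ℝ) 1))

/-- The derivative of a function on the closed interval `[0,1]` (one-sided at the endpoints). -/
def D (y : ℝ → ℂ) : ℝ → ℂ := derivWithin y (Icc (0 : ℝ) 1)

/-- The functions `y` on `[0,1]` such that `y` is differentiable, `y'` is absolutely continuous, and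
`y'(0) + β₁ y'(1) + β₂ y(1) = 0`, `y(0) - y(1) = 0`. -/
structure Admissible (β₁ β₂ : ℂ) (y : ℝ → ℂ) : Prop where
  diff : DifferentiableOn ℝ y (Icc 0 1)
  ac : AbsolutelyContinuousOnInterval (D y) 0 1
  bc₁ : D y 0 + β₁ * D y 1 + β₂ * y 1 = 0
  bc₂ : y 0 - y 1 = 0

lemma D_add {y₁ y₂ : ℝ → ℂ} (h₁ : DifferentiableOn ℝ y₁ (Icc 0 1))
    (h₂ : DifferentiableOn ℝ y₂ (Icc 0 1)) : D (y₁ + y₂) = D y₁ + D y₂ := by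
  funext x
  by_cases hx : x ∈ Icc (0 : ℝ) 1
  · exact derivWithin_add (h₁ x hx) (h₂ x hx)
  · have hx' : x ∉ closure (Icc (0 : ℝ) 1) := by rwa [isClosed_Icc.closure_eq]
    simp [D, derivWithin_zero_of_notMem_closure hx']

lemma D_const_smul (c : ℂ) (y : ℝ → ℂ) : D (c • y) = c • D y := by
  funext x
  exact derivWithin_const_mul_field c

lemma ae_differentiable {z : ℝ → ℂ} (hz : AbsolutelyContinuousOnInterval z 0 1) :
    ∀ᵐ x ∂(volume.restrict (Icc (0 : ℝ) 1)), DifferentiableWithinAt ℝ z (Icc 0 1) x := by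
  have h := hz.boundedVariationOn.locallyBoundedVariationOn
  rw [uIcc_of_le zero_le_one] at h
  exact h.ae_differentiableWithinAt measurableSet_Icc

lemma Admissible.zero (β₁ β₂ : ℂ) : Admissible β₁ β₂ 0 := by
  have h : D 0 = 0 := by funext x; simp [D]
  refine ⟨differentiableOn_const 0, ?_, by simp [h], by simp⟩
  rw [h]
  exact (LipschitzWith.const (0 : ℂ)).lipschitzOnWith.absolutelyContinuousOnInterval

lemma Admissible.add {β₁ β₂ : ℂ} {y₁ y₂ : ℝ → ℂ} (h₁ : Admissible β₁ β₂ y₁)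
    (h₂ : Admissible β₁ β₂ y₂) : Admissible β₁ β₂ (y₁ + y₂) := by
  have h := D_add h₁.diff h₂.diff
  refine ⟨h₁.diff.add h₂.diff, by rw [h]; exact h₁.ac.add h₂.ac, ?_, ?_⟩
  · rw [h]
    simp only [Pi.add_apply]
    linear_combination h₁.bc₁ + h₂.bc₁
  · simp only [Pi.add_apply]
    linear_combination h₁.bc₂ + h₂.bc₂

lemma Admissible.smul {β₁ β₂ : ℂ} (c : ℂ) {y : ℝ → ℂ} (h : Admissible β₁ β₂ y) :
    Admissible β₁ β₂ (c • y) := by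
  have h' := D_const_smul c y
  refine ⟨h.diff.const_smul c, by rw [h']; exact h.ac.const_smul c, ?_, ?_⟩
  · rw [h']
    simp only [Pi.smul_apply, smul_eq_mul]
    linear_combination c * h.bc₁
  · simp only [Pi.smul_apply, smul_eq_mul]
    linear_combination c * h.bc₂

/-- The set of all pairs `(y, -y'' + q y)` with `y` admissible and `-y'' + q y ∈ L₂[0,1]`. -/
def graph (β₁ β₂ : ℂ) (q : ℝ → ℂ) : Submodule ℂ (L2 × L2) where
  carrier := {p | ∃ y : ℝ → ℂ, Admissible β₁ β₂ y ∧
    p.1 =ᵐ[volume.restrict (Icc (0 : ℝ) 1)] y ∧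
    p.2 =ᵐ[volume.restrict (Icc (0 : ℝ) 1)] fun x => -D (D y) x + q x * y x}
  zero_mem' := by
    have h : D 0 = 0 := by funext x; simp [D]
    refine ⟨0, Admissible.zero β₁ β₂, Lp.coeFn_zero _ _ _, ?_⟩
    filter_upwards [Lp.coeFn_zero ℂ 2 (volume.restrict (Icc (0 : ℝ) 1))] with x hx
    simpa [h] using hx
  add_mem' := by
    rintro ⟨f₁, g₁⟩ ⟨f₂, g₂⟩ ⟨y₁, a₁, b₁, c₁⟩ ⟨y₂, a₂, b₂, c₂⟩
    refine ⟨y₁ + y₂, a₁.add a₂, ?_, ?_⟩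
    · exact (Lp.coeFn_add f₁ f₂).trans (b₁.add b₂)
    · refine (Lp.coeFn_add g₁ g₂).trans ?_
      rw [D_add a₁.diff a₂.diff]
      filter_upwards [c₁, c₂, ae_differentiable a₁.ac, ae_differentiable a₂.ac] with x u₁ u₂ d₁ d₂
      have e : D (D y₁ + D y₂) x = D (D y₁) x + D (D y₂) x := derivWithin_add d₁ d₂
      simp only [Pi.add_apply] at u₁ u₂ ⊢
      rw [u₁, u₂, e]
      ring
  smul_mem' := by
    rintro c ⟨f, g⟩ ⟨y, a, b, d⟩
    refine ⟨c • y, a.smul c, ?_, ?_⟩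
    · exact (Lp.coeFn_smul c f).trans (b.const_smul c)
    · refine (Lp.coeFn_smul c g).trans ?_
      rw [D_const_smul, D_const_smul]
      filter_upwards [d] with x u
      simp only [Pi.smul_apply, smul_eq_mul] at u ⊢
      rw [u]
      ring

/-- The operator in `L₂[0,1]` generated by `-y'' + q y` and the boundary conditions
`y'(0) + β₁ y'(1) + β₂ y(1) = 0`, `y(0) - y(1) = 0`. -/
def T (β₁ β₂ : ℂ) (q : ℝ → ℂ) : L2 →ₗ.[ℂ] L2 := (graph β₁ β₂ q).toLinearPMap

/-- `graph β₁ β₂ q` is single-valued, so it is the graph of `T β₁ β₂ q`. -/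
theorem T_graph (β₁ β₂ : ℂ) (q : ℝ → ℂ) : (T β₁ β₂ q).graph = graph β₁ β₂ q := by
  refine Submodule.toLinearPMap_graph_eq _ ?_
  rintro ⟨f, g⟩ ⟨y, a, b, c⟩ (hf : f = 0)
  subst hf
  change g = 0
  have hy : EqOn y 0 (Icc 0 1) :=
    Measure.eqOn_Icc_of_ae_eq volume zero_ne_one
      (b.symm.trans (Lp.coeFn_zero _ _ _)) a.diff.continuousOn continuousOn_const
  have hDy : EqOn (D y) 0 (Icc 0 1) := fun x hx => by
    have := derivWithin_congr hy (hy hx)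
    simpa [D] using this
  have hDDy : EqOn (D (D y)) 0 (Icc 0 1) := fun x hx => by
    have := derivWithin_congr hDy (hDy hx)
    simpa [D] using this
  refine Lp.ext (c.trans (EventuallyEq.trans ?_ (Lp.coeFn_zero _ _ _).symm))
  filter_upwards [ae_restrict_mem measurableSet_Icc] with x hx
  simp [hy hx, hDDy hx]

/-! ### Spectral notions for an unbounded operator -/

section Spectral

variable {H : Type*} [NormedAddCommGroup H] [InnerProductSpace ℂ H]

/-- `lam` is an eigenvalue of `A`. -/
def IsEigenvalue (A : H →ₗ.[ℂ] H) (lam : ℂ) : Prop :=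
  ∃ f : A.domain, f ≠ 0 ∧ A f = lam • (f : H)

/-- The kernel of `(A - lam)ᵏ`, on the natural domain of this power. -/
def kerPow (A : H →ₗ.[ℂ] H) (lam : ℂ) : ℕ → Submodule ℂ H
  | 0 => ⊥
  | k + 1 => ((kerPow A lam k).comap (A.toFun - lam • A.domain.subtype)).map A.domain.subtype

/-- The root subspace of `A` at `lam`: the union of the kernels of `(A - lam)ᵏ`. -/
def rootSpace (A : H →ₗ.[ℂ] H) (lam : ℂ) : Submodule ℂ H := ⨆ k, kerPow A lam k

/-- An eigenvalue is simple if its algebraic multiplicity (the dimension of its root subspace)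
is one. -/
def IsSimpleEigenvalue (A : H →ₗ.[ℂ] H) (lam : ℂ) : Prop :=
  IsEigenvalue A lam ∧ Module.finrank ℂ (rootSpace A lam) = 1

/-- A root function of `A` (an eigenfunction or an associated function): a nonzero element of some
root subspace. -/
def IsRootFunction (A : H →ₗ.[ℂ] H) (f : H) : Prop :=
  f ≠ 0 ∧ ∃ lam : ℂ, ∃ k : ℕ, f ∈ kerPow A lam k

/-- A Riesz basis: the image of an orthonormal basis under a bounded linear operator with bounded
inverse. -/
def IsRieszBasis {ι : Type*} (φ : ι → H) : Prop :=
  ∃ (b : HilbertBasis ι ℂ H) (S : H ≃L[ℂ] H), ∀ i, φ i = S (b i)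

end Spectral

end SturmLiouville

end

/-!
The eigenvalues `lam = μ ^ 2` are the zeros of the entire function `charFun β₁ β₂ q lam = (1 - β₁)
+ β₁ s'(1) - c(1) + β₂ s(1)`, where `c` and `s` are the solutions of `-y'' + q y = lam y` with
initial values `(1, 0)` and `(0, 1)` (`isEigenvalue_iff`). At a simple zero of `charFun` the
eigenspace is a line and there are no associated functions (`isSimpleEigenvalue`), so part (a) is
a statement about the large zeros of `charFun`.

Variation of constants, iterated until the error is of order `μ ^ (-3)`, together with `∫₀¹ q = 0`
gives (`exists_charFun_asymptotics`), up to `O(exp |Im μ| / |μ|³)`, `charFun (μ²) = (1 - β₁) (1 -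
cos μ) + β₂ sin μ / μ - (1 + β₁) / (2 μ) ∫₀¹ q(t) sin (μ (1 - 2 t)) dt`. Since `β₁ ≠ 1`, at a
large zero `sin (μ / 2)` is of order `1 / μ`, which puts `μ` within `O(1/n)` of some `2πn`
(`exists_localization`). In the local variable `ζ`, with `μ = 2πn + ζ / (2πn)`, an integration by
parts in the sine integral and the Riemann–Lebesgue lemma for `q'` show that `(2πn)² charFun (μ²)`
converges locally uniformly to the quadratic polynomial `(1 - β₁) / 2 ζ² + β₂ ζ + (1 + β₁) (q 0 -
q 1) / 4` (`tendstoUniformlyOn_localCharFun`). The hypothesis on `q 0 - q 1` says that its two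
roots are different. So for large `n` there are exactly two zeros near `2πn`, both simple, and
their local coordinates converge to the two roots (`exists_zeros`, `exists_zero_sequences`); this
is (a).

For (b), both eigenfunctions near `2πn`, normalized by `y 0 = 1`, are uniformly close to `cos
(2πnx)` because `β₁ ≠ -1` keeps their initial slopes bounded (`exists_eigenfunction_near_cos`). A
Riesz basis of root functions would contain nonzero multiples of both: an eigenfunction of the
adjoint problem is orthogonal to all root functions of the other eigenvalues, so none of the
eigenvalues can be left out (`exists_mem_kerPow`). But multiples of different members of a Riesz
basis cannot come arbitrarily close to each other relative to their norm
(`IsRieszBasis.exists_norm_le`).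
-/

noncomputable section

/-! ### Absolutely continuous complex functions -/

section AbsolutelyContinuous

variable {f g : ℝ → ℂ} {a b : ℝ}

theorem absolutelyContinuous_of_dist_le {X Y : Type*} [PseudoMetricSpace X] [PseudoMetricSpace Y]
    {f : ℝ → X} {g : ℝ → Y} {a b : ℝ} (hf : AbsolutelyContinuousOnInterval f a b)
    (h : ∀ x ∈ uIcc a b, ∀ y ∈ uIcc a b, dist (g x) (g y) ≤ dist (f x) (f y)) :
    AbsolutelyContinuousOnInterval g a b := by
  rw [absolutelyContinuousOnInterval_iff] at hf ⊢
  intro ε hε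
  obtain ⟨δ, hδ, H⟩ := hf ε hε
  refine ⟨δ, hδ, fun E hE hs => lt_of_le_of_lt (Finset.sum_le_sum fun i hi => ?_) (H E hE hs)⟩
  exact h _ (hE.1 i hi).1 _ (hE.1 i hi).2

theorem AbsolutelyContinuousOnInterval.re (hf : AbsolutelyContinuousOnInterval f a b) :
    AbsolutelyContinuousOnInterval (fun x => (f x).re) a b :=
  absolutelyContinuous_of_dist_le hf fun x _ y _ => by
    rw [Real.dist_eq, dist_eq_norm, ← Complex.sub_re]; exact Complex.abs_re_le_norm _

theorem AbsolutelyContinuousOnInterval.im (hf : AbsolutelyContinuousOnInterval f a b) :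
    AbsolutelyContinuousOnInterval (fun x => (f x).im) a b :=
  absolutelyContinuous_of_dist_le hf fun x _ y _ => by
    rw [Real.dist_eq, dist_eq_norm, ← Complex.sub_im]; exact Complex.abs_im_le_norm _

theorem AbsolutelyContinuousOnInterval.ae_hasDerivAt
    (hf : AbsolutelyContinuousOnInterval f a b) :
    ∀ᵐ x, x ∈ uIcc a b → HasDerivAt f (deriv f x) x := by
  filter_upwards [hf.boundedVariationOn.ae_differentiableAt_of_mem_uIcc] with x hx h
  exact (hx h).hasDerivAt

theorem AbsolutelyContinuousOnInterval.ae_deriv_eq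
    (hf : AbsolutelyContinuousOnInterval f a b) :
    ∀ᵐ x, x ∈ uIoc a b → deriv f x =
      ((deriv (fun x => (f x).re) x : ℝ) : ℂ) +
        ((deriv (fun x => (f x).im) x : ℝ) : ℂ) * Complex.I := by
  filter_upwards [hf.ae_hasDerivAt] with x hx h
  have h1 := hx (uIoc_subset_uIcc h)
  have h2 : HasDerivAt (fun x => (f x).re) (deriv f x).re x :=
    Complex.reCLM.hasFDerivAt.comp_hasDerivAt x h1
  have h3 : HasDerivAt (fun x => (f x).im) (deriv f x).im x :=
    Complex.imCLM.hasFDerivAt.comp_hasDerivAt x h1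
  rw [h2.deriv, h3.deriv, Complex.re_add_im]

theorem intervalIntegrable_ofReal {u : ℝ → ℝ} (hu : IntervalIntegrable u volume a b) :
    IntervalIntegrable (fun x => (u x : ℂ)) volume a b :=
  ⟨hu.1.ofReal, hu.2.ofReal⟩

theorem AbsolutelyContinuousOnInterval.intervalIntegrable_deriv_complex
    (hf : AbsolutelyContinuousOnInterval f a b) :
    IntervalIntegrable (deriv f) volume a b := by
  have h := (intervalIntegrable_ofReal hf.re.intervalIntegrable_deriv).add
    ((intervalIntegrable_ofReal hf.im.intervalIntegrable_deriv).mul_const Complex.I)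
  refine h.congr_ae ?_
  rw [Filter.EventuallyEq, ae_restrict_iff' measurableSet_uIoc]
  filter_upwards [hf.ae_deriv_eq] with x hx hm
  exact (hx hm).symm

/-- The fundamental theorem of calculus for absolutely continuous complex functions. -/
theorem AbsolutelyContinuousOnInterval.integral_deriv_complex
    (hf : AbsolutelyContinuousOnInterval f a b) :
    ∫ x in a..b, deriv f x = f b - f a := by
  rw [intervalIntegral.integral_congr_ae hf.ae_deriv_eq, intervalIntegral.integral_add
    (intervalIntegrable_ofReal hf.re.intervalIntegrable_deriv)
    ((intervalIntegrable_ofReal hf.im.intervalIntegrable_deriv).mul_const _),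
    intervalIntegral.integral_mul_const, intervalIntegral.integral_ofReal,
    intervalIntegral.integral_ofReal, hf.re.integral_deriv_eq_sub, hf.im.integral_deriv_eq_sub]
  apply Complex.ext <;> simp

theorem absolutelyContinuous_of_hasDerivWithinAt {g' : ℝ → ℂ} (hab : a ≤ b)
    (hg : ∀ x ∈ Icc a b, HasDerivWithinAt g (g' x) (Icc a b) x)
    (hg' : ContinuousOn g' (Icc a b)) : AbsolutelyContinuousOnInterval g a b := by
  obtain ⟨C, hC⟩ := isCompact_Icc.exists_bound_of_continuousOn hg'
  have hL : LipschitzOnWith (Real.toNNReal C) g (uIcc a b) := by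
    rw [uIcc_of_le hab]
    refine (convex_Icc a b).lipschitzOnWith_of_nnnorm_hasDerivWithin_le hg fun x hx => ?_
    rw [← NNReal.coe_le_coe]
    exact (hC x hx).trans (Real.le_coe_toNNReal C)
  exact hL.absolutelyContinuousOnInterval

/-- Integration by parts, for an absolutely continuous factor `f` and a `C¹` factor `g`. -/
theorem integral_mul_eq_sub_of_ac {g' : ℝ → ℂ} (hf : AbsolutelyContinuousOnInterval f 0 1)
    (hg : ∀ x, HasDerivAt g (g' x) x) (hg' : Continuous g') {x : ℝ} (hx : x ∈ Icc (0 : ℝ) 1) :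
    ∫ t in (0 : ℝ)..x, f t * g' t
      = f x * g x - f 0 * g 0 - ∫ t in (0 : ℝ)..x, deriv f t * g t := by
  have hf : AbsolutelyContinuousOnInterval f 0 x := hf.mono (by
    rw [uIcc_of_le hx.1, uIcc_of_le zero_le_one]; exact Icc_subset_Icc_right hx.2)
  have hgc : Continuous g := continuous_iff_continuousAt.2 fun x => (hg x).continuousAt
  have hgac : AbsolutelyContinuousOnInterval g 0 x :=
    absolutelyContinuous_of_hasDerivWithinAt hx.1 (fun t _ => (hg t).hasDerivWithinAt)
      hg'.continuousOn
  have h := (hf.fun_smul hgac).integral_deriv_complex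
  have h2 : ∫ t in (0 : ℝ)..x, deriv (fun t => f t • g t) t
      = ∫ t in (0 : ℝ)..x, (f t * g' t + deriv f t * g t) := by
    refine intervalIntegral.integral_congr_ae ?_
    filter_upwards [hf.ae_hasDerivAt] with t ht hm
    have := (ht (uIoc_subset_uIcc hm)).mul (hg t)
    exact this.deriv.trans (by ring)
  rw [h2, intervalIntegral.integral_add] at h
  · simp only [smul_eq_mul] at h
    linear_combination h
  · exact (hf.continuousOn.mul hg'.continuousOn).intervalIntegrable
  · exact hf.intervalIntegrable_deriv_complex.mul_continuousOn hgc.continuousOn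

end AbsolutelyContinuous

namespace SturmLiouville

/-! ### The Volterra operator and the initial value problem -/

/-- The Banach algebra `C[0,1]` of continuous complex functions on `[0,1]`, as a type of its own:
its only normed structure is the one of a commutative Banach algebra. -/
def CI : Type := C(unitInterval, ℂ)

namespace CI

instance : NormedCommRing CI := inferInstanceAs (NormedCommRing C(unitInterval, ℂ))

instance : NormedAlgebra ℂ CI := inferInstanceAs (NormedAlgebra ℂ C(unitInterval, ℂ))

instance : CompleteSpace CI := inferInstanceAs (CompleteSpace C(unitInterval, ℂ))

instance : FunLike CI unitInterval ℂ :=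
  inferInstanceAs (FunLike C(unitInterval, ℂ) unitInterval ℂ)

@[simp] theorem add_apply (f g : CI) (x : unitInterval) : (f + g) x = f x + g x := rfl

@[simp] theorem sub_apply (f g : CI) (x : unitInterval) : (f - g) x = f x - g x := rfl

@[simp] theorem mul_apply (f g : CI) (x : unitInterval) : (f * g) x = f x * g x := rfl

@[simp] theorem smul_apply (c : ℂ) (f : CI) (x : unitInterval) : (c • f) x = c * f x := rfl

@[simp] theorem one_apply (x : unitInterval) : (1 : CI) x = 1 := rfl

@[simp] theorem zero_apply (x : unitInterval) : (0 : CI) x = 0 := rfl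

theorem continuous_coe (f : CI) : Continuous f := ContinuousMap.continuous f

theorem norm_apply_le (f : CI) (x : unitInterval) : ‖f x‖ ≤ ‖f‖ :=
  ContinuousMap.norm_coe_le_norm f x

theorem norm_le {f : CI} {C : ℝ} (hC : 0 ≤ C) : ‖f‖ ≤ C ↔ ∀ x, ‖f x‖ ≤ C :=
  ContinuousMap.norm_le f hC

@[ext] theorem ext {f g : CI} (h : ∀ x, f x = g x) : f = g := DFunLike.ext _ _ h

/-- A continuous function on `[0,1]` as an element of `CI`. -/
def mk (f : unitInterval → ℂ) (hf : Continuous f) : CI := ContinuousMap.mk f hf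

@[simp] theorem mk_apply (f : unitInterval → ℂ) (hf : Continuous f) (x : unitInterval) :
    mk f hf x = f x := rfl

/-- Evaluation at a point of `[0,1]`. -/
def eval (x : unitInterval) : CI →L[ℂ] ℂ :=
  LinearMap.mkContinuous
    { toFun := fun f => f x
      map_add' := fun _ _ => rfl
      map_smul' := fun _ _ => rfl } 1
    (fun f => by rw [one_mul]; exact norm_apply_le f x)

end CI

/-- The continuous extension of a function on `[0,1]` to the real line, constant on both sides. -/
abbrev extend (f : CI) : ℝ → ℂ := IccExtend (zero_le_one (α := ℝ)) (f : unitInterval → ℂ)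

theorem continuous_extend (f : CI) : Continuous (extend f) := f.continuous_coe.Icc_extend'

theorem extend_apply (f : CI) {x : ℝ} (hx : x ∈ Icc (0 : ℝ) 1) : extend f x = f ⟨x, hx⟩ :=
  IccExtend_of_mem _ _ hx

theorem extend_coe (f : CI) (x : unitInterval) : extend f x = f x := extend_apply f x.2

theorem norm_extend_le (f : CI) (x : ℝ) : ‖extend f x‖ ≤ ‖f‖ := f.norm_apply_le _

/-- The Volterra operator `f ↦ ∫₀ˣ f` on `C[0,1]`. -/
def volterra : CI →L[ℂ] CI :=
  LinearMap.mkContinuous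
    { toFun := fun f => CI.mk (fun x => ∫ t in (0 : ℝ)..x, extend f t)
        ((intervalIntegral.continuous_primitive
          (fun _ _ => (continuous_extend f).intervalIntegrable _ _) 0).comp continuous_subtype_val)
      map_add' := fun f g => by
        ext x
        exact intervalIntegral.integral_add ((continuous_extend f).intervalIntegrable _ _)
          ((continuous_extend g).intervalIntegrable _ _)
      map_smul' := fun c f => by
        ext x
        exact intervalIntegral.integral_smul c (extend f) } 1 (fun f => by
    rw [one_mul, CI.norm_le (norm_nonneg _)]
    intro x
    refine (intervalIntegral.norm_integral_le_of_norm_le_const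
      fun t _ => norm_extend_le f t).trans ?_
    rw [sub_zero, abs_of_nonneg x.2.1]
    exact mul_le_of_le_one_right (norm_nonneg _) x.2.2)

theorem volterra_apply (f : CI) (x : unitInterval) :
    volterra f x = ∫ t in (0 : ℝ)..x, extend f t := rfl

theorem volterra_zero (f : CI) : volterra f 0 = 0 := by
  simp [volterra_apply]

theorem norm_volterra_le {f : CI} {B : ℝ} {n : ℕ}
    (h : ∀ x : unitInterval, ‖f x‖ ≤ B * ((x : ℝ) ^ n / n.factorial)) (x : unitInterval) :
    ‖volterra f x‖ ≤ B * ((x : ℝ) ^ (n + 1) / (n + 1).factorial) := by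
  have h1 : ‖volterra f x‖ ≤ ∫ t in (0 : ℝ)..x, B * (t ^ n / n.factorial) := by
    refine intervalIntegral.norm_integral_le_of_norm_le x.2.1 (ae_of_all _ fun t ht => ?_)
      ((by fun_prop : Continuous fun t : ℝ => B * (t ^ n / n.factorial)).intervalIntegrable _ _)
    have ht' : t ∈ Icc (0 : ℝ) 1 := ⟨ht.1.le, ht.2.trans x.2.2⟩
    rw [extend_apply f ht']
    exact h ⟨t, ht'⟩
  refine h1.trans_eq ?_
  rw [intervalIntegral.integral_const_mul, intervalIntegral.integral_div, integral_pow,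
    Nat.factorial_succ]
  push_cast
  field_simp
  simp

/-- The integral operator `u ↦ ∫₀ˣ∫₀ᵗ (q - lam) u`, whose resolvent solves `-y'' + q y = lam y`. -/
def volterraK (q : CI) (lam : ℂ) : CI →L[ℂ] CI :=
  (volterra * volterra) * (ContinuousLinearMap.mul ℂ CI (q - algebraMap ℂ CI lam))

theorem volterraK_apply (q : CI) (lam : ℂ) (u : CI) :
    volterraK q lam u = volterra (volterra ((q - algebraMap ℂ CI lam) * u)) := rfl

theorem norm_volterraK_pow_apply_le (q : CI) (lam : ℂ) (u : CI) (n : ℕ) (x : unitInterval) :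
    ‖(volterraK q lam ^ n) u x‖ ≤ ‖q - algebraMap ℂ CI lam‖ ^ n * ‖u‖ *
      ((x : ℝ) ^ (2 * n) / (2 * n).factorial) := by
  induction n generalizing x with
  | zero => simpa using u.norm_apply_le x
  | succ n ih =>
    rw [pow_succ', mul_apply_eq_comp, volterraK_apply]
    set v := (volterraK q lam ^ n) u
    have h : ∀ x : unitInterval, ‖((q - algebraMap ℂ CI lam) * v) x‖ ≤
        ‖q - algebraMap ℂ CI lam‖ ^ (n + 1) * ‖u‖ * ((x : ℝ) ^ (2 * n) / (2 * n).factorial) := by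
      intro x
      rw [CI.mul_apply, norm_mul, pow_succ', mul_assoc, mul_assoc]
      gcongr
      · exact CI.norm_apply_le _ x
      · rw [← mul_assoc]; exact ih x
    exact norm_volterra_le (norm_volterra_le h) x

/-- Volterra operators are quasi-nilpotent: some power of `volterraK q lam` has norm below one. -/
theorem isUnit_one_sub_volterraK (q : CI) (lam : ℂ) : IsUnit (1 - volterraK q lam) := by
  set K := volterraK q lam with hK
  set M := ‖q - algebraMap ℂ CI lam‖
  have hpow : ∀ n : ℕ, ‖K ^ n‖ ≤ M ^ n / n.factorial := by
    intro n
    refine ContinuousLinearMap.opNorm_le_bound _ (by positivity) fun u => ?_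
    rw [CI.norm_le (by positivity)]
    intro x
    refine (norm_volterraK_pow_apply_le q lam u n x).trans ?_
    rw [div_mul_eq_mul_div, mul_div_assoc']
    have h1 : (x : ℝ) ^ (2 * n) ≤ 1 := pow_le_one₀ x.2.1 x.2.2
    have h2 : (n.factorial : ℝ) ≤ (2 * n).factorial := by
      exact_mod_cast Nat.factorial_le (by omega)
    have h0 : 0 ≤ M ^ n * ‖u‖ := by positivity
    have h3 : (0 : ℝ) < n.factorial := by positivity
    have h4 : (0 : ℝ) ≤ (x : ℝ) ^ (2 * n) := pow_nonneg x.2.1 _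
    calc M ^ n * ‖u‖ * (x : ℝ) ^ (2 * n) / (2 * n).factorial
        ≤ M ^ n * ‖u‖ * 1 / n.factorial := by gcongr
      _ = _ := by rw [mul_one]
  obtain ⟨n, hn⟩ := (((FloorSemiring.tendsto_pow_div_factorial_atTop M)).eventually
    (gt_mem_nhds one_pos)).exists
  have hu : IsUnit (1 - K ^ n) := isUnit_one_sub_of_norm_lt_one ((hpow n).trans_lt hn)
  have hc : Commute (1 - K) (∑ i ∈ Finset.range n, K ^ i) := by
    refine Commute.sum_right _ _ _ fun i _ => ?_
    exact (Commute.one_left _).sub_left (Commute.self_pow K i)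
  rw [← mul_neg_geom_sum] at hu
  exact (hc.isUnit_mul_iff.1 hu).1

/-- The resolvent `(1 - volterraK q lam)⁻¹`. -/
def resolventK (q : CI) (lam : ℂ) : CI →L[ℂ] CI := Ring.inverse (1 - volterraK q lam)

theorem eq_resolventK_iff {q : CI} {lam : ℂ} {u f : CI} :
    u = resolventK q lam f ↔ u = f + volterraK q lam u := by
  have h := isUnit_one_sub_volterraK q lam
  have h1 := Ring.mul_inverse_cancel _ h
  have h2 := Ring.inverse_mul_cancel _ h
  constructor
  · intro hu
    have h3 := DFunLike.congr_fun h1 f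
    simp only [mul_apply_eq_comp, _root_.sub_apply,
      one_apply_eq_self] at h3
    rw [hu, resolventK]
    exact sub_eq_iff_eq_add.1 h3
  · intro hu
    have h3 := DFunLike.congr_fun h2 u
    simp only [mul_apply_eq_comp, _root_.sub_apply,
      one_apply_eq_self] at h3
    rw [← sub_eq_iff_eq_add] at hu
    rw [← hu, resolventK, h3]

theorem hasDerivAt_resolventK (q : CI) (lam : ℂ) :
    HasDerivAt (resolventK q)
      (-(resolventK q lam * (volterra * volterra) * resolventK q lam)) lam := by
  obtain ⟨U, hU⟩ := isUnit_one_sub_volterraK q lam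
  have h1 : HasDerivAt (fun l => 1 - volterraK q l) (volterra * volterra) lam := by
    have h : (fun l => 1 - volterraK q l)
        = fun l => (1 - volterraK q 0) + l • (volterra * volterra) := by
      funext l
      ext u : 1
      simp only [_root_.sub_apply, _root_.add_apply,
        volterraK_apply, map_zero, sub_zero, sub_mul, map_sub, _root_.smul_apply,
        mul_apply_eq_comp, Algebra.algebraMap_eq_smul_one, smul_mul_assoc, one_mul,
        map_smul]
      module
    rw [h]
    simpa using ((hasDerivAt_id lam).smul_const (volterra * volterra)).const_add
      (1 - volterraK q 0)
  have h2 := hasFDerivAt_ringInverse (𝕜 := ℂ) U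
  rw [hU] at h2
  have h3 := h2.comp_hasDerivAt lam h1
  have hi : (↑U⁻¹ : CI →L[ℂ] CI) = resolventK q lam := by
    rw [resolventK, ← hU, Ring.inverse_unit]
  rw [hi] at h3
  exact h3

/-- The function `x ↦ x` on `[0,1]`. -/
def coordI : CI := CI.mk (fun x => ((x : ℝ) : ℂ)) (by fun_prop)

theorem volterra_one : volterra 1 = coordI := by
  ext x
  rw [volterra_apply]
  have : ∀ t : ℝ, extend 1 t = 1 := fun t => rfl
  simp [this, coordI]

/-- The solution of `-y'' + q y = lam y + h` with `y 0 = a`, `y' 0 = b`. -/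
def sol (q : CI) (lam a b : ℂ) (h : CI) : CI :=
  resolventK q lam (a • 1 + b • coordI - volterra (volterra h))

/-- The derivative of `sol q lam a b h`. -/
def dsol (q : CI) (lam a b : ℂ) (h : CI) : CI :=
  b • 1 + volterra ((q - algebraMap ℂ CI lam) * sol q lam a b h - h)

theorem sol_eq (q : CI) (lam a b : ℂ) (h : CI) :
    sol q lam a b h = a • 1 + volterra (dsol q lam a b h) := by
  have h1 := eq_resolventK_iff.1 (rfl : sol q lam a b h = resolventK q lam _)
  rw [volterraK_apply] at h1
  rw [dsol, map_add, map_smul, volterra_one, map_sub, map_sub]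
  nth_rewrite 1 [h1]
  module

theorem eq_sol {q : CI} {lam a b : ℂ} {h u d : CI} (hu : u = a • 1 + volterra d)
    (hd : d = b • 1 + volterra ((q - algebraMap ℂ CI lam) * u - h)) :
    u = sol q lam a b h ∧ d = dsol q lam a b h := by
  have h1 : u = sol q lam a b h := by
    refine eq_resolventK_iff.2 ?_
    rw [volterraK_apply]
    nth_rewrite 1 [hu]
    rw [hd, map_add, map_smul, volterra_one, map_sub, map_sub]
    module
  refine ⟨h1, ?_⟩
  rw [hd, dsol, ← h1]

theorem sol_zero_apply (q : CI) (lam a b : ℂ) (h : CI) : sol q lam a b h 0 = a := by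
  rw [sol_eq]; simp [volterra_zero]

theorem dsol_zero_apply (q : CI) (lam a b : ℂ) (h : CI) : dsol q lam a b h 0 = b := by
  rw [dsol]; simp [volterra_zero]

theorem sol_linear (q : CI) (lam a b : ℂ) (h : CI) : sol q lam a b h =
    a • sol q lam 1 0 0 + b • sol q lam 0 1 0 + sol q lam 0 0 h := by
  simp only [sol, map_add, map_sub, map_smul, zero_smul, one_smul, map_zero]
  module

theorem dsol_linear (q : CI) (lam a b : ℂ) (h : CI) : dsol q lam a b h =
    a • dsol q lam 1 0 0 + b • dsol q lam 0 1 0 + dsol q lam 0 0 h := by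
  simp only [dsol]
  rw [sol_linear]
  simp only [mul_add, map_add, map_sub, sub_zero, mul_smul_comm, map_smul, smul_add, zero_smul,
    one_smul, smul_zero]
  module

/-- The derivative of a solution in the spectral parameter solves the inhomogeneous equation with
the solution itself on the right-hand side. -/
theorem hasDerivAt_sol (q : CI) (lam a b : ℂ) :
    HasDerivAt (fun l => sol q l a b 0) (sol q lam 0 0 (sol q lam a b 0)) lam := by
  have h := (hasDerivAt_resolventK q lam).clm_apply
    (hasDerivAt_const lam (a • 1 + b • coordI - volterra (volterra 0)))
  refine h.congr_deriv ?_
  simp [sol]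

theorem hasDerivAt_dsol (q : CI) (lam a b : ℂ) :
    HasDerivAt (fun l => dsol q l a b 0) (dsol q lam 0 0 (sol q lam a b 0)) lam := by
  have h1 : HasDerivAt (fun l : ℂ => q - algebraMap ℂ CI l) (-1) lam := by
    simp only [Algebra.algebraMap_eq_smul_one]
    simpa using ((hasDerivAt_id lam).smul_const (1 : CI)).const_sub q
  have h := ((volterra.hasFDerivAt.comp_hasDerivAt lam
    ((h1.mul (hasDerivAt_sol q lam a b)).sub_const 0)).const_add (b • (1 : CI)))
  refine h.congr_deriv ?_
  simp only [dsol, zero_smul, zero_add]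
  congr 1
  ring

theorem hasDerivAt_sol_one (q : CI) (lam a b : ℂ) :
    HasDerivAt (fun l => sol q l a b 0 1) (sol q lam 0 0 (sol q lam a b 0) 1) lam :=
  (CI.eval 1).hasFDerivAt.comp_hasDerivAt lam
    (hasDerivAt_sol q lam a b)

theorem hasDerivAt_dsol_one (q : CI) (lam a b : ℂ) :
    HasDerivAt (fun l => dsol q l a b 0 1) (dsol q lam 0 0 (sol q lam a b 0) 1) lam :=
  (CI.eval 1).hasFDerivAt.comp_hasDerivAt lam
    (hasDerivAt_dsol q lam a b)

/-- `y` is a classical solution of `-y'' + q y = lam y + h` on `[0,1]`, with derivative `dy`. -/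
structure IsSol (q : ℝ → ℂ) (lam : ℂ) (h y dy : ℝ → ℂ) : Prop where
  deriv₁ : ∀ x ∈ Icc (0 : ℝ) 1, HasDerivWithinAt y (dy x) (Icc 0 1) x
  deriv₂ : ∀ x ∈ Icc (0 : ℝ) 1,
    HasDerivWithinAt dy ((q x - lam) * y x - h x) (Icc 0 1) x

theorem hasDerivWithinAt_extend_volterra (a : ℂ) (f : CI) {x : ℝ} (hx : x ∈ Icc (0 : ℝ) 1) :
    HasDerivWithinAt (extend (a • 1 + volterra f)) (extend f x) (Icc 0 1) x := by
  have h : HasDerivAt (fun x => a + ∫ t in (0 : ℝ)..x, extend f t) (extend f x) x :=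
    (intervalIntegral.integral_hasDerivAt_right ((continuous_extend f).intervalIntegrable _ _)
      ((continuous_extend f).stronglyMeasurableAtFilter _ _)
      (continuous_extend f).continuousAt).const_add a
  refine h.hasDerivWithinAt.congr (fun t ht => ?_) ?_
  · rw [extend_apply _ ht]; simp [volterra_apply]
  · rw [extend_apply _ hx]; simp [volterra_apply]

theorem eq_volterra {y dy : ℝ → ℂ} {u d : CI}
    (hy : ∀ x ∈ Icc (0 : ℝ) 1, HasDerivWithinAt y (dy x) (Icc 0 1) x)
    (hu : ∀ x : unitInterval, u x = y x) (hd : ∀ x : unitInterval, d x = dy x) :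
    u = y 0 • 1 + volterra d := by
  ext x
  have h0 : ∀ t ∈ Icc (0 : ℝ) x, t ∈ Icc (0 : ℝ) 1 := fun t ht => ⟨ht.1, ht.2.trans x.2.2⟩
  have h := intervalIntegral.integral_eq_sub_of_hasDerivAt_of_le (f := y) (f' := extend d) x.2.1
    (fun t ht => (hy t (h0 t ht)).continuousWithinAt.mono h0)
    (fun t ht => by
      have ht' := h0 t (Ioo_subset_Icc_self ht)
      rw [extend_apply d ht', hd]
      exact (hy t ht').hasDerivAt (Icc_mem_nhds ht.1 (ht.2.trans_le x.2.2)))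
    ((continuous_extend d).intervalIntegrable _ _)
  simp [volterra_apply, h, hu]

theorem isSol_sol (q : CI) (lam a b : ℂ) (h : CI) :
    IsSol (extend q) lam (extend h) (extend (sol q lam a b h)) (extend (dsol q lam a b h)) := by
  constructor
  · intro x hx
    rw [sol_eq]
    exact hasDerivWithinAt_extend_volterra a _ hx
  · intro x hx
    exact hasDerivWithinAt_extend_volterra b
      ((q - algebraMap ℂ CI lam) * sol q lam a b h - h) hx

theorem IsSol.continuousOn {q h y dy : ℝ → ℂ} {lam : ℂ} (H : IsSol q lam h y dy) :
    ContinuousOn y (Icc 0 1) := fun x hx => (H.deriv₁ x hx).continuousWithinAt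

theorem IsSol.continuousOn_deriv {q h y dy : ℝ → ℂ} {lam : ℂ} (H : IsSol q lam h y dy) :
    ContinuousOn dy (Icc 0 1) := fun x hx => (H.deriv₂ x hx).continuousWithinAt

theorem IsSol.congr {q h y dy q₁ h₁ : ℝ → ℂ} {lam : ℂ} (H : IsSol q lam h y dy)
    (hq : EqOn q₁ q (Icc 0 1)) (hh : EqOn h₁ h (Icc 0 1)) : IsSol q₁ lam h₁ y dy :=
  ⟨H.deriv₁, fun x hx => by rw [hq hx, hh hx]; exact H.deriv₂ x hx⟩

/-- Uniqueness for the initial value problem. -/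
theorem IsSol.eq_sol {q h : CI} {y dy : ℝ → ℂ} {lam : ℂ}
    (H : IsSol (extend q) lam (extend h) y dy) :
    EqOn y (extend (sol q lam (y 0) (dy 0) h)) (Icc 0 1) ∧
      EqOn dy (extend (dsol q lam (y 0) (dy 0) h)) (Icc 0 1) := by
  let u : CI := CI.mk (fun x => y x) (continuousOn_iff_continuous_domRestrict.1 H.continuousOn)
  let d : CI := CI.mk (fun x => dy x)
    (continuousOn_iff_continuous_domRestrict.1 H.continuousOn_deriv)
  have h1 := eq_volterra (u := u) (d := d) H.deriv₁ (fun _ => rfl) (fun _ => rfl)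
  have h2 := eq_volterra (u := d) (d := (q - algebraMap ℂ CI lam) * u - h) H.deriv₂
    (fun _ => rfl) (fun x => by
      rw [extend_coe, extend_coe]; rfl)
  obtain ⟨e1, e2⟩ := SturmLiouville.eq_sol h1 h2
  constructor <;> intro x hx <;> rw [extend_apply _ hx]
  · exact DFunLike.congr_fun e1 ⟨x, hx⟩
  · exact DFunLike.congr_fun e2 ⟨x, hx⟩

/-- The Lagrange identity: the Wronskian of two solutions for the same `lam` is constant. -/
theorem IsSol.wronskian_eq {q y dy z dz : ℝ → ℂ} {lam : ℂ} (H : IsSol q lam 0 y dy)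
    (G : IsSol q lam 0 z dz) : y 1 * dz 1 - dy 1 * z 1 = y 0 * dz 0 - dy 0 * z 0 := by
  have h : ∀ x ∈ Icc (0 : ℝ) 1,
      HasDerivWithinAt (fun x => y x * dz x - dy x * z x) 0 (Icc 0 1) x := fun x hx => by
    refine (((H.deriv₁ x hx).mul (G.deriv₂ x hx)).sub
      ((H.deriv₂ x hx).mul (G.deriv₁ x hx))).congr_deriv ?_
    simp only [Pi.zero_apply]
    ring
  have := (convex_Icc (0 : ℝ) 1).norm_image_sub_le_of_norm_hasDerivWithin_le (C := 0) h
    (by simp) (left_mem_Icc.2 zero_le_one) (right_mem_Icc.2 zero_le_one)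
  rw [zero_mul, norm_le_zero_iff, sub_eq_zero] at this
  exact this

/-! ### The operator in terms of classical solutions -/

/-- A continuous function on `[0,1]` as an element of `L₂[0,1]`. -/
def toL2 (u : CI) : L2 :=
  MemLp.toLp (extend u)
    (MemLp.of_bound (continuous_extend u).aestronglyMeasurable ‖u‖ (ae_of_all _ (norm_extend_le u)))

theorem coeFn_toL2 (u : CI) : toL2 u =ᵐ[volume.restrict (Icc (0 : ℝ) 1)] extend u :=
  MemLp.coeFn_toLp _

theorem toL2_eq_of_ae {u : CI} {f : L2}
    (h : f =ᵐ[volume.restrict (Icc (0 : ℝ) 1)] extend u) : f = toL2 u :=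
  Lp.ext (h.trans (coeFn_toL2 u).symm)

theorem toL2_add (u v : CI) : toL2 (u + v) = toL2 u + toL2 v := by
  symm
  refine toL2_eq_of_ae ?_
  filter_upwards [Lp.coeFn_add (toL2 u) (toL2 v), coeFn_toL2 u, coeFn_toL2 v] with x h1 h2 h3
  rw [h1, Pi.add_apply, h2, h3]
  rfl

theorem toL2_smul (c : ℂ) (u : CI) : toL2 (c • u) = c • toL2 u := by
  symm
  refine toL2_eq_of_ae ?_
  filter_upwards [Lp.coeFn_smul c (toL2 u), coeFn_toL2 u] with x h1 h2
  rw [h1, Pi.smul_apply, h2]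
  rfl

theorem toL2_zero : toL2 0 = 0 := by
  have := toL2_smul 0 0
  rwa [zero_smul, zero_smul] at this

theorem toL2_injective : Function.Injective toL2 := by
  intro u v h
  have h1 : extend u =ᵐ[volume.restrict (Icc (0 : ℝ) 1)] extend v :=
    (coeFn_toL2 u).symm.trans ((by rw [h]) : EventuallyEq _ _ _) |>.trans (coeFn_toL2 v)
  have h2 := Measure.eqOn_Icc_of_ae_eq volume zero_ne_one h1
    (continuous_extend u).continuousOn (continuous_extend v).continuousOn
  ext x
  rw [← extend_coe, ← extend_coe]
  exact h2 x.2

theorem mem_graph_iff_T {β₁ β₂ : ℂ} {q : ℝ → ℂ} {f g : L2} :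
    (∃ h : f ∈ (T β₁ β₂ q).domain, (T β₁ β₂ q) ⟨f, h⟩ = g) ↔ (f, g) ∈ graph β₁ β₂ q := by
  rw [← T_graph, LinearPMap.mem_graph_iff]
  constructor
  · rintro ⟨h, e⟩; exact ⟨⟨f, h⟩, rfl, e⟩
  · rintro ⟨⟨f', h⟩, e1, e2⟩
    obtain rfl : f' = f := e1
    exact ⟨h, e2⟩

theorem mem_kerPow_succ {β₁ β₂ : ℂ} {q : ℝ → ℂ} {lam : ℂ} {k : ℕ} {f : L2} :
    f ∈ kerPow (T β₁ β₂ q) lam (k + 1) ↔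
      ∃ g, (f, g) ∈ graph β₁ β₂ q ∧ g - lam • f ∈ kerPow (T β₁ β₂ q) lam k := by
  simp only [kerPow, Submodule.mem_map, Submodule.mem_comap]
  constructor
  · rintro ⟨⟨f', h⟩, e1, e2⟩
    obtain rfl : f' = f := e2
    exact ⟨_, mem_graph_iff_T.1 ⟨h, rfl⟩, e1⟩
  · rintro ⟨g, hg, e⟩
    obtain ⟨h, rfl⟩ := mem_graph_iff_T.2 hg
    exact ⟨⟨f, h⟩, e, rfl⟩

theorem IsSol.D_eq {q h y dy : ℝ → ℂ} {lam : ℂ} (H : IsSol q lam h y dy) :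
    EqOn (D y) dy (Icc 0 1) := fun x hx =>
  (H.deriv₁ x hx).derivWithin (uniqueDiffOn_Icc zero_lt_one x hx)

theorem IsSol.D_D_eq {q h y dy : ℝ → ℂ} {lam : ℂ} (H : IsSol q lam h y dy) :
    EqOn (D (D y)) (fun x => (q x - lam) * y x - h x) (Icc 0 1) := fun x hx =>
  ((H.deriv₂ x hx).congr H.D_eq (H.D_eq hx)).derivWithin (uniqueDiffOn_Icc zero_lt_one x hx)

theorem IsSol.admissible {q h y dy : ℝ → ℂ} {lam β₁ β₂ : ℂ} (H : IsSol q lam h y dy)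
    (hq : ContinuousOn q (Icc 0 1)) (hh : ContinuousOn h (Icc 0 1))
    (h₁ : dy 0 + β₁ * dy 1 + β₂ * y 1 = 0) (h₂ : y 0 - y 1 = 0) : Admissible β₁ β₂ y where
  diff := fun x hx => (H.deriv₁ x hx).differentiableWithinAt
  ac := by
    have h := absolutelyContinuous_of_hasDerivWithinAt zero_le_one H.deriv₂
      (((hq.sub continuousOn_const).mul H.continuousOn).sub hh)
    refine absolutelyContinuous_of_dist_le h fun x hx z hz => ?_
    rw [uIcc_of_le zero_le_one] at hx hz
    rw [H.D_eq hx, H.D_eq hz]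
  bc₁ := by
    rw [H.D_eq (left_mem_Icc.2 zero_le_one), H.D_eq (right_mem_Icc.2 zero_le_one), h₁]
  bc₂ := h₂

theorem Admissible.hasDerivWithinAt {β₁ β₂ : ℂ} {y : ℝ → ℂ} (hy : Admissible β₁ β₂ y) {x : ℝ}
    (hx : x ∈ Icc (0 : ℝ) 1) : HasDerivWithinAt y (D y x) (Icc 0 1) x :=
  (hy.diff x hx).hasDerivWithinAt

theorem D_eq_deriv {y : ℝ → ℂ} {x : ℝ} (hx : x ∈ Ioo (0 : ℝ) 1) : D y x = deriv y x :=
  derivWithin_of_mem_nhds (Icc_mem_nhds hx.1 hx.2)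

/-- An admissible function whose second derivative agrees almost everywhere with the one prescribed
by a continuous right-hand side is a classical solution. -/
theorem Admissible.isSol {q h y : ℝ → ℂ} {lam β₁ β₂ : ℂ} (hy : Admissible β₁ β₂ y)
    (hq : ContinuousOn q (Icc 0 1)) (hh : ContinuousOn h (Icc 0 1))
    (he : ∀ᵐ x ∂(volume.restrict (Icc (0 : ℝ) 1)), D (D y) x = (q x - lam) * y x - h x) :
    IsSol q lam h y (D y) := by
  have hr : ContinuousOn (fun x => (q x - lam) * y x - h x) (Icc 0 1) :=
    ((hq.sub continuousOn_const).mul hy.diff.continuousOn).sub hh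
  let r : CI := CI.mk (fun x => (q x - lam) * y x - h x)
    (continuousOn_iff_continuous_domRestrict.1 hr)
  have hre : ∀ x (hx : x ∈ Icc (0 : ℝ) 1), extend r x = (q x - lam) * y x - h x :=
    fun x hx => extend_apply r hx
  have key : EqOn (D y) (extend (D y 0 • 1 + volterra r)) (Icc 0 1) := by
    intro x hx
    have h0 : uIcc 0 x ⊆ uIcc (0 : ℝ) 1 := by
      rw [uIcc_of_le hx.1, uIcc_of_le zero_le_one]; exact Icc_subset_Icc_right hx.2
    have h1 := (hy.ac.mono h0).integral_deriv_complex
    have h2 : ∫ t in (0 : ℝ)..x, deriv (D y) t = ∫ t in (0 : ℝ)..x, extend r t := by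
      refine intervalIntegral.integral_congr_ae ?_
      rw [ae_restrict_iff' measurableSet_Icc] at he
      filter_upwards [he, Measure.ae_ne volume (1 : ℝ)] with t ht ht1 htm
      rw [uIoc_of_le hx.1] at htm
      have ht' : t ∈ Ioo (0 : ℝ) 1 := ⟨htm.1, lt_of_le_of_ne (htm.2.trans hx.2) ht1⟩
      rw [← D_eq_deriv ht', ht (Ioo_subset_Icc_self ht'), hre t (Ioo_subset_Icc_self ht')]
    rw [extend_apply _ hx, CI.add_apply, CI.smul_apply, volterra_apply]
    simp only [CI.one_apply, mul_one]
    rw [← h2, h1]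
    ring
  refine ⟨fun x hx => hy.hasDerivWithinAt hx, fun x hx => ?_⟩
  rw [← hre x hx]
  exact (hasDerivWithinAt_extend_volterra (D y 0) r hx).congr key (key hx)

/-- Elements of the graph over a continuous right-hand side are classical solutions of the boundary
value problem. -/
theorem mem_graph_iff {β₁ β₂ lam : ℂ} {q : ℝ → ℂ} {p : CI} (hpq : EqOn q (extend p) (Icc 0 1))
    {f : L2} {h : CI} :
    (f, lam • f + toL2 h) ∈ graph β₁ β₂ q ↔ ∃ a b : ℂ, f = toL2 (sol p lam a b h) ∧
      b + β₁ * dsol p lam a b h 1 + β₂ * sol p lam a b h 1 = 0 ∧ a - sol p lam a b h 1 = 0 := by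
  have hqc : ContinuousOn q (Icc 0 1) := (continuous_extend p).continuousOn.congr hpq
  have e0 : ∀ u : CI, extend u 0 = u 0 := fun u => extend_coe u 0
  have e1 : ∀ u : CI, extend u 1 = u 1 := fun u => extend_coe u 1
  constructor
  · rintro ⟨y, hy, h1, h2⟩
    simp only at h1 h2
    have he : ∀ᵐ x ∂(volume.restrict (Icc (0 : ℝ) 1)),
        D (D y) x = (q x - lam) * y x - extend h x := by
      filter_upwards [h1, h2, Lp.coeFn_add (lam • f) (toL2 h), Lp.coeFn_smul lam f,
        coeFn_toL2 h] with x a1 a2 a3 a4 a5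
      rw [a3, Pi.add_apply, a4, a5, Pi.smul_apply, a1, smul_eq_mul] at a2
      linear_combination a2
    have H := (hy.isSol hqc (continuous_extend h).continuousOn he).congr hpq.symm (fun _ _ => rfl)
    obtain ⟨E1, E2⟩ := H.eq_sol
    have F1 := E1 (right_mem_Icc.2 zero_le_one)
    have F2 := E2 (right_mem_Icc.2 zero_le_one)
    rw [e1] at F1 F2
    refine ⟨y 0, D y 0, toL2_eq_of_ae (h1.trans ?_), ?_, ?_⟩
    · filter_upwards [ae_restrict_mem measurableSet_Icc] with x hx using E1 hx
    · rw [← F1, ← F2]; exact hy.bc₁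
    · rw [← F1]; exact hy.bc₂
  · rintro ⟨a, b, rfl, h1, h2⟩
    have H := (isSol_sol p lam a b h).congr hpq (fun _ _ => rfl)
    refine ⟨_, H.admissible (β₁ := β₁) (β₂ := β₂) hqc (continuous_extend h).continuousOn ?_ ?_,
      coeFn_toL2 _, ?_⟩
    · rw [e0, e1, e1, dsol_zero_apply, h1]
    · rw [e0, e1, sol_zero_apply, h2]
    · filter_upwards [Lp.coeFn_add (lam • toL2 (sol p lam a b h)) (toL2 h),
        Lp.coeFn_smul lam (toL2 (sol p lam a b h)), coeFn_toL2 h, coeFn_toL2 (sol p lam a b h),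
        ae_restrict_mem measurableSet_Icc] with x a1 a2 a3 a4 hx
      rw [a1, Pi.add_apply, a2, a3, Pi.smul_apply, a4, H.D_D_eq hx, smul_eq_mul]
      ring

/-! ### The characteristic function and simple eigenvalues -/

/-- The characteristic function: the determinant of the boundary conditions on the fundamental
system `sol p lam 1 0 0`, `sol p lam 0 1 0`, simplified by means of the Wronskian. -/
def charFun (β₁ β₂ : ℂ) (p : CI) (lam : ℂ) : ℂ :=
  (1 - β₁) + β₁ * dsol p lam 0 1 0 1 - sol p lam 1 0 0 1 + β₂ * sol p lam 0 1 0 1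

theorem wronskian_one (p : CI) (lam : ℂ) :
    sol p lam 1 0 0 1 * dsol p lam 0 1 0 1 - dsol p lam 1 0 0 1 * sol p lam 0 1 0 1 = 1 := by
  have h := (isSol_sol p lam 1 0 0).wronskian_eq (isSol_sol p lam 0 1 0)
  have e0 : ∀ u : CI, extend u 0 = u 0 := fun u => extend_coe u 0
  have e1 : ∀ u : CI, extend u 1 = u 1 := fun u => extend_coe u 1
  simp only [e0, e1, sol_zero_apply, dsol_zero_apply] at h
  linear_combination h

theorem charFun_eq_det (β₁ β₂ : ℂ) (p : CI) (lam : ℂ) : charFun β₁ β₂ p lam =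
    (1 - sol p lam 1 0 0 1) * (1 + β₁ * dsol p lam 0 1 0 1 + β₂ * sol p lam 0 1 0 1) +
      sol p lam 0 1 0 1 * (β₁ * dsol p lam 1 0 0 1 + β₂ * sol p lam 1 0 0 1) := by
  rw [charFun]
  linear_combination β₁ * wronskian_one p lam

theorem exists_kernel_of_det_eq_zero {m₁₁ m₁₂ m₂₁ m₂₂ : ℂ} (h : m₁₁ * m₂₂ - m₁₂ * m₂₁ = 0) :
    ∃ a b : ℂ, (a ≠ 0 ∨ b ≠ 0) ∧ m₁₁ * a + m₁₂ * b = 0 ∧ m₂₁ * a + m₂₂ * b = 0 := by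
  by_cases h1 : m₁₂ ≠ 0 ∨ m₁₁ ≠ 0
  · exact ⟨m₁₂, -m₁₁, by simpa using h1, by ring, by linear_combination -h⟩
  · push Not at h1
    by_cases h2 : m₂₂ ≠ 0 ∨ m₂₁ ≠ 0
    · exact ⟨m₂₂, -m₂₁, by simpa using h2, by linear_combination h, by ring⟩
    · push Not at h2
      exact ⟨1, 0, by simp, by simp [h1], by simp [h2]⟩

theorem det_eq_zero_of_kernel {m₁₁ m₁₂ m₂₁ m₂₂ a b : ℂ} (hab : a ≠ 0 ∨ b ≠ 0)
    (h1 : m₁₁ * a + m₁₂ * b = 0) (h2 : m₂₁ * a + m₂₂ * b = 0) : m₁₁ * m₂₂ - m₁₂ * m₂₁ = 0 := by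
  rcases hab with h | h <;> refine (mul_eq_zero.1 ?_).resolve_left h
  · linear_combination m₂₂ * h1 - m₁₂ * h2
  · linear_combination -m₂₁ * h1 + m₁₁ * h2

section Simple

variable {β₁ β₂ lam : ℂ} {q : ℝ → ℂ} {p : CI}

theorem sol_one_eq (a b : ℂ) (h : CI) : sol p lam a b h 1 =
    a * sol p lam 1 0 0 1 + b * sol p lam 0 1 0 1 + sol p lam 0 0 h 1 := by
  rw [sol_linear]; rfl

theorem dsol_one_eq (a b : ℂ) (h : CI) : dsol p lam a b h 1 =
    a * dsol p lam 1 0 0 1 + b * dsol p lam 0 1 0 1 + dsol p lam 0 0 h 1 := by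
  rw [dsol_linear]; rfl

theorem sol_zero_zero_zero : sol p lam 0 0 0 = 0 := by simp [sol]

theorem dsol_zero_zero_zero : dsol p lam 0 0 0 = 0 := by simp [dsol, sol_zero_zero_zero]

theorem sol_ne_zero {a b : ℂ} (h : a ≠ 0 ∨ b ≠ 0) : sol p lam a b 0 ≠ 0 := by
  intro h0
  have ha : a = 0 := by rw [← sol_zero_apply p lam a b 0, h0]; rfl
  have hb : b = 0 := by
    have h1 := congrArg (fun u : CI => u 1) (sol_eq p lam a b 0)
    rw [dsol, h0, ha, mul_zero, sub_zero, map_zero, add_zero, map_smul, volterra_one] at h1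
    simpa [coordI] using h1.symm
  simp [ha, hb] at h

/-- The eigenfunctions for `lam`, in terms of their initial values. -/
theorem mem_kerPow_one (hpq : EqOn q (extend p) (Icc 0 1)) {f : L2} :
    f ∈ kerPow (T β₁ β₂ q) lam 1 ↔ ∃ a b : ℂ, f = toL2 (sol p lam a b 0) ∧
      (β₁ * dsol p lam 1 0 0 1 + β₂ * sol p lam 1 0 0 1) * a +
        (1 + β₁ * dsol p lam 0 1 0 1 + β₂ * sol p lam 0 1 0 1) * b = 0 ∧
      (1 - sol p lam 1 0 0 1) * a + (-sol p lam 0 1 0 1) * b = 0 := by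
  rw [mem_kerPow_succ]
  simp only [kerPow, Submodule.mem_bot]
  have h1 : (∃ g, (f, g) ∈ graph β₁ β₂ q ∧ g - lam • f = 0) ↔
      (f, lam • f + toL2 0) ∈ graph β₁ β₂ q := by
    rw [toL2_zero, add_zero]
    exact ⟨fun ⟨g, h, e⟩ => by rwa [← sub_eq_zero.1 e], fun h => ⟨_, h, sub_self _⟩⟩
  rw [h1, mem_graph_iff hpq]
  refine exists₂_congr fun a b => and_congr Iff.rfl ?_
  rw [sol_one_eq a b, dsol_one_eq a b, sol_zero_zero_zero, dsol_zero_zero_zero, CI.zero_apply]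
  refine and_congr ⟨fun h => ?_, fun h => ?_⟩ ⟨fun h => ?_, fun h => ?_⟩ <;>
    linear_combination h

theorem isEigenvalue_iff_kerPow_one :
    IsEigenvalue (T β₁ β₂ q) lam ↔ ∃ f ∈ kerPow (T β₁ β₂ q) lam 1, f ≠ 0 := by
  constructor
  · rintro ⟨f, hf, e⟩
    refine ⟨f, mem_kerPow_succ.2 ⟨_, mem_graph_iff_T.1 ⟨f.2, rfl⟩, ?_⟩, by simpa using hf⟩
    simp [kerPow, e]
  · rintro ⟨f, hf, h0⟩
    obtain ⟨g, hg, e⟩ := mem_kerPow_succ.1 hf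
    obtain ⟨h, rfl⟩ := mem_graph_iff_T.2 hg
    refine ⟨⟨f, h⟩, by simpa using h0, ?_⟩
    simpa [kerPow, sub_eq_zero] using e

theorem isEigenvalue_iff (hpq : EqOn q (extend p) (Icc 0 1)) :
    IsEigenvalue (T β₁ β₂ q) lam ↔ charFun β₁ β₂ p lam = 0 := by
  rw [isEigenvalue_iff_kerPow_one, charFun_eq_det]
  constructor
  · rintro ⟨f, hf, h0⟩
    obtain ⟨a, b, rfl, h1, h2⟩ := (mem_kerPow_one hpq).1 hf
    have hab : a ≠ 0 ∨ b ≠ 0 := by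
      by_contra! h
      rw [h.1, h.2, sol_zero_zero_zero, toL2_zero] at h0
      exact h0 rfl
    linear_combination -det_eq_zero_of_kernel hab h1 h2
  · intro h
    obtain ⟨a, b, hab, h1, h2⟩ := exists_kernel_of_det_eq_zero
      (m₁₁ := β₁ * dsol p lam 1 0 0 1 + β₂ * sol p lam 1 0 0 1)
      (m₁₂ := 1 + β₁ * dsol p lam 0 1 0 1 + β₂ * sol p lam 0 1 0 1)
      (m₂₁ := 1 - sol p lam 1 0 0 1) (m₂₂ := -sol p lam 0 1 0 1) (by linear_combination -h)
    refine ⟨_, (mem_kerPow_one hpq).2 ⟨a, b, rfl, h1, h2⟩,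
      fun h0 => sol_ne_zero (p := p) (lam := lam) hab ?_⟩
    exact toL2_injective (h0.trans toL2_zero.symm)

theorem hasDerivAt_charFun (β₁ β₂ : ℂ) (p : CI) (lam : ℂ) : HasDerivAt (charFun β₁ β₂ p)
    (β₁ * dsol p lam 0 0 (sol p lam 0 1 0) 1 - sol p lam 0 0 (sol p lam 1 0 0) 1 +
      β₂ * sol p lam 0 0 (sol p lam 0 1 0) 1) lam := by
  have h := ((((hasDerivAt_dsol_one p lam 0 1).const_mul β₁).const_add (1 - β₁)).sub
    (hasDerivAt_sol_one p lam 1 0)).add ((hasDerivAt_sol_one p lam 0 1).const_mul β₂)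
  exact h

/-- The derivative of the characteristic function as that of the determinant in `charFun_eq_det`. -/
theorem hasDerivAt_charFun_det (β₁ β₂ : ℂ) (p : CI) (lam : ℂ) : HasDerivAt (charFun β₁ β₂ p)
    (-sol p lam 0 0 (sol p lam 1 0 0) 1 *
        (1 + β₁ * dsol p lam 0 1 0 1 + β₂ * sol p lam 0 1 0 1) +
      (1 - sol p lam 1 0 0 1) * (β₁ * dsol p lam 0 0 (sol p lam 0 1 0) 1 +
        β₂ * sol p lam 0 0 (sol p lam 0 1 0) 1) +
      (sol p lam 0 0 (sol p lam 0 1 0) 1 *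
        (β₁ * dsol p lam 1 0 0 1 + β₂ * sol p lam 1 0 0 1) +
      sol p lam 0 1 0 1 * (β₁ * dsol p lam 0 0 (sol p lam 1 0 0) 1 +
        β₂ * sol p lam 0 0 (sol p lam 1 0 0) 1))) lam := by
  have h1 := hasDerivAt_sol_one p lam 1 0
  have h2 := hasDerivAt_sol_one p lam 0 1
  have h3 := hasDerivAt_dsol_one p lam 1 0
  have h4 := hasDerivAt_dsol_one p lam 0 1
  have h := ((h1.const_sub 1).mul (((h4.const_mul β₁).const_add 1).add (h2.const_mul β₂))).add
    (h2.mul ((h3.const_mul β₁).add (h1.const_mul β₂)))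
  rw [funext (charFun_eq_det β₁ β₂ p)]
  exact h

theorem sol_add_smul (a b a₀ b₀ : ℂ) : sol p lam a b (sol p lam a₀ b₀ 0) 1 =
    a * sol p lam 1 0 0 1 + b * sol p lam 0 1 0 1 +
      (a₀ * sol p lam 0 0 (sol p lam 1 0 0) 1 + b₀ * sol p lam 0 0 (sol p lam 0 1 0) 1) := by
  rw [sol_one_eq]
  congr 1
  have h : sol p lam 0 0 (sol p lam a₀ b₀ 0) =
      a₀ • sol p lam 0 0 (sol p lam 1 0 0) + b₀ • sol p lam 0 0 (sol p lam 0 1 0) := by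
    rw [sol_linear p lam a₀ b₀ 0, sol_zero_zero_zero, add_zero]
    generalize sol p lam 1 0 0 = u
    generalize sol p lam 0 1 0 = v
    simp only [sol, map_add, map_sub, map_smul, zero_smul, zero_add, map_zero]
    module
  rw [h]; rfl

theorem dsol_add_smul (a b a₀ b₀ : ℂ) : dsol p lam a b (sol p lam a₀ b₀ 0) 1 =
    a * dsol p lam 1 0 0 1 + b * dsol p lam 0 1 0 1 +
      (a₀ * dsol p lam 0 0 (sol p lam 1 0 0) 1 + b₀ * dsol p lam 0 0 (sol p lam 0 1 0) 1) := by
  rw [dsol_one_eq]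
  congr 1
  have h : dsol p lam 0 0 (sol p lam a₀ b₀ 0) =
      a₀ • dsol p lam 0 0 (sol p lam 1 0 0) + b₀ • dsol p lam 0 0 (sol p lam 0 1 0) := by
    rw [sol_linear p lam a₀ b₀ 0, sol_zero_zero_zero, add_zero]
    generalize sol p lam 1 0 0 = u
    generalize sol p lam 0 1 0 = v
    simp only [dsol, sol, map_add, map_sub, map_smul, zero_smul, zero_add, mul_add, mul_smul_comm,
      zero_sub, map_neg, mul_neg]
    module
  rw [h]; rfl

theorem kerPow_le_one (h : kerPow (T β₁ β₂ q) lam 2 ≤ kerPow (T β₁ β₂ q) lam 1) (k : ℕ) :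
    kerPow (T β₁ β₂ q) lam k ≤ kerPow (T β₁ β₂ q) lam 1 := by
  induction k with
  | zero => exact bot_le
  | succ k ih =>
    intro f hf
    obtain ⟨g, hg, e⟩ := mem_kerPow_succ.1 hf
    exact h (mem_kerPow_succ.2 ⟨g, hg, ih e⟩)

/-- At a simple zero of the characteristic function there are no associated functions. -/
theorem kerPow_two_le (hpq : EqOn q (extend p) (Icc 0 1)) (h0 : charFun β₁ β₂ p lam = 0)
    (h1 : deriv (charFun β₁ β₂ p) lam ≠ 0) :
    kerPow (T β₁ β₂ q) lam 2 ≤ kerPow (T β₁ β₂ q) lam 1 := by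
  intro f hf
  obtain ⟨g, hg, e⟩ := mem_kerPow_succ.1 hf
  obtain ⟨a₀, b₀, e1, k1, k2⟩ := (mem_kerPow_one hpq).1 e
  rw [sub_eq_iff_eq_add'] at e1
  have hg' := hg
  rw [e1, mem_graph_iff hpq] at hg
  obtain ⟨a, b, -, k3, k4⟩ := hg
  rw [sol_add_smul, dsol_add_smul] at k3
  rw [sol_add_smul] at k4
  rw [charFun_eq_det] at h0
  rw [(hasDerivAt_charFun_det β₁ β₂ p lam).deriv] at h1
  -- Let `M` be the matrix of the boundary conditions, `v₀ = (a₀, b₀)` and `v = (a, b)`. Then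
  -- `M v₀ = 0` and `M' v₀ + M v = 0`. Multiplying by the adjugates gives
  -- `(det M)' v₀ = adj(M)' M v₀ + adj(M) (M' v₀ + M v) - (det M) v = 0`.
  have hab : a₀ = 0 ∧ b₀ = 0 := by
    constructor <;> refine (mul_eq_zero.1 ?_).resolve_right h1
    · linear_combination
        (β₁ * dsol p lam 0 0 (sol p lam 0 1 0) 1 + β₂ * sol p lam 0 0 (sol p lam 0 1 0) 1) * k2 +
        sol p lam 0 0 (sol p lam 0 1 0) 1 * k1 +
        (1 + β₁ * dsol p lam 0 1 0 1 + β₂ * sol p lam 0 1 0 1) * k4 +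
        sol p lam 0 1 0 1 * k3 - a * h0
    · linear_combination -sol p lam 0 0 (sol p lam 1 0 0) 1 * k1 -
        (β₁ * dsol p lam 0 0 (sol p lam 1 0 0) 1 + β₂ * sol p lam 0 0 (sol p lam 1 0 0) 1) * k2 +
        (1 - sol p lam 1 0 0 1) * k3 -
        (β₁ * dsol p lam 1 0 0 1 + β₂ * sol p lam 1 0 0 1) * k4 - b * h0
  obtain ⟨rfl, rfl⟩ := hab
  refine mem_kerPow_succ.2 ⟨g, hg', ?_⟩
  simp [kerPow, e1, sol_zero_zero_zero, toL2_zero]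

/-- The eigenspace at a simple zero of the characteristic function is a line. -/
theorem exists_span_kerPow_one (hpq : EqOn q (extend p) (Icc 0 1))
    (h0 : charFun β₁ β₂ p lam = 0) (h1 : deriv (charFun β₁ β₂ p) lam ≠ 0) :
    ∃ f ≠ 0, kerPow (T β₁ β₂ q) lam 1 = ℂ ∙ f := by
  obtain ⟨f, hf, hf0⟩ := isEigenvalue_iff_kerPow_one.1 ((isEigenvalue_iff hpq).2 h0)
  refine ⟨f, hf0, le_antisymm (fun g hg => ?_) ((Submodule.span_singleton_le_iff_mem _ _).2 hf)⟩
  obtain ⟨a₀, b₀, rfl, k1, k2⟩ := (mem_kerPow_one hpq).1 hf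
  obtain ⟨a, b, rfl, k3, k4⟩ := (mem_kerPow_one hpq).1 hg
  have hab : a₀ ≠ 0 ∨ b₀ ≠ 0 := by
    by_contra! h
    rw [h.1, h.2, sol_zero_zero_zero, toL2_zero] at hf0
    exact hf0 rfl
  -- two independent eigenfunctions would make all four entries of the boundary matrix vanish
  have hd : a₀ * b - b₀ * a = 0 := by
    by_contra hd
    refine h1 ?_
    rw [(hasDerivAt_charFun_det β₁ β₂ p lam).deriv]
    have z1 : β₁ * dsol p lam 1 0 0 1 + β₂ * sol p lam 1 0 0 1 = 0 :=
      (mul_eq_zero.1 (by linear_combination b * k1 - b₀ * k3)).resolve_left hd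
    have z2 : 1 + β₁ * dsol p lam 0 1 0 1 + β₂ * sol p lam 0 1 0 1 = 0 :=
      (mul_eq_zero.1 (by linear_combination a₀ * k3 - a * k1)).resolve_left hd
    have z3 : 1 - sol p lam 1 0 0 1 = 0 :=
      (mul_eq_zero.1 (by linear_combination b * k2 - b₀ * k4)).resolve_left hd
    have z4 : sol p lam 0 1 0 1 = 0 :=
      (mul_eq_zero.1 (by linear_combination a * k2 - a₀ * k4)).resolve_left hd
    rw [z1, z2, z3, z4]
    ring
  obtain ⟨t, rfl, rfl⟩ : ∃ t : ℂ, a = t * a₀ ∧ b = t * b₀ := by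
    rcases hab with h | h
    · exact ⟨a / a₀, by field_simp, by field_simp; linear_combination hd⟩
    · exact ⟨b / b₀, by field_simp; linear_combination -hd, by field_simp⟩
  rw [Submodule.mem_span_singleton]
  refine ⟨t, ?_⟩
  rw [← toL2_smul, sol_linear p lam (t * a₀), sol_linear p lam a₀, sol_zero_zero_zero]
  congr 1
  module

theorem isSimpleEigenvalue (hpq : EqOn q (extend p) (Icc 0 1))
    (h0 : charFun β₁ β₂ p lam = 0) (h1 : deriv (charFun β₁ β₂ p) lam ≠ 0) :
    IsSimpleEigenvalue (T β₁ β₂ q) lam := by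
  refine ⟨(isEigenvalue_iff hpq).2 h0, ?_⟩
  obtain ⟨f, hf, e⟩ := exists_span_kerPow_one hpq h0 h1
  have : rootSpace (T β₁ β₂ q) lam = kerPow (T β₁ β₂ q) lam 1 :=
    le_antisymm (iSup_le (kerPow_le_one (kerPow_two_le hpq h0 h1))) (le_iSup _ 1)
  rw [this, e, finrank_span_singleton hf]

end Simple

/-! ### Annihilators of root functions -/

open ComplexConjugate in
/-- The complex conjugate of a continuous function. -/
def conjCI (u : CI) : CI :=
  CI.mk (fun x => conj (u x)) (Complex.continuous_conj.comp u.continuous_coe)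

theorem inner_toL2_conjCI (u : CI) (f : L2) :
    inner ℂ (toL2 (conjCI u)) f = ∫ x in Icc (0 : ℝ) 1, f x * extend u x := by
  rw [L2.inner_def]
  refine integral_congr_ae ?_
  filter_upwards [coeFn_toL2 (conjCI u)] with x hx
  rw [hx, RCLike.inner_apply]
  congr 1
  exact Complex.conj_conj _

/-- A solution satisfying the adjoint boundary conditions annihilates the range of the operator
minus `lam`. -/
theorem inner_eq_of_adjoint {β₁ β₂ lam a b : ℂ} {q : ℝ → ℂ} {p : CI}
    (hpq : EqOn q (extend p) (Icc 0 1))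
    (h1 : sol p lam a b 0 1 + β₁ * a = 0)
    (h2 : dsol p lam a b 0 1 - b - β₂ * a = 0) {f g : L2} (hfg : (f, g) ∈ graph β₁ β₂ q) :
    inner ℂ (toL2 (conjCI (sol p lam a b 0))) g
      = lam * inner ℂ (toL2 (conjCI (sol p lam a b 0))) f := by
  obtain ⟨y, hy, e1, e2⟩ := hfg
  simp only at e1 e2
  set ψ := sol p lam a b 0 with hψ
  set dψ := dsol p lam a b 0 with hdψ
  have H := isSol_sol p lam a b 0
  rw [← hψ, ← hdψ] at H
  have acψ : AbsolutelyContinuousOnInterval (extend ψ) 0 1 :=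
    absolutelyContinuous_of_hasDerivWithinAt zero_le_one H.deriv₁ H.continuousOn_deriv
  have acdψ : AbsolutelyContinuousOnInterval (extend dψ) 0 1 :=
    absolutelyContinuous_of_hasDerivWithinAt zero_le_one H.deriv₂
      ((((continuous_extend p).sub continuous_const).mul (continuous_extend ψ)).sub
        (continuous_extend 0)).continuousOn
  have acDy := hy.ac
  have acy : AbsolutelyContinuousOnInterval y 0 1 := by
    refine absolutelyContinuous_of_hasDerivWithinAt zero_le_one
      (fun x hx => hy.hasDerivWithinAt hx) ?_
    have := acDy.continuousOn
    rwa [uIcc_of_le zero_le_one] at this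
  -- the boundary terms in the Lagrange identity for `y` and `ψ` cancel
  have hW := ((acDy.fun_smul acψ).fun_sub (acy.fun_smul acdψ)).integral_deriv_complex
  have e0' : ∀ u : CI, extend u 0 = u 0 := fun u => extend_coe u 0
  have e1' : ∀ u : CI, extend u 1 = u 1 := fun u => extend_coe u 1
  have hbd : ∫ x in (0 : ℝ)..1,
      deriv (fun x => D y x • extend ψ x - y x • extend dψ x) x = 0 := by
    rw [hW]
    simp only [e0', e1', smul_eq_mul]
    rw [hψ, hdψ, sol_zero_apply, dsol_zero_apply, ← hψ, ← hdψ]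
    linear_combination D y 1 * h1 - y 1 * h2 - a * hy.bc₁ + b * hy.bc₂
  have hint : ∀ u : L2, Integrable (fun x => u x * extend ψ x)
      (volume.restrict (Icc (0 : ℝ) 1)) := fun u =>
    ((Lp.memLp u).integrable (by norm_num)).mul_bdd (c := ‖ψ‖)
      (continuous_extend ψ).aestronglyMeasurable (ae_of_all _ (norm_extend_le ψ))
  rw [← sub_eq_zero, inner_toL2_conjCI, inner_toL2_conjCI, ← integral_const_mul,
    ← integral_sub (hint g) ((hint f).const_mul lam), integral_Icc_eq_integral_Ioc,
    ← intervalIntegral.integral_of_le zero_le_one, ← neg_eq_zero, ← hbd,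
    ← intervalIntegral.integral_neg]
  refine intervalIntegral.integral_congr_ae ?_
  rw [Filter.EventuallyEq, ae_restrict_iff' measurableSet_Icc] at e1 e2
  filter_upwards [e1, e2, acDy.ae_hasDerivAt, Measure.ae_ne volume (1 : ℝ)] with x a1 a2 a3 a4 hx
  rw [uIoc_of_le zero_le_one] at hx
  have hx' : x ∈ Icc (0 : ℝ) 1 := Ioc_subset_Icc_self hx
  have hx1 : x ∈ Ioo (0 : ℝ) 1 := ⟨hx.1, lt_of_le_of_ne hx.2 a4⟩
  have hn : Icc (0 : ℝ) 1 ∈ nhds x := Icc_mem_nhds hx1.1 hx1.2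
  have d1 := a3 (by rwa [uIcc_of_le zero_le_one])
  have d2 := (H.deriv₁ x hx').hasDerivAt hn
  have d3 := (H.deriv₂ x hx').hasDerivAt hn
  have d4 := (hy.hasDerivWithinAt hx').hasDerivAt hn
  have d5 : deriv (fun x => D y x • extend ψ x - y x • extend dψ x) x = _ :=
    ((d1.mul d2).sub (d4.mul d3)).deriv
  have z : extend (0 : CI) x = 0 := rfl
  rw [a1 hx', a2 hx', d5, D_eq_deriv hx1, hpq hx', z]
  ring

theorem toL2_ne_zero {u : CI} (hu : u ≠ 0) : toL2 u ≠ 0 := fun h =>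
  hu (toL2_injective (h.trans toL2_zero.symm))

/-- For every eigenvalue there is a nonzero vector orthogonal to the range of the operator minus the
eigenvalue. -/
theorem exists_annihilator {β₁ β₂ lam : ℂ} {q : ℝ → ℂ} {p : CI}
    (hpq : EqOn q (extend p) (Icc 0 1)) (h0 : charFun β₁ β₂ p lam = 0) :
    ∃ v : L2, v ≠ 0 ∧ ∀ f g : L2, (f, g) ∈ graph β₁ β₂ q → inner ℂ v g = lam * inner ℂ v f := by
  obtain ⟨a, b, hab, h1, h2⟩ := exists_kernel_of_det_eq_zero
    (m₁₁ := sol p lam 1 0 0 1 + β₁) (m₁₂ := sol p lam 0 1 0 1)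
    (m₂₁ := dsol p lam 1 0 0 1 - β₂) (m₂₂ := dsol p lam 0 1 0 1 - 1) (by
      rw [charFun] at h0
      linear_combination h0 + wronskian_one p lam)
  refine ⟨toL2 (conjCI (sol p lam a b 0)), toL2_ne_zero fun h => ?_, fun f g hfg =>
    inner_eq_of_adjoint hpq ?_ ?_ hfg⟩
  · refine sol_ne_zero (p := p) (lam := lam) hab ?_
    ext x
    have := congrArg (fun u : CI => u x) h
    simpa [conjCI] using this
  · rw [sol_one_eq, sol_zero_zero_zero, CI.zero_apply]
    linear_combination h1
  · rw [dsol_one_eq, dsol_zero_zero_zero, CI.zero_apply]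
    linear_combination h2

/-- A vector orthogonal to the range of the operator minus `lam` is orthogonal to the root functions
of every other eigenvalue. -/
theorem inner_eq_zero_of_mem_kerPow {β₁ β₂ lam lam' : ℂ} {q : ℝ → ℂ} {v : L2} (hne : lam' ≠ lam)
    (hv : ∀ f g : L2, (f, g) ∈ graph β₁ β₂ q → inner ℂ v g = lam * inner ℂ v f) {k : ℕ} {f : L2}
    (hf : f ∈ kerPow (T β₁ β₂ q) lam' k) : inner ℂ v f = 0 := by
  induction k generalizing f with
  | zero =>
    rw [kerPow, Submodule.mem_bot] at hf
    rw [hf, inner_zero_right]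
  | succ k ih =>
    obtain ⟨g, hg, e⟩ := mem_kerPow_succ.1 hf
    have h := ih e
    rw [inner_sub_right, inner_smul_right, hv f g hg, ← sub_mul] at h
    exact (mul_eq_zero.1 h).resolve_left (sub_ne_zero.2 hne.symm)

/-! ### Riesz bases of root functions -/

theorem IsRieszBasis.eq_zero_of_inner {H : Type*} [NormedAddCommGroup H] [InnerProductSpace ℂ H]
    [CompleteSpace H] {ι : Type*} {φ : ι → H} (hφ : IsRieszBasis φ) {v : H}
    (hv : ∀ i, inner ℂ v (φ i) = 0) : v = 0 := by
  obtain ⟨b, S, hS⟩ := hφ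
  have h1 : (innerSL ℂ v).comp (S : H →L[ℂ] H) = 0 := by
    refine ContinuousLinearMap.ext_on (dense_iff_closure_eq.2 ?_) (s := range b) ?_
    · have := b.dense_span
      rw [← Submodule.topologicalClosure_coe, this]; rfl
    · rintro _ ⟨i, rfl⟩
      simpa [← hS i] using hv i
  have h2 := DFunLike.congr_fun h1 (S.symm v)
  simpa using h2

/-- A Riesz basis of root functions contains a root function for every eigenvalue. -/
theorem exists_mem_kerPow {β₁ β₂ lam : ℂ} {q : ℝ → ℂ} {p : CI}
    (hpq : EqOn q (extend p) (Icc 0 1)) (h0 : charFun β₁ β₂ p lam = 0) {ι : Type*} {φ : ι → L2}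
    (hφ : ∀ i, IsRootFunction (T β₁ β₂ q) (φ i)) (hR : IsRieszBasis φ) :
    ∃ i k, φ i ∈ kerPow (T β₁ β₂ q) lam k := by
  obtain ⟨v, hv0, hv⟩ := exists_annihilator hpq h0
  by_contra! hc
  refine hv0 (hR.eq_zero_of_inner fun i => ?_)
  obtain ⟨-, lam', k, hk⟩ := hφ i
  have hne : lam' ≠ lam := by
    rintro rfl
    exact hc i k hk
  exact inner_eq_zero_of_mem_kerPow hne hv hk

/-- In a Riesz basis, suitable multiples of two different members cannot be close to each other,
relative to their norm. -/
theorem IsRieszBasis.exists_norm_le {H : Type*} [NormedAddCommGroup H] [InnerProductSpace ℂ H]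
    {ι : Type*} {φ : ι → H} (hφ : IsRieszBasis φ) :
    ∃ C : ℝ, ∀ i j, i ≠ j → ∀ (f g : H) (s t : ℂ), φ i = s • f → φ j = t • g →
      s ≠ 0 → t ≠ 0 → ‖f‖ ≤ C * ‖f - g‖ := by
  obtain ⟨b, S, hS⟩ := hφ
  refine ⟨‖(S : H →L[ℂ] H)‖ * ‖(S.symm : H →L[ℂ] H)‖, fun i j hij f g s t hf hg hs ht => ?_⟩
  have ef : f = s⁻¹ • S (b i) := by rw [← hS, hf, smul_smul, inv_mul_cancel₀ hs, one_smul]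
  have eg : g = t⁻¹ • S (b j) := by rw [← hS, hg, smul_smul, inv_mul_cancel₀ ht, one_smul]
  have e1 : S.symm (f - g) = s⁻¹ • b i - t⁻¹ • b j := by
    rw [ef, eg, map_sub, map_smul, map_smul, S.symm_apply_apply, S.symm_apply_apply]
  have h1 : ‖s⁻¹‖ ≤ ‖S.symm (f - g)‖ := by
    have h2 : inner ℂ (b i) (S.symm (f - g)) = s⁻¹ := by
      rw [e1, inner_sub_right, inner_smul_right, inner_smul_right,
        b.orthonormal.2 hij, mul_zero, sub_zero, inner_self_eq_norm_sq_to_K, b.orthonormal.1]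
      simp
    have h3 := norm_inner_le_norm (𝕜 := ℂ) (b i) (S.symm (f - g))
    rwa [h2, b.orthonormal.1, one_mul] at h3
  have h4 : ‖S.symm (f - g)‖ ≤ ‖(S.symm : H →L[ℂ] H)‖ * ‖f - g‖ :=
    (S.symm : H →L[ℂ] H).le_opNorm _
  have h5 : ‖S (b i)‖ ≤ ‖(S : H →L[ℂ] H)‖ := by
    have := (S : H →L[ℂ] H).le_opNorm (b i)
    rwa [b.orthonormal.1, mul_one] at this
  calc ‖f‖ = ‖s⁻¹‖ * ‖S (b i)‖ := by rw [ef, norm_smul]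
    _ ≤ (‖(S.symm : H →L[ℂ] H)‖ * ‖f - g‖) * ‖(S : H →L[ℂ] H)‖ := by
        gcongr; exact h1.trans h4
    _ = _ := by ring

/-! ### Trigonometric integrals -/

theorem norm_cos_le_exp (z : ℂ) : ‖Complex.cos z‖ ≤ Real.exp |z.im| := by
  rw [Complex.cos, norm_div, Complex.norm_ofNat]
  have h1 : ‖Complex.exp (z * Complex.I)‖ ≤ Real.exp |z.im| := by
    rw [Complex.norm_exp]
    exact Real.exp_le_exp.2 (by simpa using neg_le_abs z.im)
  have h2 : ‖Complex.exp (-z * Complex.I)‖ ≤ Real.exp |z.im| := by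
    rw [Complex.norm_exp]
    exact Real.exp_le_exp.2 (by simpa using le_abs_self z.im)
  linarith [norm_add_le (Complex.exp (z * Complex.I)) (Complex.exp (-z * Complex.I))]

theorem norm_sin_le_exp (z : ℂ) : ‖Complex.sin z‖ ≤ Real.exp |z.im| := by
  rw [Complex.sin, norm_div, norm_mul, Complex.norm_I, Complex.norm_ofNat]
  have h1 : ‖Complex.exp (z * Complex.I)‖ ≤ Real.exp |z.im| := by
    rw [Complex.norm_exp]
    exact Real.exp_le_exp.2 (by simpa using neg_le_abs z.im)
  have h2 : ‖Complex.exp (-z * Complex.I)‖ ≤ Real.exp |z.im| := by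
    rw [Complex.norm_exp]
    exact Real.exp_le_exp.2 (by simpa using le_abs_self z.im)
  linarith [norm_sub_le (Complex.exp (-z * Complex.I)) (Complex.exp (z * Complex.I))]

theorem abs_im_mul_ofReal_le {μ : ℂ} {r s : ℝ} (h : |r| ≤ s) : |(μ * (r : ℂ)).im| ≤ |μ.im| * s := by
  rw [Complex.im_mul_ofReal, abs_mul]
  gcongr

theorem norm_cos_mul_le {μ : ℂ} {r s : ℝ} (h : |r| ≤ s) :
    ‖Complex.cos (μ * (r : ℂ))‖ ≤ Real.exp (|μ.im| * s) :=
  (norm_cos_le_exp _).trans (Real.exp_le_exp.2 (abs_im_mul_ofReal_le h))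

theorem norm_sin_mul_le {μ : ℂ} {r s : ℝ} (h : |r| ≤ s) :
    ‖Complex.sin (μ * (r : ℂ))‖ ≤ Real.exp (|μ.im| * s) :=
  (norm_sin_le_exp _).trans (Real.exp_le_exp.2 (abs_im_mul_ofReal_le h))

theorem hasDerivAt_sin_mul (μ : ℂ) {g : ℝ → ℝ} {g' t : ℝ} (hg : HasDerivAt g g' t) :
    HasDerivAt (fun t : ℝ => Complex.sin (μ * (g t : ℂ)))
      (Complex.cos (μ * (g t : ℂ)) * (μ * (g' : ℂ))) t :=
  (Complex.hasDerivAt_sin _).comp t (hg.ofReal_comp.const_mul μ)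

theorem hasDerivAt_cos_mul (μ : ℂ) {g : ℝ → ℝ} {g' t : ℝ} (hg : HasDerivAt g g' t) :
    HasDerivAt (fun t : ℝ => Complex.cos (μ * (g t : ℂ)))
      (-Complex.sin (μ * (g t : ℂ)) * (μ * (g' : ℂ))) t :=
  (Complex.hasDerivAt_cos _).comp t (hg.ofReal_comp.const_mul μ)

theorem integral_sin_mul_cos {f : ℝ → ℂ} (hf : Continuous f) (μ : ℂ) (x : ℝ) :
    ∫ t in (0 : ℝ)..x, Complex.sin (μ * ((x - t : ℝ) : ℂ)) * (f t * Complex.cos (μ * (t : ℂ))) =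
      (Complex.sin (μ * x) * (∫ t in (0 : ℝ)..x, f t) +
        ∫ t in (0 : ℝ)..x, f t * Complex.sin (μ * ((x - 2 * t : ℝ) : ℂ))) / 2 := by
  rw [← intervalIntegral.integral_const_mul, ← intervalIntegral.integral_add,
    ← intervalIntegral.integral_div]
  · congr 1; funext t
    have e1 : μ * (x : ℂ) = μ * ((x - t : ℝ) : ℂ) + μ * t := by push_cast; ring
    have e2 : μ * ((x - 2 * t : ℝ) : ℂ) = μ * ((x - t : ℝ) : ℂ) - μ * t := by push_cast; ring
    rw [e1, e2, Complex.sin_add, Complex.sin_sub]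
    ring
  all_goals exact Continuous.intervalIntegrable (by fun_prop) _ _

theorem integral_sin_mul_sin {f : ℝ → ℂ} (hf : Continuous f) (μ : ℂ) (x : ℝ) :
    ∫ t in (0 : ℝ)..x, Complex.sin (μ * ((x - t : ℝ) : ℂ)) * (f t * Complex.sin (μ * (t : ℂ))) =
      (-(Complex.cos (μ * x) * (∫ t in (0 : ℝ)..x, f t)) +
        ∫ t in (0 : ℝ)..x, f t * Complex.cos (μ * ((x - 2 * t : ℝ) : ℂ))) / 2 := by
  rw [← intervalIntegral.integral_const_mul, ← intervalIntegral.integral_neg,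
    ← intervalIntegral.integral_add, ← intervalIntegral.integral_div]
  · congr 1; funext t
    have e1 : μ * (x : ℂ) = μ * ((x - t : ℝ) : ℂ) + μ * t := by push_cast; ring
    have e2 : μ * ((x - 2 * t : ℝ) : ℂ) = μ * ((x - t : ℝ) : ℂ) - μ * t := by push_cast; ring
    rw [e1, e2, Complex.cos_add, Complex.cos_sub]
    ring
  all_goals exact Continuous.intervalIntegrable (by fun_prop) _ _

theorem integral_cos_mul_sin {f : ℝ → ℂ} (hf : Continuous f) (μ : ℂ) (x : ℝ) :
    ∫ t in (0 : ℝ)..x, Complex.cos (μ * ((x - t : ℝ) : ℂ)) * (f t * Complex.sin (μ * (t : ℂ))) =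
      (Complex.sin (μ * x) * (∫ t in (0 : ℝ)..x, f t) -
        ∫ t in (0 : ℝ)..x, f t * Complex.sin (μ * ((x - 2 * t : ℝ) : ℂ))) / 2 := by
  rw [← intervalIntegral.integral_const_mul, ← intervalIntegral.integral_sub,
    ← intervalIntegral.integral_div]
  · congr 1; funext t
    have e1 : μ * (x : ℂ) = μ * ((x - t : ℝ) : ℂ) + μ * t := by push_cast; ring
    have e2 : μ * ((x - 2 * t : ℝ) : ℂ) = μ * ((x - t : ℝ) : ℂ) - μ * t := by push_cast; ring
    rw [e1, e2, Complex.sin_add, Complex.sin_sub]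
    ring
  all_goals exact Continuous.intervalIntegrable (by fun_prop) _ _

theorem integral_cos_mul_cos {f : ℝ → ℂ} (hf : Continuous f) (μ : ℂ) (x : ℝ) :
    ∫ t in (0 : ℝ)..x, Complex.cos (μ * ((x - t : ℝ) : ℂ)) * (f t * Complex.cos (μ * (t : ℂ))) =
      (Complex.cos (μ * x) * (∫ t in (0 : ℝ)..x, f t) +
        ∫ t in (0 : ℝ)..x, f t * Complex.cos (μ * ((x - 2 * t : ℝ) : ℂ))) / 2 := by
  rw [← intervalIntegral.integral_const_mul, ← intervalIntegral.integral_add,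
    ← intervalIntegral.integral_div]
  · congr 1; funext t
    have e1 : μ * (x : ℂ) = μ * ((x - t : ℝ) : ℂ) + μ * t := by push_cast; ring
    have e2 : μ * ((x - 2 * t : ℝ) : ℂ) = μ * ((x - t : ℝ) : ℂ) - μ * t := by push_cast; ring
    rw [e1, e2, Complex.cos_add, Complex.cos_sub]
    ring
  all_goals exact Continuous.intervalIntegrable (by fun_prop) _ _

theorem hasDerivAt_sub_two_mul (x t : ℝ) : HasDerivAt (fun t : ℝ => x - 2 * t) (-2) t := by
  simpa using ((hasDerivAt_id t).const_mul 2).const_sub x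

theorem integral_mul_sin_eq {f : ℝ → ℂ} (hf : AbsolutelyContinuousOnInterval f 0 1) {μ : ℂ}
    (hμ : μ ≠ 0) {x : ℝ} (hx : x ∈ Icc (0 : ℝ) 1) :
    ∫ t in (0 : ℝ)..x, f t * Complex.sin (μ * ((x - 2 * t : ℝ) : ℂ)) =
      ((f x - f 0) * Complex.cos (μ * x) -
        ∫ t in (0 : ℝ)..x, deriv f t * Complex.cos (μ * ((x - 2 * t : ℝ) : ℂ))) / (2 * μ) := by
  have h := integral_mul_eq_sub_of_ac hf (x := x)
    (g := fun t : ℝ => Complex.cos (μ * ((x - 2 * t : ℝ) : ℂ)) / (2 * μ))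
    (g' := fun t : ℝ => Complex.sin (μ * ((x - 2 * t : ℝ) : ℂ))) (fun t => by
      refine ((hasDerivAt_cos_mul μ (hasDerivAt_sub_two_mul x t)).div_const (2 * μ)).congr_deriv ?_
      push_cast
      field_simp) (by fun_prop) hx
  have e : (μ * ((x - 2 * x : ℝ) : ℂ)) = -(μ * x) := by push_cast; ring
  simp only [mul_zero, sub_zero, e, Complex.cos_neg] at h
  rw [h, sub_div, ← intervalIntegral.integral_div]
  simp only [mul_div_assoc]
  ring

theorem integral_mul_cos_eq {f : ℝ → ℂ} (hf : AbsolutelyContinuousOnInterval f 0 1) {μ : ℂ}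
    (hμ : μ ≠ 0) {x : ℝ} (hx : x ∈ Icc (0 : ℝ) 1) :
    ∫ t in (0 : ℝ)..x, f t * Complex.cos (μ * ((x - 2 * t : ℝ) : ℂ)) =
      ((f x + f 0) * Complex.sin (μ * x) +
        ∫ t in (0 : ℝ)..x, deriv f t * Complex.sin (μ * ((x - 2 * t : ℝ) : ℂ))) / (2 * μ) := by
  have h := integral_mul_eq_sub_of_ac hf (x := x)
    (g := fun t : ℝ => -Complex.sin (μ * ((x - 2 * t : ℝ) : ℂ)) / (2 * μ))
    (g' := fun t : ℝ => Complex.cos (μ * ((x - 2 * t : ℝ) : ℂ))) (fun t => by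
      refine ((hasDerivAt_sin_mul μ (hasDerivAt_sub_two_mul x t)).neg.div_const
        (2 * μ)).congr_deriv ?_
      push_cast
      field_simp) (by fun_prop) hx
  have e : (μ * ((x - 2 * x : ℝ) : ℂ)) = -(μ * x) := by push_cast; ring
  simp only [mul_zero, sub_zero, e, Complex.sin_neg] at h
  rw [h, add_div, ← intervalIntegral.integral_div, sub_eq_add_neg _ (∫ _ in _.._, _),
    ← intervalIntegral.integral_neg]
  congr 1
  · ring
  · congr 1; funext t; ring

theorem abs_sub_two_mul_le {x t : ℝ} (ht : t ∈ Icc 0 x) : |x - 2 * t| ≤ x := by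
  rw [abs_le]; constructor <;> linarith [ht.1, ht.2]

theorem norm_integral_mul_trig_le {g k : ℝ → ℂ} (hg : IntervalIntegrable g volume 0 1) {x B : ℝ}
    (hx : x ∈ Icc (0 : ℝ) 1) (hk : ∀ t ∈ Icc 0 x, ‖k t‖ ≤ B) (hB : 0 ≤ B) :
    ‖∫ t in (0 : ℝ)..x, g t * k t‖ ≤ (∫ t in (0 : ℝ)..1, ‖g t‖) * B := by
  have h0 : uIcc 0 x ⊆ uIcc (0 : ℝ) 1 := by
    rw [uIcc_of_le hx.1, uIcc_of_le zero_le_one]; exact Icc_subset_Icc_right hx.2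
  calc ‖∫ t in (0 : ℝ)..x, g t * k t‖ ≤ ∫ t in (0 : ℝ)..x, ‖g t‖ * B := by
        refine intervalIntegral.norm_integral_le_of_norm_le hx.1 (ae_of_all _ fun t ht => ?_)
          ((hg.norm.mono_set h0).mul_const _)
        rw [norm_mul]
        gcongr
        exact hk t (Ioc_subset_Icc_self ht)
    _ = (∫ t in (0 : ℝ)..x, ‖g t‖) * B := intervalIntegral.integral_mul_const _ _
    _ ≤ _ := by
        gcongr
        exact intervalIntegral.integral_mono_interval le_rfl hx.1 hx.2
          (ae_of_all _ fun t => norm_nonneg _) hg.norm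

/-- Oscillatory integrals of an absolutely continuous function gain one power of the frequency. -/
theorem exists_norm_integral_mul_le {f : ℝ → ℂ} (hf : AbsolutelyContinuousOnInterval f 0 1) :
    ∃ C : ℝ, 0 ≤ C ∧ ∀ μ : ℂ, μ ≠ 0 → ∀ x ∈ Icc (0 : ℝ) 1,
      ‖∫ t in (0 : ℝ)..x, f t * Complex.sin (μ * ((x - 2 * t : ℝ) : ℂ))‖
          ≤ C * Real.exp (|μ.im| * x) / ‖μ‖ ∧
        ‖∫ t in (0 : ℝ)..x, f t * Complex.cos (μ * ((x - 2 * t : ℝ) : ℂ))‖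
          ≤ C * Real.exp (|μ.im| * x) / ‖μ‖ := by
  obtain ⟨A, hA⟩ := hf.exists_bound
  rw [uIcc_of_le zero_le_one] at hA
  have hA0 : 0 ≤ A := (norm_nonneg _).trans (hA 0 (left_mem_Icc.2 zero_le_one))
  have hi := hf.intervalIntegrable_deriv_complex
  set J := ∫ t in (0 : ℝ)..1, ‖deriv f t‖
  have hJ : 0 ≤ J := intervalIntegral.integral_nonneg zero_le_one fun t _ => norm_nonneg _
  refine ⟨A + J, by positivity, fun μ hμ x hx => ?_⟩
  have h1 := hA x hx
  have h2 := hA 0 (left_mem_Icc.2 zero_le_one)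
  have hxx : |x| ≤ x := (abs_of_nonneg hx.1).le
  have hE := (Real.exp_pos (|μ.im| * x)).le
  have hμ' : 0 < ‖μ‖ := norm_pos_iff.2 hμ
  have key : ∀ u v w : ℂ, ‖u‖ ≤ 2 * A → ‖v‖ ≤ Real.exp (|μ.im| * x) →
      ‖w‖ ≤ J * Real.exp (|μ.im| * x) →
      (‖u * v‖ + ‖w‖) / ‖2 * μ‖ ≤ (A + J) * Real.exp (|μ.im| * x) / ‖μ‖ := by
    intro u v w hu hv hw
    rw [norm_mul, norm_mul, Complex.norm_ofNat, div_le_div_iff₀ (by positivity) hμ']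
    have h3 : ‖u‖ * ‖v‖ ≤ 2 * A * Real.exp (|μ.im| * x) := by gcongr
    have h4 : 0 ≤ J * Real.exp (|μ.im| * x) := by positivity
    nlinarith
  rw [integral_mul_sin_eq hf hμ hx, integral_mul_cos_eq hf hμ hx, norm_div, norm_div]
  constructor
  · refine le_trans (by gcongr; exact norm_sub_le _ _) (key _ _ _ ?_ (norm_cos_mul_le hxx)
      (norm_integral_mul_trig_le hi hx (fun t ht => norm_cos_mul_le (abs_sub_two_mul_le ht)) hE))
    linarith [norm_sub_le (f x) (f 0)]
  · refine le_trans (by gcongr; exact norm_add_le _ _) (key _ _ _ ?_ (norm_sin_mul_le hxx)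
      (norm_integral_mul_trig_le hi hx (fun t ht => norm_sin_mul_le (abs_sub_two_mul_le ht)) hE))
    linarith [norm_add_le (f x) (f 0)]

/-! ### Asymptotics of solutions for large spectral parameter -/

theorem hasDerivAt_const_sub (x t : ℝ) : HasDerivAt (fun t : ℝ => x - t) (-1) t := by
  simpa using (hasDerivAt_id t).const_sub x

section Duhamel

variable {q y dy : ℝ → ℂ} {μ : ℂ}

/-- Variation of constants: the solution as a perturbation of the solution with zero potential. -/
theorem IsSol.duhamel (H : IsSol q (μ ^ 2) 0 y dy) (hq : Continuous q) (hy : Continuous y)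
    (hμ : μ ≠ 0) {x : ℝ} (hx : x ∈ Icc (0 : ℝ) 1) :
    y x = y 0 * Complex.cos (μ * x) + dy 0 * Complex.sin (μ * x) / μ +
      (∫ t in (0 : ℝ)..x, Complex.sin (μ * ((x - t : ℝ) : ℂ)) * (q t * y t)) / μ := by
  have h0 : ∀ t ∈ Icc (0 : ℝ) x, t ∈ Icc (0 : ℝ) 1 := fun t ht => ⟨ht.1, ht.2.trans hx.2⟩
  have hD : ∀ t ∈ Icc (0 : ℝ) x, HasDerivWithinAt
      (fun t : ℝ => Complex.sin (μ * ((x - t : ℝ) : ℂ)) * dy t +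
        μ * (Complex.cos (μ * ((x - t : ℝ) : ℂ)) * y t))
      (Complex.sin (μ * ((x - t : ℝ) : ℂ)) * (q t * y t)) (Icc 0 x) t := fun t ht => by
    have d1 := (hasDerivAt_sin_mul μ (hasDerivAt_const_sub x t)).hasDerivWithinAt (s := Icc 0 x)
    have d2 := (hasDerivAt_cos_mul μ (hasDerivAt_const_sub x t)).hasDerivWithinAt (s := Icc 0 x)
    refine ((d1.mul ((H.deriv₂ t (h0 t ht)).mono h0)).add
      ((d2.mul ((H.deriv₁ t (h0 t ht)).mono h0)).const_mul μ)).congr_deriv ?_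
    simp only [Pi.zero_apply]
    push_cast
    ring
  have h := intervalIntegral.integral_eq_sub_of_hasDerivAt_of_le hx.1
    (fun t ht => (hD t ht).continuousWithinAt)
    (fun t ht => (hD t (Ioo_subset_Icc_self ht)).hasDerivAt (Icc_mem_nhds ht.1 ht.2))
    (Continuous.intervalIntegrable (by fun_prop) _ _)
  rw [h]
  simp only [sub_self, Complex.ofReal_zero, mul_zero, Complex.sin_zero, Complex.cos_zero, sub_zero]
  field_simp
  ring

/-- Variation of constants for the derivative of a solution. -/
theorem IsSol.duhamel_deriv (H : IsSol q (μ ^ 2) 0 y dy) (hq : Continuous q) (hy : Continuous y)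
    {x : ℝ} (hx : x ∈ Icc (0 : ℝ) 1) :
    dy x = dy 0 * Complex.cos (μ * x) - y 0 * (μ * Complex.sin (μ * x)) +
      ∫ t in (0 : ℝ)..x, Complex.cos (μ * ((x - t : ℝ) : ℂ)) * (q t * y t) := by
  have h0 : ∀ t ∈ Icc (0 : ℝ) x, t ∈ Icc (0 : ℝ) 1 := fun t ht => ⟨ht.1, ht.2.trans hx.2⟩
  have hD : ∀ t ∈ Icc (0 : ℝ) x, HasDerivWithinAt
      (fun t : ℝ => Complex.cos (μ * ((x - t : ℝ) : ℂ)) * dy t -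
        μ * (Complex.sin (μ * ((x - t : ℝ) : ℂ)) * y t))
      (Complex.cos (μ * ((x - t : ℝ) : ℂ)) * (q t * y t)) (Icc 0 x) t := fun t ht => by
    have d1 := (hasDerivAt_sin_mul μ (hasDerivAt_const_sub x t)).hasDerivWithinAt (s := Icc 0 x)
    have d2 := (hasDerivAt_cos_mul μ (hasDerivAt_const_sub x t)).hasDerivWithinAt (s := Icc 0 x)
    refine ((d2.mul ((H.deriv₂ t (h0 t ht)).mono h0)).sub
      ((d1.mul ((H.deriv₁ t (h0 t ht)).mono h0)).const_mul μ)).congr_deriv ?_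
    simp only [Pi.zero_apply]
    push_cast
    ring
  have h := intervalIntegral.integral_eq_sub_of_hasDerivAt_of_le hx.1
    (fun t ht => (hD t ht).continuousWithinAt)
    (fun t ht => (hD t (Ioo_subset_Icc_self ht)).hasDerivAt (Icc_mem_nhds ht.1 ht.2))
    (Continuous.intervalIntegrable (by fun_prop) _ _)
  rw [h]
  simp only [sub_self, Complex.ofReal_zero, mul_zero, Complex.sin_zero, Complex.cos_zero, sub_zero]
  ring

end Duhamel

/-- A convolution with a trigonometric kernel preserves bounds of the form `B * exp (|Im μ| x)`. -/
theorem norm_integral_kernel_le {q f k : ℝ → ℂ} {τ M B : ℝ} {x : ℝ} (hx : x ∈ Icc (0 : ℝ) 1)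
    (hq : ∀ t, ‖q t‖ ≤ M) (hf : ∀ t ∈ Icc (0 : ℝ) 1, ‖f t‖ ≤ B * Real.exp (τ * t)) (hB : 0 ≤ B)
    (hk : ∀ t ∈ Icc 0 x, ‖k t‖ ≤ Real.exp (τ * (x - t))) :
    ‖∫ t in (0 : ℝ)..x, k t * (q t * f t)‖ ≤ M * B * Real.exp (τ * x) := by
  have hM : 0 ≤ M := (norm_nonneg _).trans (hq 0)
  have h := intervalIntegral.norm_integral_le_of_norm_le_const (a := 0) (b := x)
    (f := fun t => k t * (q t * f t)) (C := M * B * Real.exp (τ * x)) (fun t ht => by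
      rw [uIoc_of_le hx.1] at ht
      have ht' : t ∈ Icc 0 x := Ioc_subset_Icc_self ht
      rw [norm_mul, norm_mul]
      calc ‖k t‖ * (‖q t‖ * ‖f t‖)
          ≤ Real.exp (τ * (x - t)) * (M * (B * Real.exp (τ * t))) := by
            gcongr
            · exact hk t ht'
            · exact hq t
            · exact hf t ⟨ht'.1, ht'.2.trans hx.2⟩
        _ = M * B * (Real.exp (τ * (x - t)) * Real.exp (τ * t)) := by ring
        _ = _ := by rw [← Real.exp_add]; ring_nf)
  refine h.trans ?_
  rw [sub_zero, abs_of_nonneg hx.1]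
  exact mul_le_of_le_one_right (by positivity) hx.2

theorem norm_sin_sub_le (μ : ℂ) {x t : ℝ} (ht : t ∈ Icc 0 x) :
    ‖Complex.sin (μ * ((x - t : ℝ) : ℂ))‖ ≤ Real.exp (|μ.im| * (x - t)) :=
  norm_sin_mul_le (abs_of_nonneg (sub_nonneg.2 ht.2)).le

theorem norm_cos_sub_le (μ : ℂ) {x t : ℝ} (ht : t ∈ Icc 0 x) :
    ‖Complex.cos (μ * ((x - t : ℝ) : ℂ))‖ ≤ Real.exp (|μ.im| * (x - t)) :=
  norm_cos_mul_le (abs_of_nonneg (sub_nonneg.2 ht.2)).le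

/-- The a priori bound: for `2 M ≤ ‖μ‖` the integral term in the variation of constants formula is a
contraction by one half in the norm weighted with `exp (-|Im μ| x)`. -/
theorem IsSol.norm_le {q y dy : ℝ → ℂ} {μ : ℂ} {M A : ℝ} (H : IsSol q (μ ^ 2) 0 y dy)
    (hq : Continuous q) (hy : Continuous y) (hM : ∀ t, ‖q t‖ ≤ M) (hμ : 2 * M ≤ ‖μ‖) (hμ0 : μ ≠ 0)
    (hA : ∀ x ∈ Icc (0 : ℝ) 1, ‖y 0 * Complex.cos (μ * x) + dy 0 * Complex.sin (μ * x) / μ‖ ≤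
      A * Real.exp (|μ.im| * x)) {x : ℝ} (hx : x ∈ Icc (0 : ℝ) 1) :
    ‖y x‖ ≤ 2 * A * Real.exp (|μ.im| * x) := by
  have hμ' : 0 < ‖μ‖ := norm_pos_iff.2 hμ0
  have hc : ContinuousOn (fun x => ‖y x‖ * Real.exp (-(|μ.im| * x))) (Icc 0 1) := by fun_prop
  obtain ⟨z, hz, hmax⟩ := isCompact_Icc.exists_isMaxOn ⟨0, left_mem_Icc.2 zero_le_one⟩ hc
  set m := ‖y z‖ * Real.exp (-(|μ.im| * z)) with hm
  have hm0 : 0 ≤ m := by positivity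
  have hle : ∀ t ∈ Icc (0 : ℝ) 1, ‖y t‖ ≤ m * Real.exp (|μ.im| * t) := fun t ht => by
    have h1 : ‖y t‖ * Real.exp (-(|μ.im| * t)) ≤ m := hmax ht
    rwa [Real.exp_neg, ← div_eq_mul_inv, div_le_iff₀ (Real.exp_pos _)] at h1
  have h2 := norm_integral_kernel_le (τ := |μ.im|) hz hM hle hm0
    (k := fun t => Complex.sin (μ * ((z - t : ℝ) : ℂ))) fun t ht => norm_sin_sub_le μ ht
  have h3 : ‖y z‖ ≤ A * Real.exp (|μ.im| * z) + m / 2 * Real.exp (|μ.im| * z) := by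
    rw [H.duhamel hq hy hμ0 hz]
    refine (norm_add_le _ _).trans (add_le_add (hA z hz) ?_)
    rw [norm_div, div_le_iff₀ hμ']
    refine h2.trans ?_
    have : 0 ≤ m * Real.exp (|μ.im| * z) := by positivity
    nlinarith
  have h4 : ‖y z‖ = m * Real.exp (|μ.im| * z) := by
    rw [hm, mul_assoc, ← Real.exp_add]; simp
  have h5 : m ≤ 2 * A := by
    rw [h4] at h3
    have hp := Real.exp_pos (|μ.im| * z)
    have : m * Real.exp (|μ.im| * z) ≤ (A + m / 2) * Real.exp (|μ.im| * z) := by linarith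
    linarith [le_of_mul_le_mul_right this hp]
  exact (hle x hx).trans (by gcongr)

section Expansion

variable {q : ℝ → ℂ}

theorem hasDerivAt_primitive (hq : Continuous q) (x : ℝ) :
    HasDerivAt (fun x => ∫ t in (0 : ℝ)..x, q t) (q x) x :=
  intervalIntegral.integral_hasDerivAt_right (hq.intervalIntegrable _ _)
    (hq.stronglyMeasurableAtFilter _ _) hq.continuousAt

theorem continuous_primitive_zero (hq : Continuous q) :
    Continuous (fun x => ∫ t in (0 : ℝ)..x, q t) :=
  continuous_iff_continuousAt.2 fun x => (hasDerivAt_primitive hq x).continuousAt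

theorem absolutelyContinuous_mul_primitive (hq : Continuous q)
    (hac : AbsolutelyContinuousOnInterval q 0 1) :
    AbsolutelyContinuousOnInterval (fun x => q x * ∫ t in (0 : ℝ)..x, q t) 0 1 :=
  hac.fun_smul (absolutelyContinuous_of_hasDerivWithinAt zero_le_one
    (fun x _ => (hasDerivAt_primitive hq x).hasDerivWithinAt) hq.continuousOn)

theorem integral_mul_primitive (hq : Continuous q) (hmean : ∫ t in (0 : ℝ)..1, q t = 0) :
    ∫ x in (0 : ℝ)..1, q x * ∫ t in (0 : ℝ)..x, q t = 0 := by
  have hQ := continuous_primitive_zero hq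
  have h := intervalIntegral.integral_eq_sub_of_hasDerivAt (a := 0) (b := 1)
    (f := fun x => (∫ t in (0 : ℝ)..x, q t) * (∫ t in (0 : ℝ)..x, q t) / 2)
    (f' := fun x => q x * ∫ t in (0 : ℝ)..x, q t) (fun x _ => by
      refine (((hasDerivAt_primitive hq x).mul (hasDerivAt_primitive hq x)).div_const
        2).congr_deriv ?_
      ring) ((hq.mul hQ).intervalIntegrable _ _)
  rw [h, hmean]
  simp

/-- The error scale `exp (|Im μ| x) / ‖μ‖ ^ k`. -/
def errScale (μ : ℂ) (k : ℕ) (x : ℝ) : ℝ := Real.exp (|μ.im| * x) / ‖μ‖ ^ k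

theorem errScale_nonneg (μ : ℂ) (k : ℕ) (x : ℝ) : 0 ≤ errScale μ k x := by
  unfold errScale; positivity

theorem norm_kernel_div_le {q f k : ℝ → ℂ} {μ : ℂ} {M B : ℝ} {x : ℝ} {j : ℕ}
    (hx : x ∈ Icc (0 : ℝ) 1) (hq : ∀ t, ‖q t‖ ≤ M)
    (hf : ∀ t ∈ Icc (0 : ℝ) 1, ‖f t‖ ≤ B * errScale μ j t) (hB : 0 ≤ B)
    (hk : ∀ t ∈ Icc 0 x, ‖k t‖ ≤ Real.exp (|μ.im| * (x - t))) :
    ‖∫ t in (0 : ℝ)..x, k t * (q t * f t)‖ ≤ M * B * errScale μ j x := by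
  have h := norm_integral_kernel_le (τ := |μ.im|) (B := B / ‖μ‖ ^ j) hx hq
    (fun t ht => (hf t ht).trans_eq (by rw [errScale]; ring)) (by positivity) hk
  exact h.trans_eq (by rw [errScale]; ring)

theorem norm_div_le_errScale {μ z : ℂ} {B x : ℝ} {j : ℕ}
    (h : ‖z‖ ≤ B * errScale μ j x) : ‖z / μ‖ ≤ B * errScale μ (j + 1) x := by
  rw [norm_div]
  have : B * errScale μ (j + 1) x = B * errScale μ j x / ‖μ‖ := by
    rw [errScale, errScale, pow_succ]; field_simp
  rw [this]
  gcongr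

end Expansion

section FundamentalSystem

variable {q : ℝ → ℂ} {M : ℝ}

theorem mul_errScale_le {μ : ℂ} {k : ℕ} {x B C : ℝ} (h : B ≤ C) :
    B * errScale μ k x ≤ C * errScale μ k x :=
  mul_le_mul_of_nonneg_right h (errScale_nonneg _ _ _)

/-- The sine integral `∫₀¹ q(t) sin (μ (1 - 2 t)) dt`, which carries the influence of the boundary
values of `q` on the fundamental system. -/
def sinIntegral (q : ℝ → ℂ) (μ : ℂ) : ℂ :=
  ∫ t in (0 : ℝ)..1, q t * Complex.sin (μ * ((1 - 2 * t : ℝ) : ℂ))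

/-- Asymptotics of the solution with `y 0 = 1`, `y' 0 = 0`. -/
theorem exists_cosine_asymptotics (hq : Continuous q) (hM : ∀ t, ‖q t‖ ≤ M)
    (hac : AbsolutelyContinuousOnInterval q 0 1) (hmean : ∫ t in (0 : ℝ)..1, q t = 0) :
    ∃ C : ℝ, 0 ≤ C ∧ ∀ μ : ℂ, μ ≠ 0 → 2 * M ≤ ‖μ‖ → ∀ y dy : ℝ → ℂ, IsSol q (μ ^ 2) 0 y dy →
      Continuous y → y 0 = 1 → dy 0 = 0 →
      (∀ x ∈ Icc (0 : ℝ) 1, ‖y x - Complex.cos (μ * x)‖ ≤ C * errScale μ 1 x) ∧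
      ‖y 1 - (Complex.cos μ + sinIntegral q μ / (2 * μ))‖ ≤ C * errScale μ 3 1 ∧
      ‖dy 1 + μ * Complex.sin μ‖ ≤ C * errScale μ 0 1 := by
  have hM0 : 0 ≤ M := (norm_nonneg _).trans (hM 0)
  have hQ := continuous_primitive_zero hq
  obtain ⟨C₁, hC₁, hosc₁⟩ := exists_norm_integral_mul_le hac
  obtain ⟨C₂, hC₂, hosc₂⟩ := exists_norm_integral_mul_le (absolutelyContinuous_mul_primitive hq hac)
  refine ⟨2 * M + (M * (M * (M * 2) + C₁) + C₂), by positivity, ?_⟩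
  intro μ hμ0 hμ y dy H hy h0 h0'
  have h1m : (1 : ℝ) ∈ Icc (0 : ℝ) 1 := right_mem_Icc.2 zero_le_one
  have hb : ∀ t ∈ Icc (0 : ℝ) 1, ‖y t‖ ≤ 2 * errScale μ 0 t := fun t ht => by
    have := H.norm_le hq hy hM hμ hμ0 (A := 1) (fun x hx => by
      rw [h0, h0', one_mul, zero_mul, zero_div, add_zero, one_mul]
      exact norm_cos_mul_le (abs_of_nonneg hx.1).le) ht
    simpa [errScale] using this
  have hD : ∀ x ∈ Icc (0 : ℝ) 1, y x - Complex.cos (μ * x) =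
      (∫ t in (0 : ℝ)..x, Complex.sin (μ * ((x - t : ℝ) : ℂ)) * (q t * y t)) / μ := fun x hx => by
    rw [H.duhamel hq hy hμ0 hx, h0, h0']
    ring
  have hr1 : ∀ x ∈ Icc (0 : ℝ) 1, ‖y x - Complex.cos (μ * x)‖ ≤ M * 2 * errScale μ 1 x :=
    fun x hx => by
      rw [hD x hx]
      exact norm_div_le_errScale (norm_kernel_div_le hx hM hb (by norm_num)
        fun t ht => norm_sin_sub_le μ ht)
  -- the integral equation with `cos (μ t)` split off from `y t` under the integral
  have hD2 : ∀ x ∈ Icc (0 : ℝ) 1, y x - Complex.cos (μ * x) =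
      (Complex.sin (μ * x) * (∫ t in (0 : ℝ)..x, q t) +
        ∫ t in (0 : ℝ)..x, q t * Complex.sin (μ * ((x - 2 * t : ℝ) : ℂ))) / 2 / μ +
      (∫ t in (0 : ℝ)..x, Complex.sin (μ * ((x - t : ℝ) : ℂ)) *
        (q t * (y t - Complex.cos (μ * t)))) / μ := fun x hx => by
    rw [hD x hx, ← integral_sin_mul_cos hq, ← add_div, ← intervalIntegral.integral_add]
    · congr 2; funext t; ring
    all_goals exact Continuous.intervalIntegrable (by fun_prop) _ _
  have hr2 : ∀ x ∈ Icc (0 : ℝ) 1,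
      ‖y x - Complex.cos (μ * x) - Complex.sin (μ * x) * (∫ t in (0 : ℝ)..x, q t) / 2 / μ‖ ≤
        (M * (M * 2) + C₁) * errScale μ 2 x := fun x hx => by
    have e : y x - Complex.cos (μ * x) - Complex.sin (μ * x) * (∫ t in (0 : ℝ)..x, q t) / 2 / μ =
        (∫ t in (0 : ℝ)..x, q t * Complex.sin (μ * ((x - 2 * t : ℝ) : ℂ))) / 2 / μ +
        (∫ t in (0 : ℝ)..x, Complex.sin (μ * ((x - t : ℝ) : ℂ)) *
          (q t * (y t - Complex.cos (μ * t)))) / μ := by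
      rw [hD2 x hx]; ring
    rw [e]
    refine (norm_add_le _ _).trans ?_
    have a1 : ‖(∫ t in (0 : ℝ)..x, Complex.sin (μ * ((x - t : ℝ) : ℂ)) *
          (q t * (y t - Complex.cos (μ * t)))) / μ‖ ≤ M * (M * 2) * errScale μ 2 x :=
      norm_div_le_errScale (norm_kernel_div_le hx hM hr1 (by positivity)
        fun t ht => norm_sin_sub_le μ ht)
    have a2 : ‖(∫ t in (0 : ℝ)..x, q t * Complex.sin (μ * ((x - 2 * t : ℝ) : ℂ))) / 2 / μ‖ ≤
        C₁ * errScale μ 2 x := by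
      refine norm_div_le_errScale ?_
      have := (hosc₁ μ hμ0 x hx).1
      rw [norm_div, Complex.norm_ofNat]
      have h2 : C₁ * Real.exp (|μ.im| * x) / ‖μ‖ = C₁ * errScale μ 1 x := by
        rw [errScale]; ring
      rw [h2] at this
      linarith [norm_nonneg (∫ t in (0 : ℝ)..x, q t * Complex.sin (μ * ((x - 2 * t : ℝ) : ℂ)))]
    linarith
  refine ⟨fun x hx => (hr1 x hx).trans (mul_errScale_le ?_), ?_, ?_⟩
  · have : 0 ≤ M * (M * (M * 2) + C₁) + C₂ := by positivity
    linarith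
  · have e : y 1 - (Complex.cos μ + sinIntegral q μ / (2 * μ)) =
        (∫ t in (0 : ℝ)..1, q t * (∫ u in (0 : ℝ)..t, q u) *
          Complex.cos (μ * ((1 - 2 * t : ℝ) : ℂ))) / 2 / 2 / μ / μ +
        (∫ t in (0 : ℝ)..1, Complex.sin (μ * ((1 - t : ℝ) : ℂ)) * (q t * (y t - Complex.cos (μ * t)
          - Complex.sin (μ * t) * (∫ t in (0 : ℝ)..t, q t) / 2 / μ))) / μ := by
      have h := hD2 1 h1m
      rw [hmean, mul_zero, zero_add, Complex.ofReal_one, mul_one] at h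
      have h3 := integral_sin_mul_sin (f := fun t => q t * ∫ u in (0 : ℝ)..t, q u) (hq.mul hQ) μ 1
      rw [integral_mul_primitive hq hmean, mul_zero, neg_zero, zero_add] at h3
      have h4 : ∫ t in (0 : ℝ)..1, Complex.sin (μ * ((1 - t : ℝ) : ℂ)) *
          (q t * (y t - Complex.cos (μ * t))) =
          (∫ t in (0 : ℝ)..1, Complex.sin (μ * ((1 - t : ℝ) : ℂ)) *
            (q t * (∫ u in (0 : ℝ)..t, q u) * Complex.sin (μ * t))) / 2 / μ +
          ∫ t in (0 : ℝ)..1, Complex.sin (μ * ((1 - t : ℝ) : ℂ)) * (q t * (y t -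
            Complex.cos (μ * t) - Complex.sin (μ * t) * (∫ t in (0 : ℝ)..t, q t) / 2 / μ)) := by
        rw [← intervalIntegral.integral_div, ← intervalIntegral.integral_div,
          ← intervalIntegral.integral_add]
        · congr 1; funext t; ring
        all_goals exact Continuous.intervalIntegrable (by fun_prop) _ _
      rw [h4, h3] at h
      rw [sinIntegral]
      linear_combination h
    rw [e]
    refine (norm_add_le _ _).trans ?_
    have a1 := norm_div_le_errScale (norm_kernel_div_le h1m hM hr2 (by positivity)
        fun t ht => norm_sin_sub_le μ ht)
    have a2 : ‖(∫ t in (0 : ℝ)..1, q t * (∫ u in (0 : ℝ)..t, q u) *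
          Complex.cos (μ * ((1 - 2 * t : ℝ) : ℂ))) / 2 / 2 / μ / μ‖ ≤ C₂ * errScale μ 3 1 := by
      refine norm_div_le_errScale (norm_div_le_errScale ?_)
      have := (hosc₂ μ hμ0 1 h1m).2
      rw [norm_div, norm_div, Complex.norm_ofNat]
      have h2 : C₂ * Real.exp (|μ.im| * 1) / ‖μ‖ = C₂ * errScale μ 1 1 := by
        rw [errScale]; ring
      rw [h2] at this
      linarith [norm_nonneg (∫ t in (0 : ℝ)..1, q t * (∫ u in (0 : ℝ)..t, q u) *
          Complex.cos (μ * ((1 - 2 * t : ℝ) : ℂ)))]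
    have a3 := mul_errScale_le (μ := μ) (k := 3) (x := 1)
      (show M * (M * (M * 2) + C₁) + C₂ ≤ 2 * M + (M * (M * (M * 2) + C₁) + C₂) by linarith)
    linarith
  · have h := H.duhamel_deriv hq hy h1m
    rw [h0, h0', Complex.ofReal_one, mul_one] at h
    have e : dy 1 + μ * Complex.sin μ =
        ∫ t in (0 : ℝ)..1, Complex.cos (μ * ((1 - t : ℝ) : ℂ)) * (q t * y t) := by
      rw [h]; ring
    rw [e]
    refine (norm_kernel_div_le h1m hM hb (by norm_num) fun t ht => norm_cos_sub_le μ ht).trans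
      (mul_errScale_le ?_)
    have : 0 ≤ M * (M * (M * 2) + C₁) + C₂ := by positivity
    linarith

/-- Asymptotics of the solution with `y 0 = 0`, `y' 0 = 1`. -/
theorem exists_sine_asymptotics (hq : Continuous q) (hM : ∀ t, ‖q t‖ ≤ M)
    (hac : AbsolutelyContinuousOnInterval q 0 1) (hmean : ∫ t in (0 : ℝ)..1, q t = 0) :
    ∃ C : ℝ, 0 ≤ C ∧ ∀ μ : ℂ, μ ≠ 0 → 2 * M ≤ ‖μ‖ → ∀ y dy : ℝ → ℂ, IsSol q (μ ^ 2) 0 y dy →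
      Continuous y → y 0 = 0 → dy 0 = 1 →
      (∀ x ∈ Icc (0 : ℝ) 1, ‖y x‖ ≤ 2 * errScale μ 1 x) ∧
      ‖y 1 - Complex.sin μ / μ‖ ≤ C * errScale μ 3 1 ∧
      ‖dy 1 - (Complex.cos μ - sinIntegral q μ / (2 * μ))‖ ≤ C * errScale μ 3 1 := by
  have hM0 : 0 ≤ M := (norm_nonneg _).trans (hM 0)
  have hQ := continuous_primitive_zero hq
  obtain ⟨C₁, hC₁, hosc₁⟩ := exists_norm_integral_mul_le hac
  obtain ⟨C₂, hC₂, hosc₂⟩ := exists_norm_integral_mul_le (absolutelyContinuous_mul_primitive hq hac)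
  refine ⟨(M * (M * 2) + C₁) + (M * (M * (M * 2) + C₁) + C₂), by positivity, ?_⟩
  intro μ hμ0 hμ y dy H hy h0 h0'
  have h1m : (1 : ℝ) ∈ Icc (0 : ℝ) 1 := right_mem_Icc.2 zero_le_one
  have hb : ∀ t ∈ Icc (0 : ℝ) 1, ‖y t‖ ≤ 2 * errScale μ 1 t := fun t ht => by
    have := H.norm_le hq hy hM hμ hμ0 (A := 1 / ‖μ‖) (fun x hx => by
      rw [h0, h0', zero_mul, zero_add, one_mul, norm_div, div_mul_eq_mul_div, one_mul]
      gcongr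
      exact norm_sin_mul_le (abs_of_nonneg hx.1).le) ht
    refine this.trans_eq ?_
    rw [errScale]; ring
  have hD : ∀ x ∈ Icc (0 : ℝ) 1, y x - Complex.sin (μ * x) / μ =
      (∫ t in (0 : ℝ)..x, Complex.sin (μ * ((x - t : ℝ) : ℂ)) * (q t * y t)) / μ := fun x hx => by
    rw [H.duhamel hq hy hμ0 hx, h0, h0']
    ring
  have hr1 : ∀ x ∈ Icc (0 : ℝ) 1, ‖y x - Complex.sin (μ * x) / μ‖ ≤ M * 2 * errScale μ 2 x :=
    fun x hx => by
      rw [hD x hx]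
      exact norm_div_le_errScale (norm_kernel_div_le hx hM hb (by norm_num)
        fun t ht => norm_sin_sub_le μ ht)
  -- the integral equation with `sin (μ t) / μ` split off from `y t` under the integral
  have hD2 : ∀ x ∈ Icc (0 : ℝ) 1, y x - Complex.sin (μ * x) / μ =
      (-(Complex.cos (μ * x) * (∫ t in (0 : ℝ)..x, q t)) +
        ∫ t in (0 : ℝ)..x, q t * Complex.cos (μ * ((x - 2 * t : ℝ) : ℂ))) / 2 / μ / μ +
      (∫ t in (0 : ℝ)..x, Complex.sin (μ * ((x - t : ℝ) : ℂ)) *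
        (q t * (y t - Complex.sin (μ * t) / μ))) / μ := fun x hx => by
    rw [hD x hx, ← integral_sin_mul_sin hq, ← add_div]
    congr 1
    rw [← intervalIntegral.integral_div, ← intervalIntegral.integral_add]
    · congr 1; funext t; ring
    all_goals exact Continuous.intervalIntegrable (by fun_prop) _ _
  have hr2 : ∀ x ∈ Icc (0 : ℝ) 1, ‖y x - Complex.sin (μ * x) / μ +
      Complex.cos (μ * x) * (∫ t in (0 : ℝ)..x, q t) / 2 / μ / μ‖ ≤
        (M * (M * 2) + C₁) * errScale μ 3 x := fun x hx => by
    have e : y x - Complex.sin (μ * x) / μ +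
        Complex.cos (μ * x) * (∫ t in (0 : ℝ)..x, q t) / 2 / μ / μ =
        (∫ t in (0 : ℝ)..x, q t * Complex.cos (μ * ((x - 2 * t : ℝ) : ℂ))) / 2 / μ / μ +
        (∫ t in (0 : ℝ)..x, Complex.sin (μ * ((x - t : ℝ) : ℂ)) *
          (q t * (y t - Complex.sin (μ * t) / μ))) / μ := by
      rw [hD2 x hx]; ring
    rw [e]
    refine (norm_add_le _ _).trans ?_
    have a1 := norm_div_le_errScale (norm_kernel_div_le hx hM hr1 (by positivity)
        fun t ht => norm_sin_sub_le μ ht)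
    have a2 : ‖(∫ t in (0 : ℝ)..x, q t * Complex.cos (μ * ((x - 2 * t : ℝ) : ℂ))) / 2 / μ / μ‖ ≤
        C₁ * errScale μ 3 x := by
      refine norm_div_le_errScale (norm_div_le_errScale ?_)
      have := (hosc₁ μ hμ0 x hx).2
      rw [norm_div, Complex.norm_ofNat]
      have h2 : C₁ * Real.exp (|μ.im| * x) / ‖μ‖ = C₁ * errScale μ 1 x := by
        rw [errScale]; ring
      rw [h2] at this
      linarith [norm_nonneg (∫ t in (0 : ℝ)..x, q t * Complex.cos (μ * ((x - 2 * t : ℝ) : ℂ)))]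
    linarith
  have hC : 0 ≤ M * (M * 2) + C₁ := by positivity
  have hC' : 0 ≤ M * (M * (M * 2) + C₁) + C₂ := by positivity
  refine ⟨hb, ?_, ?_⟩
  · have h := hr2 1 h1m
    rw [hmean, mul_zero, zero_div, zero_div, zero_div, add_zero, Complex.ofReal_one, mul_one] at h
    exact h.trans (mul_errScale_le (by linarith))
  · have e : dy 1 - (Complex.cos μ - sinIntegral q μ / (2 * μ)) =
        -((∫ t in (0 : ℝ)..1, q t * (∫ u in (0 : ℝ)..t, q u) *
          Complex.cos (μ * ((1 - 2 * t : ℝ) : ℂ))) / 2 / 2 / μ / μ) +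
        ∫ t in (0 : ℝ)..1, Complex.cos (μ * ((1 - t : ℝ) : ℂ)) * (q t * (y t -
          Complex.sin (μ * t) / μ +
            Complex.cos (μ * t) * (∫ t in (0 : ℝ)..t, q t) / 2 / μ / μ)) := by
      have h := H.duhamel_deriv hq hy h1m
      rw [h0, h0', Complex.ofReal_one, mul_one] at h
      have h2 := integral_cos_mul_sin hq μ 1
      rw [hmean, mul_zero, zero_sub] at h2
      have h3 := integral_cos_mul_cos (f := fun t => q t * ∫ u in (0 : ℝ)..t, q u) (hq.mul hQ) μ 1
      rw [integral_mul_primitive hq hmean, mul_zero, zero_add] at h3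
      have h4 : ∫ t in (0 : ℝ)..1, Complex.cos (μ * ((1 - t : ℝ) : ℂ)) * (q t * y t) =
          (∫ t in (0 : ℝ)..1, Complex.cos (μ * ((1 - t : ℝ) : ℂ)) * (q t * Complex.sin (μ * t))) / μ
          - (∫ t in (0 : ℝ)..1, Complex.cos (μ * ((1 - t : ℝ) : ℂ)) *
            (q t * (∫ u in (0 : ℝ)..t, q u) * Complex.cos (μ * t))) / 2 / μ / μ +
          ∫ t in (0 : ℝ)..1, Complex.cos (μ * ((1 - t : ℝ) : ℂ)) * (q t * (y t -
            Complex.sin (μ * t) / μ +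
              Complex.cos (μ * t) * (∫ t in (0 : ℝ)..t, q t) / 2 / μ / μ)) := by
        rw [← intervalIntegral.integral_div, ← intervalIntegral.integral_div,
          ← intervalIntegral.integral_div, ← intervalIntegral.integral_div,
          ← intervalIntegral.integral_sub, ← intervalIntegral.integral_add]
        · congr 1; funext t; ring
        all_goals exact Continuous.intervalIntegrable (by fun_prop) _ _
      rw [h4, h3, h2] at h
      rw [sinIntegral]
      linear_combination h
    rw [e]
    refine (norm_add_le _ _).trans ?_
    have a1 := norm_kernel_div_le h1m hM hr2 hC fun t ht => norm_cos_sub_le μ ht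
    have a2 : ‖-((∫ t in (0 : ℝ)..1, q t * (∫ u in (0 : ℝ)..t, q u) *
          Complex.cos (μ * ((1 - 2 * t : ℝ) : ℂ))) / 2 / 2 / μ / μ)‖ ≤ C₂ * errScale μ 3 1 := by
      rw [norm_neg]
      refine norm_div_le_errScale (norm_div_le_errScale ?_)
      have := (hosc₂ μ hμ0 1 h1m).2
      rw [norm_div, norm_div, Complex.norm_ofNat]
      have h2 : C₂ * Real.exp (|μ.im| * 1) / ‖μ‖ = C₂ * errScale μ 1 1 := by
        rw [errScale]; ring
      rw [h2] at this
      linarith [norm_nonneg (∫ t in (0 : ℝ)..1, q t * (∫ u in (0 : ℝ)..t, q u) *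
          Complex.cos (μ * ((1 - 2 * t : ℝ) : ℂ)))]
    have a3 := mul_errScale_le (μ := μ) (k := 3) (x := 1)
      (show M * (M * (M * 2) + C₁) + C₂ ≤
        (M * (M * 2) + C₁) + (M * (M * (M * 2) + C₁) + C₂) by linarith)
    linarith

end FundamentalSystem

/-! ### Asymptotics of the characteristic function and localization of its zeros -/

theorem isSol_extend_sol (p : CI) (lam a b : ℂ) :
    IsSol (extend p) lam 0 (extend (sol p lam a b 0)) (extend (dsol p lam a b 0)) :=
  (isSol_sol p lam a b 0).congr (fun _ _ => rfl) (fun _ _ => rfl)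

theorem extend_zero (u : CI) : extend u 0 = u 0 := extend_coe u 0

theorem extend_one (u : CI) : extend u 1 = u 1 := extend_coe u 1

theorem exists_charFun_asymptotics (β₁ β₂ : ℂ) {p : CI}
    (hac : AbsolutelyContinuousOnInterval (extend p) 0 1)
    (hmean : ∫ t in (0 : ℝ)..1, extend p t = 0) :
    ∃ C : ℝ, 0 ≤ C ∧ ∀ μ : ℂ, μ ≠ 0 → 2 * ‖p‖ ≤ ‖μ‖ →
      ‖charFun β₁ β₂ p (μ ^ 2) - ((1 - β₁) * (1 - Complex.cos μ) + β₂ * Complex.sin μ / μ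
        - (1 + β₁) * sinIntegral (extend p) μ / (2 * μ))‖ ≤ C * errScale μ 3 1 := by
  obtain ⟨C₁, hC₁, h₁⟩ :=
    exists_cosine_asymptotics (continuous_extend p) (norm_extend_le p) hac hmean
  obtain ⟨C₂, hC₂, h₂⟩ := exists_sine_asymptotics (continuous_extend p) (norm_extend_le p) hac hmean
  refine ⟨‖β₁‖ * C₂ + C₁ + ‖β₂‖ * C₂, by positivity, fun μ hμ0 hμ => ?_⟩
  obtain ⟨-, a1, -⟩ := h₁ μ hμ0 hμ _ _ (isSol_extend_sol p (μ ^ 2) 1 0) (continuous_extend _)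
    (by rw [extend_zero, sol_zero_apply]) (by rw [extend_zero, dsol_zero_apply])
  obtain ⟨-, a2, a3⟩ := h₂ μ hμ0 hμ _ _ (isSol_extend_sol p (μ ^ 2) 0 1) (continuous_extend _)
    (by rw [extend_zero, sol_zero_apply]) (by rw [extend_zero, dsol_zero_apply])
  rw [extend_one] at a1 a2 a3
  have e : charFun β₁ β₂ p (μ ^ 2) - ((1 - β₁) * (1 - Complex.cos μ) + β₂ * Complex.sin μ / μ
        - (1 + β₁) * sinIntegral (extend p) μ / (2 * μ)) =
      β₁ * (dsol p (μ ^ 2) 0 1 0 1 - (Complex.cos μ - sinIntegral (extend p) μ / (2 * μ))) -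
      (sol p (μ ^ 2) 1 0 0 1 - (Complex.cos μ + sinIntegral (extend p) μ / (2 * μ))) +
      β₂ * (sol p (μ ^ 2) 0 1 0 1 - Complex.sin μ / μ) := by
    rw [charFun]; ring
  rw [e]
  refine (norm_add_le _ _).trans ?_
  have b1 := norm_sub_le
    (β₁ * (dsol p (μ ^ 2) 0 1 0 1 - (Complex.cos μ - sinIntegral (extend p) μ / (2 * μ))))
    (sol p (μ ^ 2) 1 0 0 1 - (Complex.cos μ + sinIntegral (extend p) μ / (2 * μ)))
  rw [norm_mul] at b1 ⊢
  have b2 := mul_le_mul_of_nonneg_left a3 (norm_nonneg β₁)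
  have b3 := mul_le_mul_of_nonneg_left a2 (norm_nonneg β₂)
  linarith

theorem exists_norm_sinIntegral_le {q : ℝ → ℂ} (hac : AbsolutelyContinuousOnInterval q 0 1) :
    ∃ C : ℝ, 0 ≤ C ∧ ∀ μ : ℂ, μ ≠ 0 → ‖sinIntegral q μ‖ ≤ C * errScale μ 1 1 := by
  obtain ⟨C, hC, h⟩ := exists_norm_integral_mul_le hac
  refine ⟨C, hC, fun μ hμ => ?_⟩
  have := (h μ hμ 1 (right_mem_Icc.2 zero_le_one)).1
  rwa [show C * Real.exp (|μ.im| * 1) / ‖μ‖ = C * errScale μ 1 1 by rw [errScale]; ring] at this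

theorem norm_sin_sq (w : ℂ) : ‖Complex.sin w‖ ^ 2 = Real.sin w.re ^ 2 + Real.sinh w.im ^ 2 := by
  rw [← Complex.normSq_eq_norm_sq, Complex.sin_eq, ← Complex.ofReal_sin, ← Complex.ofReal_cos,
    ← Complex.ofReal_cosh, ← Complex.ofReal_sinh, ← Complex.ofReal_mul, ← Complex.ofReal_mul,
    Complex.normSq_add_mul_I]
  have h1 := Real.sin_sq_add_cos_sq w.re
  have h2 := Real.cosh_sq w.im
  rw [mul_pow, mul_pow, h2]
  linear_combination Real.sinh w.im ^ 2 * h1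

/-- The distance of `w` to the zeros of the sine is controlled by `sin w`. -/
theorem exists_norm_sub_le_norm_sin (w : ℂ) :
    ∃ k : ℤ, ‖w - k * Real.pi‖ ≤ Real.pi / 2 * ‖Complex.sin w‖ := by
  have hpi := Real.pi_pos
  refine ⟨round (w.re / Real.pi), ?_⟩
  set k := round (w.re / Real.pi) with hk
  set v := w - k * Real.pi with hv
  have h1 : ‖Complex.sin v‖ = ‖Complex.sin w‖ := by
    rw [hv, Complex.sin_antiperiodic.sub_int_mul_eq k, norm_mul]
    rcases Int.units_eq_one_or k.negOnePow with h | h <;> simp [h]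
  have hre : |v.re| ≤ Real.pi / 2 := by
    have h := abs_sub_round (w.re / Real.pi)
    have e : v.re = (w.re / Real.pi - k) * Real.pi := by
      rw [hv]; simp; field_simp
    rw [e, abs_mul, abs_of_pos hpi]
    rw [← hk] at h
    nlinarith
  have h2 : (2 / Real.pi * v.re) ^ 2 ≤ Real.sin v.re ^ 2 := by
    rw [← sq_abs (Real.sin v.re), ← sq_abs (2 / Real.pi * v.re), abs_mul,
      abs_of_pos (show 0 < 2 / Real.pi by positivity)]
    have := Real.mul_abs_le_abs_sin hre
    gcongr
  have h3 : v.im ^ 2 ≤ Real.sinh v.im ^ 2 := by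
    rw [← sq_abs v.im, ← sq_abs (Real.sinh _), Real.abs_sinh]
    gcongr
    exact Real.self_le_sinh_iff.2 (abs_nonneg _)
  rw [← h1]
  refine le_of_sq_le_sq ?_ (by positivity)
  rw [mul_pow, norm_sin_sq, ← Complex.normSq_eq_norm_sq, Complex.normSq_apply]
  have h4 : (2 / Real.pi * v.re) ^ 2 = (2 / Real.pi) ^ 2 * v.re ^ 2 := by ring
  have h5 : (2 / Real.pi) ^ 2 ≤ 1 := by
    have : 2 / Real.pi ≤ 1 := by rw [div_le_one hpi]; linarith [Real.pi_gt_three]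
    exact pow_le_one₀ (by positivity) this
  have h6 : (Real.pi / 2) ^ 2 * (2 / Real.pi) ^ 2 = 1 := by field_simp
  have h7 : (2 / Real.pi) ^ 2 * (v.re ^ 2 + v.im ^ 2) ≤ Real.sin v.re ^ 2 + Real.sinh v.im ^ 2 := by
    nlinarith [sq_nonneg v.im]
  have h8 := mul_le_mul_of_nonneg_left h7 (sq_nonneg (Real.pi / 2))
  rw [← mul_assoc, h6] at h8
  linarith

/-- If `sin w` is small compared with `exp |Im w|`, then it is small: `|Im w|` is bounded because
`sinh |Im w| ≤ ‖sin w‖`. -/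
theorem norm_sin_le_of_le_exp {w : ℂ} {δ : ℝ} (hδ : δ ≤ 1 / 4)
    (h : ‖Complex.sin w‖ ≤ δ * Real.exp |w.im|) : ‖Complex.sin w‖ ≤ 2 * δ := by
  have h1 : Real.sinh |w.im| ≤ ‖Complex.sin w‖ := by
    refine le_of_sq_le_sq ?_ (norm_nonneg _)
    rw [norm_sin_sq, ← Real.abs_sinh, sq_abs]
    linarith [sq_nonneg (Real.sin w.re)]
  rw [Real.sinh_eq] at h1
  have hp := Real.exp_pos |w.im|
  have h2 : Real.exp |w.im| * Real.exp (-|w.im|) = 1 := by rw [← Real.exp_add]; simp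
  have hδ0 : 0 ≤ δ := by
    by_contra hc
    nlinarith [norm_nonneg (Complex.sin w)]
  have h3 : Real.exp |w.im| ≤ 2 := by
    have h4 : Real.exp |w.im| ≤ 2 * Real.exp (-|w.im|) := by nlinarith
    have h5 : Real.exp |w.im| ^ 2 ≤ 2 := by nlinarith
    nlinarith
  nlinarith

/-- At a large zero `z ^ 2` of the characteristic function, `sin (z / 2)` is of order `1 / ‖z‖`
compared with its natural growth. -/
theorem exists_norm_sin_half_le (β₁ β₂ : ℂ) (hβ : β₁ ≠ 1) {p : CI}
    (hac : AbsolutelyContinuousOnInterval (extend p) 0 1)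
    (hmean : ∫ t in (0 : ℝ)..1, extend p t = 0) :
    ∃ K : ℝ, 1 ≤ K ∧ ∀ z : ℂ, 2 * ‖p‖ ≤ ‖z‖ → 1 ≤ ‖z‖ → charFun β₁ β₂ p (z ^ 2) = 0 →
      ‖Complex.sin (z / 2)‖ ≤ K / ‖z‖ * Real.exp |(z / 2).im| := by
  obtain ⟨C₁, hC₁, h₁⟩ := exists_charFun_asymptotics β₁ β₂ hac hmean
  obtain ⟨C₂, hC₂, h₂⟩ := exists_norm_sinIntegral_le hac
  have ha : 0 < 2 * ‖1 - β₁‖ := by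
    have : 0 < ‖1 - β₁‖ := norm_pos_iff.2 (sub_ne_zero.2 hβ.symm)
    positivity
  set a := 2 * ‖1 - β₁‖ with ha'
  set B := 2 * ‖β₂‖ + (C₁ + ‖1 + β₁‖ * C₂) with hB
  have hB0 : 0 ≤ B := by positivity
  set K := B / a + 1 with hK
  have hK0 : 1 ≤ K := by rw [hK]; linarith [div_nonneg hB0 ha.le]
  refine ⟨K, hK0, fun z hz1 hz2 h0 => ?_⟩
  have hzp : 0 < ‖z‖ := by linarith
  have hz0 : z ≠ 0 := norm_pos_iff.1 hzp
  set τ := |z.im| with hτ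
  set s := Complex.sin (z / 2) with hs
  set c := Complex.cos (z / 2) with hc
  have him : |(z / 2).im| = τ / 2 := by
    rw [show (z / 2).im = z.im / 2 by simp, abs_div, abs_two]
  have hcn : ‖c‖ ≤ Real.exp (τ / 2) := by rw [← him]; exact norm_cos_le_exp _
  have hexp : Real.exp τ = Real.exp (τ / 2) ^ 2 := by rw [← Real.exp_nat_mul]; ring_nf
  have hcos : 1 - Complex.cos z = 2 * s ^ 2 := by
    rw [show z = 2 * (z / 2) by ring, Complex.cos_two_mul, Complex.cos_sq', ← hs]; ring
  have hsin : Complex.sin z = 2 * s * c := by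
    rw [show z = 2 * (z / 2) by ring, Complex.sin_two_mul]
  -- the characteristic equation, as a quadratic inequality for the normalized sine
  set x := ‖s‖ / Real.exp (τ / 2) * ‖z‖ with hx
  have hE := Real.exp_pos (τ / 2)
  have hsx : ‖s‖ = x * Real.exp (τ / 2) / ‖z‖ := by rw [hx]; field_simp
  have hx0 : 0 ≤ x := by positivity
  have hquad : a * x ^ 2 ≤ 2 * ‖β₂‖ * x + (C₁ + ‖1 + β₁‖ * C₂) := by
    have k1 := h₁ z hz0 hz1
    rw [h0, hcos, hsin] at k1
    have k2 := h₂ z hz0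
    have e : (1 - β₁) * (2 * s ^ 2) =
        (1 + β₁) * sinIntegral (extend p) z / (2 * z) - β₂ * (2 * s * c) / z -
        (0 - ((1 - β₁) * (2 * s ^ 2) + β₂ * (2 * s * c) / z
          - (1 + β₁) * sinIntegral (extend p) z / (2 * z))) := by ring
    have k3 : ‖(1 - β₁) * (2 * s ^ 2)‖ ≤ ‖(1 + β₁) * sinIntegral (extend p) z / (2 * z)‖ +
        ‖β₂ * (2 * s * c) / z‖ + C₁ * errScale z 3 1 := by
      rw [e]
      exact (norm_sub_le _ _).trans (add_le_add (norm_sub_le _ _) k1)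
    have k4 : ‖(1 - β₁) * (2 * s ^ 2)‖ = a * x ^ 2 * (Real.exp τ / ‖z‖ ^ 2) := by
      rw [norm_mul, norm_mul, norm_pow, Complex.norm_ofNat, hsx, hexp, ha']
      field_simp
    have k5 : ‖β₂ * (2 * s * c) / z‖ ≤ 2 * ‖β₂‖ * x * (Real.exp τ / ‖z‖ ^ 2) := by
      rw [norm_div, norm_mul, norm_mul, norm_mul, Complex.norm_ofNat]
      calc ‖β₂‖ * (2 * ‖s‖ * ‖c‖) / ‖z‖ ≤ ‖β₂‖ * (2 * ‖s‖ * Real.exp (τ / 2)) / ‖z‖ := by gcongr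
        _ = _ := by rw [hsx, hexp]; field_simp
    have k6 : ‖(1 + β₁) * sinIntegral (extend p) z / (2 * z)‖ ≤
        ‖1 + β₁‖ * C₂ * (Real.exp τ / ‖z‖ ^ 2) := by
      rw [norm_div, norm_mul, norm_mul, Complex.norm_ofNat]
      rw [errScale, mul_one, ← hτ, pow_one] at k2
      calc ‖1 + β₁‖ * ‖sinIntegral (extend p) z‖ / (2 * ‖z‖)
          ≤ ‖1 + β₁‖ * (C₂ * (Real.exp τ / ‖z‖)) / (1 * ‖z‖) := by gcongr; norm_num
        _ = _ := by field_simp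
    have k7 : C₁ * errScale z 3 1 ≤ C₁ * (Real.exp τ / ‖z‖ ^ 2) := by
      rw [errScale, mul_one, ← hτ]
      gcongr
      · linarith
    have hpos : 0 < Real.exp τ / ‖z‖ ^ 2 := by positivity
    refine le_of_mul_le_mul_right ?_ hpos
    rw [k4] at k3
    linarith
  have hxK : x ≤ K := by
    by_contra! hlt
    have h1 : 1 ≤ x := by linarith
    have h2 : a * K = B + a := by rw [hK]; field_simp
    have h3 : a * K * x < a * x * x := by gcongr
    have h4 : (C₁ + ‖1 + β₁‖ * C₂) * 1 ≤ (C₁ + ‖1 + β₁‖ * C₂) * x := by gcongr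
    rw [h2] at h3
    have h5 : 0 ≤ a * x := by positivity
    nlinarith
  rw [him, hsx]
  calc x * Real.exp (τ / 2) / ‖z‖ ≤ K * Real.exp (τ / 2) / ‖z‖ := by gcongr
    _ = _ := by ring

/-- The large zeros of the characteristic function, as a function of the square root of the spectral
parameter, lie within `O(1/n)` of the points `2πn`. -/
theorem exists_localization (β₁ β₂ : ℂ) (hβ : β₁ ≠ 1) {p : CI}
    (hac : AbsolutelyContinuousOnInterval (extend p) 0 1)
    (hmean : ∫ t in (0 : ℝ)..1, extend p t = 0) :
    ∃ C R : ℝ, 0 ≤ C ∧ ∀ z : ℂ, R ≤ ‖z‖ → 0 ≤ z.re → charFun β₁ β₂ p (z ^ 2) = 0 →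
      ∃ n : ℕ, 1 ≤ n ∧ ‖z - 2 * Real.pi * n‖ ≤ C / n := by
  obtain ⟨K, hK0, hK⟩ := exists_norm_sin_half_le β₁ β₂ hβ hac hmean
  have hpi := Real.pi_gt_three
  refine ⟨2 * Real.pi * K, max (2 * ‖p‖) (max 10 (2 * Real.pi * K)), by positivity, ?_⟩
  intro z hz hre h0
  have hz1 : 2 * ‖p‖ ≤ ‖z‖ := (le_max_left _ _).trans hz
  have hz2 : 10 ≤ ‖z‖ := (le_max_left _ _).trans ((le_max_right _ _).trans hz)
  have hz3 : 2 * Real.pi * K ≤ ‖z‖ := (le_max_right _ _).trans ((le_max_right _ _).trans hz)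
  have hzp : 0 < ‖z‖ := by linarith
  have hδ : K / ‖z‖ ≤ 1 / 4 := by
    rw [div_le_div_iff₀ hzp (by norm_num)]
    nlinarith
  have hsn : ‖Complex.sin (z / 2)‖ ≤ 2 * (K / ‖z‖) :=
    norm_sin_le_of_le_exp hδ (hK z hz1 (by linarith) h0)
  obtain ⟨k, hk⟩ := exists_norm_sub_le_norm_sin (z / 2)
  have hk2 : ‖z - 2 * Real.pi * k‖ ≤ 2 * Real.pi * K / ‖z‖ := by
    have e : z - 2 * Real.pi * k = 2 * (z / 2 - k * Real.pi) := by ring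
    rw [e, norm_mul, Complex.norm_ofNat]
    calc 2 * ‖z / 2 - k * Real.pi‖ ≤ 2 * (Real.pi / 2 * (2 * (K / ‖z‖))) := by
          gcongr
          exact hk.trans (by gcongr)
      _ = _ := by ring
  have hk3 : ‖z - 2 * Real.pi * k‖ ≤ 1 := hk2.trans ((div_le_one hzp).2 hz3)
  have hk4 : -1 ≤ 2 * Real.pi * k := by
    have := (Complex.abs_re_le_norm (z - 2 * Real.pi * k)).trans hk3
    rw [show (z - 2 * Real.pi * k).re = z.re - 2 * Real.pi * k by simp] at this
    linarith [(abs_le.1 this).2]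
  have hk5 : 0 ≤ k := by
    by_contra hneg
    have : (k : ℝ) ≤ -1 := by exact_mod_cast (by omega : k ≤ -1)
    nlinarith
  obtain ⟨n, rfl⟩ := Int.eq_ofNat_of_zero_le hk5
  simp only [Int.cast_natCast] at hk2 hk3
  have hn : ‖(2 * Real.pi * n : ℂ)‖ = 2 * Real.pi * n := by
    rw [norm_mul, norm_mul, Complex.norm_ofNat, Complex.norm_natCast, Complex.norm_real,
      Real.norm_of_nonneg Real.pi_pos.le]
  have h6 : ‖z‖ ≤ 2 * Real.pi * n + 1 := by
    have := norm_sub_norm_le z (2 * Real.pi * n)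
    rw [hn] at this; linarith
  have h7 : 2 * Real.pi * n ≤ ‖z‖ + 1 := by
    have := norm_sub_norm_le (2 * Real.pi * n : ℂ) z
    rw [hn, norm_sub_rev] at this; linarith
  have hn1 : 1 ≤ n := by
    by_contra hlt
    have : n = 0 := by omega
    rw [this] at h6
    norm_num at h6
    linarith
  have hn1' : (1 : ℝ) ≤ n := by exact_mod_cast hn1
  refine ⟨n, hn1, hk2.trans ?_⟩
  gcongr
  nlinarith

/-! ### Zeros of perturbed quadratic polynomials -/

section Roots

open Metric

variable {g : ℂ → ℂ} {a r r' : ℂ} {δ η : ℝ}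

/-- By Cauchy's estimate, a holomorphic function uniformly close to a quadratic polynomial has a
derivative close to that of the polynomial near a simple root. -/
theorem norm_deriv_sub_le (hg : Differentiable ℂ g) (hδ : 0 < δ) (hδr : 4 * δ ≤ ‖r - r'‖)
    (hη : ∀ ζ ∈ closedBall r (2 * δ), ‖g ζ - a * ((ζ - r) * (ζ - r'))‖ ≤ η)
    (hηδ : η ≤ ‖a‖ * ‖r - r'‖ / 4 * δ) {ζ : ℂ} (hζ : ζ ∈ closedBall r δ) :
    ‖deriv g ζ - a * (r - r')‖ ≤ 3 / 4 * ‖a * (r - r')‖ := by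
  have hP : ∀ ζ : ℂ, HasDerivAt (fun ζ => a * ((ζ - r) * (ζ - r'))) (a * (2 * ζ - r - r')) ζ :=
    fun ζ => by
      refine ((((hasDerivAt_id ζ).sub_const r).mul
        ((hasDerivAt_id ζ).sub_const r')).const_mul a).congr_deriv ?_
      simp only [id]
      ring
  have hd : Differentiable ℂ (fun ζ => g ζ - a * ((ζ - r) * (ζ - r'))) :=
    hg.sub fun ζ => (hP ζ).differentiableAt
  have h1 := Complex.norm_deriv_le_of_forall_mem_sphere_norm_le hδ (hd.diffContOnCl (s := ball ζ δ))
    (C := η) fun w hw => hη w (by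
      rw [mem_closedBall] at hζ ⊢
      rw [mem_sphere] at hw
      linarith [dist_triangle w ζ r])
  have hd' : deriv (fun ζ => g ζ - a * ((ζ - r) * (ζ - r'))) ζ =
      deriv g ζ - a * (2 * ζ - r - r') := ((hg ζ).hasDerivAt.sub (hP ζ)).deriv
  rw [hd'] at h1
  have h2 : η / δ ≤ ‖a‖ * ‖r - r'‖ / 4 := by rwa [div_le_iff₀ hδ]
  have h3 : ‖a * (2 * (ζ - r))‖ ≤ ‖a‖ * ‖r - r'‖ / 2 := by
    rw [norm_mul, norm_mul, Complex.norm_ofNat, mul_div_assoc]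
    rw [mem_closedBall, dist_eq_norm] at hζ
    gcongr
    linarith
  have e : deriv g ζ - a * (r - r') =
      (deriv g ζ - a * (2 * ζ - r - r')) + a * (2 * (ζ - r)) := by ring
  rw [e, norm_mul a (r - r')]
  linarith [norm_add_le (deriv g ζ - a * (2 * ζ - r - r')) (a * (2 * (ζ - r)))]

theorem deriv_ne_zero_of_close (hg : Differentiable ℂ g) (ha : a ≠ 0) (hδ : 0 < δ)
    (hδr : 4 * δ ≤ ‖r - r'‖)
    (hη : ∀ ζ ∈ closedBall r (2 * δ), ‖g ζ - a * ((ζ - r) * (ζ - r'))‖ ≤ η)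
    (hηδ : η ≤ ‖a‖ * ‖r - r'‖ / 4 * δ) {ζ : ℂ} (hζ : ζ ∈ closedBall r δ) : deriv g ζ ≠ 0 := by
  intro h
  have h1 := norm_deriv_sub_le hg hδ hδr hη hηδ hζ
  rw [h, zero_sub, norm_neg, norm_mul] at h1
  have h2 : 0 < ‖a‖ * ‖r - r'‖ := mul_pos (norm_pos_iff.2 ha) (by linarith)
  linarith

theorem eq_of_close_of_eq_zero (hg : Differentiable ℂ g) (ha : a ≠ 0) (hδ : 0 < δ)
    (hδr : 4 * δ ≤ ‖r - r'‖)
    (hη : ∀ ζ ∈ closedBall r (2 * δ), ‖g ζ - a * ((ζ - r) * (ζ - r'))‖ ≤ η)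
    (hηδ : η ≤ ‖a‖ * ‖r - r'‖ / 4 * δ) {ζ ζ' : ℂ} (hζ : ζ ∈ closedBall r δ)
    (hζ' : ζ' ∈ closedBall r δ) (h : g ζ = 0) (h' : g ζ' = 0) : ζ = ζ' := by
  have h1 := (convex_closedBall r δ).norm_image_sub_le_of_norm_hasDerivWithin_le
    (f := fun ζ => g ζ - a * (r - r') * ζ) (f' := fun ζ => deriv g ζ - a * (r - r'))
    (C := 3 / 4 * ‖a * (r - r')‖) (fun w _ => by
      refine ((hg w).hasDerivAt.sub ((hasDerivAt_id w).const_mul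
        (a * (r - r')))).hasDerivWithinAt.congr_deriv ?_
      rw [mul_one])
    (fun w hw => norm_deriv_sub_le hg hδ hδr hη hηδ hw) hζ hζ'
  have e : g ζ' - a * (r - r') * ζ' - (g ζ - a * (r - r') * ζ) = -(a * (r - r') * (ζ' - ζ)) := by
    rw [h, h']; ring
  simp only [e] at h1
  rw [norm_neg, norm_mul, norm_mul] at h1
  have h2 : 0 < ‖a‖ * ‖r - r'‖ := mul_pos (norm_pos_iff.2 ha) (by linarith)
  have h3 : ‖ζ' - ζ‖ ≤ 0 := by
    by_contra! hc
    nlinarith [mul_pos h2 hc]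
  exact (sub_eq_zero.1 (norm_le_zero_iff.1 h3)).symm

theorem exists_zero_of_close (hg : Differentiable ℂ g) (ha : a ≠ 0) (hδ : 0 < δ)
    (hδr : 4 * δ ≤ ‖r - r'‖)
    (hη : ∀ ζ ∈ closedBall r (2 * δ), ‖g ζ - a * ((ζ - r) * (ζ - r'))‖ ≤ η)
    (hηδ : η ≤ ‖a‖ * ‖r - r'‖ / 8 * δ) : ∃ ζ ∈ closedBall r δ, g ζ = 0 := by
  have h2 : 0 < ‖a‖ * ‖r - r'‖ := mul_pos (norm_pos_iff.2 ha) (by linarith)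
  have hr : ‖g r‖ ≤ η := by
    have := hη r (mem_closedBall_self (by positivity))
    simpa using this
  have hs : ∀ z ∈ sphere r δ, 3 / 4 * (‖a‖ * ‖r - r'‖ * δ) - 2 * η ≤ ‖g z - g r‖ := fun z hz => by
    rw [mem_sphere, dist_eq_norm] at hz
    have h3 := hη z (by rw [mem_closedBall, dist_eq_norm]; linarith)
    have h4 : 3 / 4 * ‖r - r'‖ ≤ ‖z - r'‖ := by
      have := norm_sub_norm_le (r - r') (r - z)
      rw [norm_sub_rev r z, hz, show r - r' - (r - z) = z - r' by ring] at this
      linarith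
    have h5 : 3 / 4 * (‖a‖ * ‖r - r'‖ * δ) ≤ ‖a * ((z - r) * (z - r'))‖ := by
      rw [norm_mul, norm_mul, hz]
      calc 3 / 4 * (‖a‖ * ‖r - r'‖ * δ) = ‖a‖ * (δ * (3 / 4 * ‖r - r'‖)) := by ring
        _ ≤ _ := by gcongr
    have h6 := norm_sub_norm_le (a * ((z - r) * (z - r'))) (a * ((z - r) * (z - r')) - g z)
    rw [norm_sub_rev _ (g z), sub_sub_cancel] at h6
    linarith [norm_sub_norm_le (g z) (g r)]
  have hd := deriv_ne_zero_of_close hg ha hδ hδr hη (hηδ.trans (by nlinarith))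
    (mem_closedBall_self hδ.le)
  have hfr : ∃ᶠ z in nhds r, g z ≠ g r :=
    (((hg r).hasDerivAt.eventually_ne hd).frequently).filter_mono nhdsWithin_le_nhds
  have h7 := (hg.diffContOnCl (s := ball r δ)).ball_subset_image_closedBall hδ hs hfr
  obtain ⟨ζ, hζ, h0⟩ := h7 (show (0 : ℂ) ∈ ball (g r) _ by
    rw [mem_ball, dist_eq_norm, zero_sub, norm_neg]
    nlinarith)
  exact ⟨ζ, hζ, h0⟩

/-- Entire functions converging locally uniformly to a quadratic polynomial with two different roots
have, on every fixed large disc, eventually exactly two zeros; these are simple and converge to the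
roots of the polynomial. -/
theorem exists_zeros {g : ℕ → ℂ → ℂ} {a : ℂ} {r : Fin 2 → ℂ} (hg : ∀ n, Differentiable ℂ (g n))
    (ha : a ≠ 0) (hr : r 0 ≠ r 1)
    (hlim : ∀ ρ : ℝ, TendstoUniformlyOn g (fun ζ => a * ((ζ - r 0) * (ζ - r 1))) atTop
      (closedBall 0 ρ)) :
    ∃ z : Fin 2 → ℕ → ℂ, (∀ i, Tendsto (z i) atTop (nhds (r i))) ∧
      ∀ ρ : ℝ, ∀ᶠ n in atTop, (∀ i, g n (z i n) = 0 ∧ deriv (g n) (z i n) ≠ 0) ∧ z 0 n ≠ z 1 n ∧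
        ∀ ζ ∈ closedBall (0 : ℂ) ρ, g n ζ = 0 → ∃ i, ζ = z i n := by
  have hP : ∀ i ζ, a * ((ζ - r 0) * (ζ - r 1)) = a * ((ζ - r i) * (ζ - r (1 - i))) := by
    intro i ζ
    fin_cases i
    · rfl
    · change a * ((ζ - r 0) * (ζ - r 1)) = a * ((ζ - r 1) * (ζ - r 0))
      ring
  have hri : ∀ i, ‖r i - r (1 - i)‖ = ‖r 0 - r 1‖ := by
    intro i
    fin_cases i
    · rfl
    · exact norm_sub_rev _ _
  have hr0 : 0 < ‖r 0 - r 1‖ := norm_pos_iff.2 (sub_ne_zero.2 hr)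
  have ha0 : 0 < ‖a‖ := norm_pos_iff.2 ha
  have hclose : ∀ ρ η : ℝ, 0 < η → ∀ᶠ n in atTop, ∀ ζ ∈ closedBall (0 : ℂ) ρ,
      ‖g n ζ - a * ((ζ - r 0) * (ζ - r 1))‖ ≤ η := fun ρ η hη => by
    filter_upwards [Metric.tendstoUniformlyOn_iff.1 (hlim ρ) η hη] with n hn ζ hζ
    rw [← dist_eq_norm, dist_comm]
    exact (hn ζ hζ).le
  have hball : ∀ (i : Fin 2) (δ : ℝ), closedBall (r i) (2 * δ) ⊆
      closedBall 0 (‖r 0‖ + ‖r 1‖ + 2 * δ) := fun i δ => by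
    refine closedBall_subset_closedBall' ?_
    rw [dist_zero_right]
    have : ‖r i‖ ≤ ‖r 0‖ + ‖r 1‖ := by
      fin_cases i
      · exact le_add_of_nonneg_right (norm_nonneg _)
      · exact le_add_of_nonneg_left (norm_nonneg _)
    linarith
  have hloc : ∀ δ : ℝ, 0 < δ → 4 * δ ≤ ‖r 0 - r 1‖ → ∀ᶠ n in atTop, ∀ i,
      ∀ ζ ∈ closedBall (r i) (2 * δ),
        ‖g n ζ - a * ((ζ - r i) * (ζ - r (1 - i)))‖ ≤ ‖a‖ * ‖r i - r (1 - i)‖ / 8 * δ :=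
    fun δ hδ hδr => by
      filter_upwards [hclose (‖r 0‖ + ‖r 1‖ + 2 * δ) (‖a‖ * ‖r 0 - r 1‖ / 8 * δ)
        (by positivity)] with n hn i ζ hζ
      rw [← hP, hri]
      exact hn ζ (hball i δ hζ)
  set δ₀ := ‖r 0 - r 1‖ / 4 with hδ₀
  have hδ₀0 : 0 < δ₀ := by positivity
  have hδ₀r : 4 * δ₀ ≤ ‖r 0 - r 1‖ := by rw [hδ₀]; linarith
  have h84 : ∀ i (δ : ℝ), 0 < δ →
      ‖a‖ * ‖r i - r (1 - i)‖ / 8 * δ ≤ ‖a‖ * ‖r i - r (1 - i)‖ / 4 * δ := fun i δ hδ => by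
    gcongr; norm_num
  classical
  let z : Fin 2 → ℕ → ℂ := fun i n =>
    if h : ∃ ζ ∈ closedBall (r i) δ₀, g n ζ = 0 then h.choose else 0
  have hz : ∀ᶠ n in atTop, ∀ i, z i n ∈ closedBall (r i) δ₀ ∧ g n (z i n) = 0 := by
    filter_upwards [hloc δ₀ hδ₀0 hδ₀r] with n hn i
    have h := exists_zero_of_close (hg n) ha hδ₀0 (by rwa [hri]) (hn i) le_rfl
    have e : z i n = h.choose := dif_pos h
    rw [e]
    exact h.choose_spec
  refine ⟨z, fun i => ?_, fun ρ => ?_⟩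
  · rw [Metric.tendsto_nhds]
    intro ε hε
    set δ := min (ε / 2) δ₀ with hδ
    have hδ0 : 0 < δ := lt_min (by positivity) hδ₀0
    have hδle : δ ≤ δ₀ := min_le_right _ _
    filter_upwards [hloc δ₀ hδ₀0 hδ₀r, hloc δ hδ0 (by linarith), hz] with n h1 h2 h3
    obtain ⟨ζ, hζ, h0⟩ := exists_zero_of_close (hg n) ha hδ0 (by rw [hri]; linarith) (h2 i) le_rfl
    have e := eq_of_close_of_eq_zero (hg n) ha hδ₀0 (by rwa [hri]) (h1 i) (h84 i _ hδ₀0)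
      (closedBall_subset_closedBall hδle hζ) (h3 i).1 h0 (h3 i).2
    rw [← e]
    rw [mem_closedBall] at hζ
    exact (hζ.trans (min_le_left _ _)).trans_lt (by linarith)
  · filter_upwards [hloc δ₀ hδ₀0 hδ₀r, hz, hclose ρ (‖a‖ * (δ₀ * δ₀) / 2) (by positivity)]
      with n h1 h2 h3
    refine ⟨fun i => ⟨(h2 i).2, deriv_ne_zero_of_close (hg n) ha hδ₀0 (by rwa [hri]) (h1 i)
      (h84 i _ hδ₀0) (h2 i).1⟩, fun he => ?_, fun ζ hζ h0 => ?_⟩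
    · have d0 := (h2 0).1
      have d1 := (h2 1).1
      rw [he] at d0
      rw [mem_closedBall] at d0 d1
      have := dist_triangle_left (r 0) (r 1) (z 1 n)
      rw [dist_eq_norm (r 0)] at this
      linarith
    · by_contra! hne
      have hout : ∀ i, δ₀ < ‖ζ - r i‖ := fun i => by
        by_contra! hc
        refine hne i (eq_of_close_of_eq_zero (hg n) ha hδ₀0 (by rwa [hri]) (h1 i) (h84 i _ hδ₀0)
          ?_ (h2 i).1 h0 (h2 i).2)
        rwa [mem_closedBall, dist_eq_norm]
      have h4 := h3 ζ hζ
      rw [h0, zero_sub, norm_neg, norm_mul, norm_mul] at h4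
      have h5 : ‖a‖ * (δ₀ * δ₀) ≤ ‖a‖ * (‖ζ - r 0‖ * ‖ζ - r 1‖) := by
        gcongr
        · exact (hout 0).le
        · exact (hout 1).le
      have h6 : 0 < ‖a‖ * (δ₀ * δ₀) := by positivity
      linarith

end Roots

/-! ### The characteristic function near the points `2πn` -/

/-- A form of the Riemann–Lebesgue lemma. -/
theorem tendsto_integral_mul_cos {f : ℝ → ℂ} (hf : IntervalIntegrable f volume 0 1) :
    Tendsto (fun n : ℕ => ∫ t in (0 : ℝ)..1,
      f t * Complex.cos (2 * Real.pi * n * ((1 - 2 * t : ℝ) : ℂ))) atTop (nhds 0) := by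
  have hI : IntegrableOn f (Ioc 0 1) :=
    (intervalIntegrable_iff_integrableOn_Ioc_of_le zero_le_one).1 hf
  set F : ℝ → ℂ := (Ioc (0 : ℝ) 1).indicator f with hF
  have hFi : Integrable F := (integrable_indicator_iff measurableSet_Ioc).2 hI
  have hRL := Real.tendsto_integral_exp_smul_cocompact F
  have hn : Tendsto (fun n : ℕ => 2 * (n : ℝ)) atTop atTop :=
    tendsto_natCast_atTop_atTop.const_mul_atTop two_pos
  have h1 := hRL.comp (hn.mono_right atTop_le_cocompact)
  have h2 := hRL.comp ((tendsto_neg_atTop_atBot.comp hn).mono_right atBot_le_cocompact)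
  have h3 := (h1.add h2).const_mul (1 / 2 : ℂ)
  rw [add_zero, mul_zero] at h3
  refine h3.congr fun n => ?_
  have hint : ∀ w : ℝ, Integrable fun v : ℝ => Real.fourierChar (-(v * w)) • F v := fun w => by
    have := (Real.fourierIntegral_convergent_iff (μ := volume) (f := F) w).2 hFi
    simpa [mul_comm] using this
  simp only [Function.comp_apply]
  rw [← integral_add (hint _) (hint _), ← integral_const_mul,
    intervalIntegral.integral_of_le zero_le_one, ← integral_indicator measurableSet_Ioc]
  congr 1
  funext t
  by_cases ht : t ∈ Ioc (0 : ℝ) 1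
  · rw [indicator_of_mem ht, hF, indicator_of_mem ht, Circle.smul_def, Circle.smul_def,
      Real.fourierChar_apply, Real.fourierChar_apply, smul_eq_mul, smul_eq_mul]
    have e1 : (2 * Real.pi * n * ((1 - 2 * t : ℝ) : ℂ)) =
        -(4 * Real.pi * n * t) + n * (2 * Real.pi) := by push_cast; ring
    rw [e1, Complex.cos_add_nat_mul_two_pi, Complex.cos_neg, Complex.cos]
    have e2 : (((2 * Real.pi * -(t * (2 * n)) : ℝ) : ℂ) * Complex.I) =
        -(4 * Real.pi * n * t) * Complex.I := by push_cast; ring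
    have e3 : (((2 * Real.pi * -(t * -(2 * n)) : ℝ) : ℂ) * Complex.I) =
        (4 * Real.pi * n * t) * Complex.I := by push_cast; ring
    rw [e2, e3]
    ring
  · rw [indicator_of_notMem ht, hF, indicator_of_notMem ht]
    simp

theorem norm_cos_sub_cos_le {A h : ℂ} (hA : A.im = 0) (hh : ‖h‖ ≤ 1) :
    ‖Complex.cos (A + h) - Complex.cos A‖ ≤ 3 * ‖h‖ := by
  have := (convex_closedBall A 1).norm_image_sub_le_of_norm_hasDerivWithin_le
    (f := Complex.cos) (f' := fun z => -Complex.sin z) (C := 3)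
    (fun w _ => (Complex.hasDerivAt_cos w).hasDerivWithinAt) (fun w hw => by
      rw [norm_neg]
      refine (norm_sin_le_exp w).trans ?_
      rw [mem_closedBall_iff_norm] at hw
      have h1 : |w.im| ≤ 1 := by
        have := (Complex.abs_im_le_norm (w - A)).trans hw
        rwa [Complex.sub_im, hA, sub_zero] at this
      have := Real.exp_one_lt_d9
      linarith [Real.exp_le_exp.2 h1])
    (Metric.mem_closedBall_self zero_le_one)
    (show A + h ∈ Metric.closedBall A 1 by simpa using hh)
  simpa using this

/-- The Riemann–Lebesgue lemma for complex frequencies approaching the real ones `2πn`. -/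
theorem tendsto_integral_mul_cos_of_close {f : ℝ → ℂ} (hf : IntervalIntegrable f volume 0 1)
    {α : Type*} {l : Filter α} {n : α → ℕ} {h : α → ℂ} (hn : Tendsto n l atTop)
    (hh : Tendsto h l (nhds 0)) :
    Tendsto (fun x => ∫ t in (0 : ℝ)..1,
      f t * Complex.cos ((2 * Real.pi * n x + h x) * ((1 - 2 * t : ℝ) : ℂ))) l (nhds 0) := by
  have h0 := (tendsto_integral_mul_cos hf).comp hn
  have h1 : Tendsto (fun x => (∫ t in (0 : ℝ)..1, ‖f t‖) * (3 * ‖h x‖)) l (nhds 0) := by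
    have := (hh.norm.const_mul 3).const_mul (∫ t in (0 : ℝ)..1, ‖f t‖)
    simpa using this
  have h2 : Tendsto (fun x => (∫ t in (0 : ℝ)..1,
      f t * Complex.cos ((2 * Real.pi * n x + h x) * ((1 - 2 * t : ℝ) : ℂ))) -
      ∫ t in (0 : ℝ)..1, f t * Complex.cos (2 * Real.pi * n x * ((1 - 2 * t : ℝ) : ℂ)))
      l (nhds 0) := by
    refine squeeze_zero_norm' ?_ h1
    have hsmall : ∀ᶠ x in l, ‖h x‖ ≤ 1 := by
      have := hh.norm.eventually (ge_mem_nhds (show ‖(0 : ℂ)‖ < 1 by simp))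
      exact this
    filter_upwards [hsmall] with x hx
    have hc : ∀ c : ℂ, IntervalIntegrable
        (fun t : ℝ => f t * Complex.cos (c * ((1 - 2 * t : ℝ) : ℂ))) volume 0 1 := fun c =>
      hf.mul_continuousOn (by fun_prop)
    rw [← intervalIntegral.integral_sub (hc _) (hc _)]
    simp_rw [← mul_sub]
    refine norm_integral_mul_trig_le hf (right_mem_Icc.2 zero_le_one) (fun t ht => ?_)
      (by positivity)
    have ht' : ‖((1 - 2 * t : ℝ) : ℂ)‖ ≤ 1 := by
      rw [Complex.norm_real, Real.norm_eq_abs, abs_le]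
      constructor <;> linarith [ht.1, ht.2]
    have hle : ‖h x * ((1 - 2 * t : ℝ) : ℂ)‖ ≤ ‖h x‖ := by
      rw [norm_mul]; exact mul_le_of_le_one_right (norm_nonneg _) ht'
    rw [add_mul]
    refine (norm_cos_sub_cos_le ?_ (hle.trans hx)).trans (by gcongr)
    have : (2 * Real.pi * n x * ((1 - 2 * t : ℝ) : ℂ)) =
      ((2 * Real.pi * n x * (1 - 2 * t) : ℝ) : ℂ) := by push_cast; ring
    rw [this, Complex.ofReal_im]
  have := h2.add h0
  simpa using this

theorem tendsto_sin_div : Tendsto (dslope Complex.sin 0) (nhds 0) (nhds 1) := by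
  have h : ContinuousAt (dslope Complex.sin 0) 0 :=
    continuousAt_dslope_same.2 Complex.differentiable_sin.differentiableAt
  have e : dslope Complex.sin 0 0 = 1 := by simp [dslope_same]
  rw [← e]
  exact h

theorem sin_eq_mul_dslope (w : ℂ) : Complex.sin w = w * dslope Complex.sin 0 w := by
  have := sub_smul_dslope Complex.sin 0 w
  simpa using this.symm

theorem norm_two_pi_mul (n : ℕ) : ‖(2 * Real.pi * n : ℂ)‖ = 2 * Real.pi * n := by
  simp only [norm_mul, Complex.norm_ofNat, Complex.norm_real, Complex.norm_natCast,
    Real.norm_eq_abs, abs_of_pos Real.pi_pos]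

theorem abs_im_two_pi_mul_add_le (n : ℕ) (h : ℂ) : |(2 * Real.pi * n + h : ℂ).im| ≤ ‖h‖ := by
  have e : (2 * Real.pi * n : ℂ) = ((2 * Real.pi * n : ℝ) : ℂ) := by push_cast; ring
  rw [e, Complex.add_im, Complex.ofReal_im, zero_add]
  exact Complex.abs_im_le_norm _

section LocalPoints

variable {α : Type*} {l : Filter α} {n : α → ℕ} {ζ : α → ℂ} {ρ : ℝ}

theorem tendsto_norm_two_pi_mul (hn : Tendsto n l atTop) :
    Tendsto (fun x => ‖(2 * Real.pi * n x : ℂ)‖) l atTop := by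
  simp_rw [norm_two_pi_mul]
  exact (tendsto_natCast_atTop_atTop.comp hn).const_mul_atTop (by positivity)

theorem tendsto_div_two_pi_mul (hn : Tendsto n l atTop) (hζ : ∀ᶠ x in l, ‖ζ x‖ ≤ ρ) :
    Tendsto (fun x => ζ x / (2 * Real.pi * n x)) l (nhds 0) := by
  simp_rw [div_eq_mul_inv]
  refine isBoundedUnder_le_mul_tendsto_zero (isBoundedUnder_of_eventually_le hζ) ?_
  rw [tendsto_zero_iff_norm_tendsto_zero]
  simp_rw [norm_inv]
  exact (tendsto_norm_two_pi_mul hn).inv_tendsto_atTop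

theorem tendsto_norm_two_pi_mul_add (hn : Tendsto n l atTop) (hζ : ∀ᶠ x in l, ‖ζ x‖ ≤ ρ) :
    Tendsto (fun x => ‖2 * Real.pi * n x + ζ x / (2 * Real.pi * n x)‖) l atTop := by
  have h1 : ∀ᶠ x in l, ‖ζ x / (2 * Real.pi * n x)‖ ≤ 1 :=
    (tendsto_div_two_pi_mul hn hζ).norm.eventually (ge_mem_nhds (show ‖(0 : ℂ)‖ < 1 by simp))
  refine tendsto_atTop_mono' l ?_
    (tendsto_atTop_add_const_right l (-1) (tendsto_norm_two_pi_mul hn))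
  filter_upwards [h1] with x hx
  have := norm_sub_le_norm_add (2 * Real.pi * n x : ℂ) (ζ x / (2 * Real.pi * n x))
  linarith

end LocalPoints

/-- The quadratic polynomial to which the rescaled characteristic function converges. -/
def localPoly (β₁ β₂ d : ℂ) (ζ : ℂ) : ℂ :=
  (1 - β₁) / 2 * ζ ^ 2 + β₂ * ζ + (1 + β₁) * d / 4

/-- The characteristic function in the local variable `ζ`, where `lam = (2πn + ζ / (2πn)) ^ 2`. -/
def localCharFun (β₁ β₂ : ℂ) (p : CI) (n : ℕ) (ζ : ℂ) : ℂ :=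
  (2 * Real.pi * n) ^ 2 * charFun β₁ β₂ p ((2 * Real.pi * n + ζ / (2 * Real.pi * n)) ^ 2)

/-- The limit is stated along an arbitrary filter so that it yields uniform convergence on discs. -/
theorem tendsto_localCharFun (β₁ β₂ : ℂ) {p : CI}
    (hac : AbsolutelyContinuousOnInterval (extend p) 0 1)
    (hmean : ∫ t in (0 : ℝ)..1, extend p t = 0)
    {α : Type*} {l : Filter α} {n : α → ℕ} {ζ : α → ℂ} {ρ : ℝ} (hn : Tendsto n l atTop)
    (hζ : ∀ᶠ x in l, ‖ζ x‖ ≤ ρ) :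
    Tendsto (fun x => localCharFun β₁ β₂ p (n x) (ζ x) -
      localPoly β₁ β₂ (extend p 0 - extend p 1) (ζ x)) l (nhds 0) := by
  obtain ⟨C, hC, hasym⟩ := exists_charFun_asymptotics β₁ β₂ hac hmean
  set d := extend p 0 - extend p 1 with hd
  set L : α → ℂ := fun x => 2 * Real.pi * n x with hL
  have hLtop : Tendsto (fun x => ‖L x‖) l atTop := tendsto_norm_two_pi_mul hn
  have hL0 : ∀ᶠ x in l, L x ≠ 0 := by
    filter_upwards [hLtop.eventually_gt_atTop 0] with x hx
    exact norm_pos_iff.1 hx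
  have hLinv : Tendsto (fun x => (L x)⁻¹) l (nhds 0) := by
    rw [tendsto_zero_iff_norm_tendsto_zero]
    simp_rw [norm_inv]
    exact hLtop.inv_tendsto_atTop
  have hbdd : ∀ {f : α → ℂ}, Tendsto f l (nhds 0) → Tendsto (fun x => ζ x * f x) l (nhds 0) :=
    fun hf => isBoundedUnder_le_mul_tendsto_zero (isBoundedUnder_of_eventually_le hζ) hf
  set h : α → ℂ := fun x => ζ x / L x with hh
  have hh0 : Tendsto h l (nhds 0) := tendsto_div_two_pi_mul hn hζ
  set κ : α → ℂ := fun x => L x / (L x + h x) with hκ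
  have hκ1 : Tendsto κ l (nhds 1) := by
    have h1 : Tendsto (fun x => (1 + h x * (L x)⁻¹)⁻¹) l (nhds (1 + 0 * 0)⁻¹) :=
      ((hh0.mul hLinv).const_add 1).inv₀ (by simp)
    rw [mul_zero, add_zero, inv_one] at h1
    refine h1.congr' ?_
    filter_upwards [hL0] with x hx
    rw [hκ]
    have : L x + h x = L x * (1 + h x * (L x)⁻¹) := by field_simp
    simp only [this]
    rw [div_mul_eq_div_div, div_self hx, one_div]
  have hμtop : Tendsto (fun x => ‖L x + h x‖) l atTop := tendsto_norm_two_pi_mul_add hn hζ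
  set Φ : α → ℂ := fun x => ∫ t in (0 : ℝ)..1,
    deriv (extend p) t * Complex.cos ((L x + h x) * ((1 - 2 * t : ℝ) : ℂ)) with hΦ
  have hΦ0 : Tendsto Φ l (nhds 0) :=
    tendsto_integral_mul_cos_of_close hac.intervalIntegrable_deriv_complex hn hh0
  have hcos : Tendsto (fun x => Complex.cos (h x)) l (nhds 1) := by
    have := (Complex.continuous_cos.tendsto 0).comp hh0
    rwa [Complex.cos_zero] at this
  have hS1 : Tendsto (fun x => dslope Complex.sin 0 (h x)) l (nhds 1) := tendsto_sin_div.comp hh0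
  have hS2 : Tendsto (fun x => dslope Complex.sin 0 (h x / 2)) l (nhds 1) := by
    refine tendsto_sin_div.comp ?_
    simpa using hh0.div_const 2
  -- the remainder of the asymptotic formula stays small after multiplication by `L ^ 2`
  have hrem : Tendsto (fun x => L x ^ 2 * (charFun β₁ β₂ p ((L x + h x) ^ 2) -
      ((1 - β₁) * (1 - Complex.cos (L x + h x)) + β₂ * Complex.sin (L x + h x) / (L x + h x)
        - (1 + β₁) * sinIntegral (extend p) (L x + h x) / (2 * (L x + h x))))) l (nhds 0) := by
    have hE : Tendsto (fun x => C * Real.exp ‖h x‖ * ‖κ x‖ ^ 2 * ‖L x + h x‖⁻¹) l (nhds 0) := by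
      have h1 := (((Real.continuous_exp.tendsto _).comp hh0.norm).const_mul C).mul (hκ1.norm.pow 2)
      have h2 := h1.mul hμtop.inv_tendsto_atTop
      rw [mul_zero] at h2
      exact h2
    refine squeeze_zero_norm' ?_ hE
    filter_upwards [hμtop.eventually_ge_atTop (2 * ‖p‖), hμtop.eventually_gt_atTop 0] with x h1 h2
    rw [norm_mul]
    refine (mul_le_mul_of_nonneg_left (hasym _ (norm_pos_iff.1 h2) h1) (norm_nonneg _)).trans ?_
    have him : |(L x + h x).im| ≤ ‖h x‖ := abs_im_two_pi_mul_add_le _ _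
    have e : ‖L x ^ 2‖ * (C * errScale (L x + h x) 3 1) =
        C * Real.exp |(L x + h x).im| * ‖κ x‖ ^ 2 * ‖L x + h x‖⁻¹ := by
      rw [errScale, hκ, norm_pow, norm_div, mul_one]
      field_simp
    rw [e]
    gcongr
  -- by periodicity the main part depends on `h`, which is factored as `L * h = ζ`
  have hmain : ∀ᶠ x in l, L x ^ 2 *
      ((1 - β₁) * (1 - Complex.cos (L x + h x)) + β₂ * Complex.sin (L x + h x) / (L x + h x)
        - (1 + β₁) * sinIntegral (extend p) (L x + h x) / (2 * (L x + h x))) -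
      localPoly β₁ β₂ d (ζ x) =
      ζ x * (ζ x * ((1 - β₁) / 2 * (dslope Complex.sin 0 (h x / 2) ^ 2 - 1))) +
      ζ x * (β₂ * (dslope Complex.sin 0 (h x) * κ x - 1)) +
      (1 + β₁) / 4 * (κ x ^ 2 * (d * Complex.cos (h x) + Φ x) - d) := by
    filter_upwards [hL0, hμtop.eventually_gt_atTop 0] with x h1 h2
    have h2' := norm_pos_iff.1 h2
    have hper : L x + h x = h x + n x * (2 * Real.pi) := by rw [hL]; ring
    have c1 : Complex.cos (L x + h x) = Complex.cos (h x) := by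
      rw [hper, Complex.cos_add_nat_mul_two_pi]
    have c2 : Complex.sin (L x + h x) = Complex.sin (h x) := by
      rw [hper, Complex.sin_add_nat_mul_two_pi]
    have c3 : sinIntegral (extend p) (L x + h x) =
        (-d * Complex.cos (h x) - Φ x) / (2 * (L x + h x)) := by
      rw [sinIntegral, integral_mul_sin_eq hac h2' (right_mem_Icc.2 zero_le_one)]
      rw [Complex.ofReal_one, mul_one, c1, hd]
      congr 1
      ring
    have c4 : 1 - Complex.cos (h x) = 2 * (h x / 2 * dslope Complex.sin 0 (h x / 2)) ^ 2 := by
      rw [← sin_eq_mul_dslope]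
      nth_rewrite 1 [show h x = 2 * (h x / 2) by ring]
      rw [Complex.cos_two_mul, Complex.cos_sq']; ring
    have c5 : ζ x = L x * h x := by simp only [hh]; field_simp
    have c6 : κ x * (L x + h x) = L x := by simp only [hκ]; field_simp
    have c7 : (L x + h x)⁻¹ = κ x * (L x)⁻¹ := by simp only [hκ]; field_simp
    rw [c1, c2, c3, c4, sin_eq_mul_dslope (h x), localPoly, c5]
    simp only [div_eq_mul_inv, mul_inv, c7]
    field_simp
    ring
  have hlim : Tendsto (fun x =>
      ζ x * (ζ x * ((1 - β₁) / 2 * (dslope Complex.sin 0 (h x / 2) ^ 2 - 1))) +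
      ζ x * (β₂ * (dslope Complex.sin 0 (h x) * κ x - 1)) +
      (1 + β₁) / 4 * (κ x ^ 2 * (d * Complex.cos (h x) + Φ x) - d)) l (nhds 0) := by
    have t1 : Tendsto (fun x => (1 - β₁) / 2 * (dslope Complex.sin 0 (h x / 2) ^ 2 - 1)) l
        (nhds 0) := by
      simpa using ((hS2.pow 2).sub_const 1).const_mul ((1 - β₁) / 2)
    have t2 : Tendsto (fun x => β₂ * (dslope Complex.sin 0 (h x) * κ x - 1)) l (nhds 0) := by
      simpa using ((hS1.mul hκ1).sub_const 1).const_mul β₂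
    have t3 : Tendsto (fun x => (1 + β₁) / 4 * (κ x ^ 2 * (d * Complex.cos (h x) + Φ x) - d)) l
        (nhds 0) := by
      simpa using ((((hκ1.pow 2).mul ((hcos.const_mul d).add hΦ0)).sub_const d)).const_mul
        ((1 + β₁) / 4)
    simpa using ((hbdd (hbdd t1)).add (hbdd t2)).add t3
  have hfin := hrem.add hlim
  rw [add_zero] at hfin
  refine hfin.congr' ?_
  filter_upwards [hmain] with x hx
  rw [← hx, localCharFun]
  simp only [hh, hL]
  ring

theorem differentiable_localCharFun (β₁ β₂ : ℂ) (p : CI) (n : ℕ) :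
    Differentiable ℂ (localCharFun β₁ β₂ p n) := by
  have h : Differentiable ℂ (charFun β₁ β₂ p) := fun lam =>
    (hasDerivAt_charFun β₁ β₂ p lam).differentiableAt
  unfold localCharFun
  exact (h.comp (by fun_prop)).const_mul _

theorem tendstoUniformlyOn_localCharFun (β₁ β₂ : ℂ) {p : CI}
    (hac : AbsolutelyContinuousOnInterval (extend p) 0 1)
    (hmean : ∫ t in (0 : ℝ)..1, extend p t = 0) (ρ : ℝ) :
    TendstoUniformlyOn (localCharFun β₁ β₂ p) (localPoly β₁ β₂ (extend p 0 - extend p 1)) atTop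
      (Metric.closedBall 0 ρ) := by
  rw [tendstoUniformlyOn_iff_tendsto, tendsto_uniformity_iff_dist_tendsto_zero]
  have h := tendsto_localCharFun β₁ β₂ hac hmean (l := atTop ×ˢ 𝓟 (Metric.closedBall (0 : ℂ) ρ))
    (n := Prod.fst) (ζ := Prod.snd) (ρ := ρ) tendsto_fst (by
      refine (tendsto_snd (f := atTop (α := ℕ))).eventually (p := fun ζ : ℂ => ‖ζ‖ ≤ ρ) ?_
      rw [eventually_principal]
      intro ζ hζ
      rwa [mem_closedBall_zero_iff] at hζ)
  refine h.norm.congr' ?_ |>.trans (by simp)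
  exact Eventually.of_forall fun x => ((dist_comm _ _).trans (dist_eq_norm _ _)).symm

theorem deriv_charFun_ne_zero {β₁ β₂ : ℂ} {p : CI} {n : ℕ} {ζ : ℂ}
    (h : deriv (localCharFun β₁ β₂ p n) ζ ≠ 0) :
    deriv (charFun β₁ β₂ p) ((2 * Real.pi * n + ζ / (2 * Real.pi * n)) ^ 2) ≠ 0 := by
  intro h0
  apply h
  have h1 : HasDerivAt (fun ζ : ℂ => (2 * Real.pi * n + ζ / (2 * Real.pi * n)) ^ 2) _ ζ :=
    (((hasDerivAt_id ζ).div_const (2 * Real.pi * n : ℂ)).const_add (2 * Real.pi * n : ℂ)).pow 2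
  have h2 := (hasDerivAt_charFun β₁ β₂ p
    ((2 * Real.pi * n + ζ / (2 * Real.pi * n)) ^ 2)).differentiableAt.hasDerivAt
  rw [h0] at h2
  have h3 := (HasDerivAt.comp ζ h2 h1).const_mul ((2 * Real.pi * n : ℂ) ^ 2)
  rw [zero_mul, mul_zero] at h3
  exact h3.deriv

/-! ### The two sequences of large zeros of the characteristic function -/

theorem two_pi_mul_ne_zero {n : ℕ} (hn : n ≠ 0) : (2 * Real.pi * n : ℂ) ≠ 0 :=
  mul_ne_zero (mul_ne_zero two_ne_zero (Complex.ofReal_ne_zero.2 Real.pi_ne_zero))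
    (Nat.cast_ne_zero.2 hn)

theorem localCharFun_eq_zero_iff {β₁ β₂ : ℂ} {p : CI} {n : ℕ} (hn : n ≠ 0) {ζ : ℂ} :
    localCharFun β₁ β₂ p n ζ = 0 ↔
      charFun β₁ β₂ p ((2 * Real.pi * n + ζ / (2 * Real.pi * n)) ^ 2) = 0 := by
  rw [localCharFun, mul_eq_zero, or_iff_right (pow_ne_zero 2 (two_pi_mul_ne_zero hn))]

/-- For large `n` the characteristic function has exactly two zeros near `(2πn) ^ 2`, they are
simple, and there are no other large zeros. -/
theorem exists_zero_sequences (β₁ β₂ : ℂ) (hβ : β₁ ≠ 1) {p : CI}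
    (hac : AbsolutelyContinuousOnInterval (extend p) 0 1)
    (hmean : ∫ t in (0 : ℝ)..1, extend p t = 0) {r : Fin 2 → ℂ} (hr : r 0 ≠ r 1)
    (hfact : ∀ ζ, localPoly β₁ β₂ (extend p 0 - extend p 1) ζ =
      (1 - β₁) / 2 * ((ζ - r 0) * (ζ - r 1))) :
    ∃ z : Fin 2 → ℕ → ℂ, (∀ i, Tendsto (z i) atTop (nhds (r i))) ∧ ∃ (N : ℕ) (R : ℝ), 0 ≤ R ∧
      (∀ i n, N ≤ n → 0 < (2 * Real.pi * n + z i n / (2 * Real.pi * n)).re ∧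
        deriv (charFun β₁ β₂ p) ((2 * Real.pi * n + z i n / (2 * Real.pi * n)) ^ 2) ≠ 0) ∧
      BijOn (fun x : Fin 2 × ℕ => 2 * Real.pi * x.2 + z x.1 x.2 / (2 * Real.pi * x.2))
        {x | N ≤ x.2} {z : ℂ | 0 ≤ z.re ∧ R < ‖z‖ ∧ charFun β₁ β₂ p (z ^ 2) = 0} := by
  have ha : (1 - β₁) / 2 ≠ 0 := div_ne_zero (sub_ne_zero.2 hβ.symm) two_ne_zero
  obtain ⟨C, R₀, hC, hloc⟩ := exists_localization β₁ β₂ hβ hac hmean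
  obtain ⟨z, hz, hzeros⟩ := exists_zeros (differentiable_localCharFun β₁ β₂ p) ha hr (fun ρ => by
    simp_rw [← hfact]
    exact tendstoUniformlyOn_localCharFun β₁ β₂ hac hmean ρ)
  have hpi := Real.pi_gt_three
  have hsmall : ∀ i, ∀ᶠ n : ℕ in atTop, ‖z i n / (2 * Real.pi * n)‖ ≤ 1 / 2 := fun i => by
    have hb : ∀ᶠ n in atTop, ‖z i n‖ ≤ ‖r i‖ + 1 :=
      (hz i).norm.eventually (ge_mem_nhds (lt_add_one _))
    exact (tendsto_div_two_pi_mul tendsto_id hb).norm.eventually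
      (ge_mem_nhds (show ‖(0 : ℂ)‖ < 1 / 2 by simp))
  -- `C / n ≤ 1 / 2` holds from `N₂` on, and `N₃` makes the cut-off `2πN - 1` exceed the modulus of
  -- every zero localized near `2πn` with `n ≤ N₂`
  obtain ⟨N₁, hN₁⟩ := eventually_atTop.1 ((hzeros (2 * Real.pi * C)).and
    ((hsmall 0).and (hsmall 1)))
  obtain ⟨N₂, hN₂⟩ := exists_nat_ge (2 * C)
  obtain ⟨N₃, hN₃⟩ := exists_nat_ge (max R₀ (2 * Real.pi * N₂ + C) + 1)
  set N := max (max N₁ N₃) 1 with hN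
  have hNN₁ : N₁ ≤ N := (le_max_left _ _).trans (le_max_left _ _)
  have hNN₃ : (N₃ : ℝ) ≤ N := by exact_mod_cast (le_max_right _ _).trans (le_max_left _ _)
  have hN1 : 1 ≤ N := le_max_right _ _
  have hN1' : (1 : ℝ) ≤ N := by exact_mod_cast hN1
  have hNbig : max R₀ (2 * Real.pi * N₂ + C) ≤ 2 * Real.pi * N - 1 := by nlinarith
  have hμ : ∀ i n, N ≤ n → ‖z i n / (2 * Real.pi * n)‖ ≤ 1 / 2 := fun i n hn => by
    have := (hN₁ n (hNN₁.trans hn)).2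
    fin_cases i
    · exact this.1
    · exact this.2
  have hre : ∀ i n, N ≤ n → 2 * Real.pi * n - 1 / 2 ≤
      (2 * Real.pi * n + z i n / (2 * Real.pi * n)).re := fun i n hn => by
    have e : (2 * Real.pi * n : ℂ) = ((2 * Real.pi * n : ℝ) : ℂ) := by push_cast; ring
    rw [Complex.add_re, e, Complex.ofReal_re, ← e]
    linarith [neg_abs_le (z i n / (2 * Real.pi * n)).re,
      (Complex.abs_re_le_norm (z i n / (2 * Real.pi * n))).trans (hμ i n hn)]
  have hre' : ∀ i n, N ≤ n → 2 * Real.pi * N - 1 <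
      (2 * Real.pi * n + z i n / (2 * Real.pi * n)).re := fun i n hn => by
    have : (N : ℝ) ≤ n := by exact_mod_cast hn
    nlinarith [hre i n hn]
  have hR0 : 0 ≤ 2 * Real.pi * N - 1 := by nlinarith
  refine ⟨z, hz, N, 2 * Real.pi * N - 1, hR0, fun i n hn => ⟨hR0.trans_lt (hre' i n hn),
    deriv_charFun_ne_zero ((hN₁ n (hNN₁.trans hn)).1.1 i).2⟩, ?_, ?_, ?_⟩
  · rintro ⟨i, n⟩ (hn : N ≤ n)
    have h := hre' i n hn
    exact ⟨(hR0.trans_lt h).le, h.trans_le (Complex.re_le_norm _),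
      (localCharFun_eq_zero_iff (by omega)).1 ((hN₁ n (hNN₁.trans hn)).1.1 i).1⟩
  · rintro ⟨i, n⟩ (hn : N ≤ n) ⟨j, m⟩ (hm : N ≤ m) (h : _ + _ = _ + _)
    dsimp only at h
    have hnm : n = m := by
      by_contra hne
      have h1 : (1 : ℝ) ≤ |(n : ℝ) - m| := by
        have : (1 : ℤ) ≤ |(n : ℤ) - m| := Int.one_le_abs (by omega)
        exact_mod_cast this
      have h2 : ((2 * Real.pi * (n - m) : ℝ) : ℂ) =
          z j m / (2 * Real.pi * m) - z i n / (2 * Real.pi * n) := by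
        push_cast
        linear_combination h
      have h3 := norm_sub_le (z j m / (2 * Real.pi * m)) (z i n / (2 * Real.pi * n))
      rw [← h2, Complex.norm_real, Real.norm_eq_abs, abs_mul,
        abs_of_pos (show 0 < 2 * Real.pi by linarith)] at h3
      nlinarith [hμ j m hm, hμ i n hn]
    subst hnm
    have hn0 : (2 * Real.pi * n : ℂ) ≠ 0 := two_pi_mul_ne_zero (by omega)
    have h1 : z i n = z j n := by
      have := add_left_cancel h
      rwa [div_left_inj' hn0] at this
    have hne := (hN₁ n (hNN₁.trans hn)).1.2.1
    have hij : i = j := by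
      fin_cases i <;> fin_cases j
      · rfl
      · exact absurd h1 hne
      · exact absurd h1.symm hne
      · rfl
    rw [hij]
  · rintro w ⟨hw0, hwR, hw⟩
    obtain ⟨n, hn1, hn⟩ := hloc w ((le_max_left _ _).trans (hNbig.trans hwR.le)) hw0 hw
    have hn1' : (1 : ℝ) ≤ n := by exact_mod_cast hn1
    have hnorm : ‖w‖ ≤ 2 * Real.pi * n + C / n := by
      have := norm_add_le (w - 2 * Real.pi * n) (2 * Real.pi * n)
      rw [sub_add_cancel, norm_two_pi_mul] at this
      linarith
    have hNn : N ≤ n := by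
      by_contra! hlt
      have hlt' : (n : ℝ) + 1 ≤ N := by exact_mod_cast hlt
      rcases le_total n N₂ with h | h
      · have h1 : (n : ℝ) ≤ N₂ := by exact_mod_cast h
        have h2 : C / n ≤ C := div_le_self hC hn1'
        have h3 := (le_max_right R₀ (2 * Real.pi * N₂ + C)).trans hNbig
        nlinarith
      · have h1 : (N₂ : ℝ) ≤ n := by exact_mod_cast h
        have h2 : C / n ≤ 1 / 2 := by
          rw [div_le_iff₀ (by linarith)]
          linarith
        nlinarith
    have hn0 : (2 * Real.pi * n : ℂ) ≠ 0 := two_pi_mul_ne_zero (by omega)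
    set ζ := (w - 2 * Real.pi * n) * (2 * Real.pi * n) with hζ
    have hw' : 2 * Real.pi * n + ζ / (2 * Real.pi * n) = w := by
      rw [hζ, mul_div_cancel_right₀ _ hn0]; ring
    have hζρ : ζ ∈ Metric.closedBall (0 : ℂ) (2 * Real.pi * C) := by
      rw [mem_closedBall_zero_iff, hζ, norm_mul, norm_two_pi_mul]
      calc ‖w - 2 * Real.pi * n‖ * (2 * Real.pi * n) ≤ C / n * (2 * Real.pi * n) := by gcongr
        _ = 2 * Real.pi * C := by field_simp
    obtain ⟨i, hi⟩ := (hN₁ n (hNN₁.trans hNn)).1.2.2 ζ hζρ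
      ((localCharFun_eq_zero_iff (by omega)).2 (by rw [hw']; exact hw))
    exact ⟨(i, n), hNn, by dsimp only; rw [← hi, hw']⟩

/-- The roots of the limit polynomial, expressed by a square root of the discriminant. -/
theorem localPoly_eq {β₁ : ℂ} (β₂ d : ℂ) (hβ : β₁ ≠ 1) {w : ℂ}
    (hw : w ^ 2 = 2 * (1 - β₁ ^ 2) * d - (2 * β₂) ^ 2) (ζ : ℂ) :
    localPoly β₁ β₂ d ζ = (1 - β₁) / 2 * ((ζ - (2 * β₂ - Complex.I * w) / (2 * (β₁ - 1))) *
      (ζ - (2 * β₂ + Complex.I * w) / (2 * (β₁ - 1)))) := by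
  have h : β₁ - 1 ≠ 0 := sub_ne_zero.2 hβ
  rw [localPoly]
  field_simp
  linear_combination (-4 * (1 - β₁)) * hw + 4 * (1 - β₁) * w ^ 2 * Complex.I_sq

theorem isLittleO_sub_of_tendsto {z : ℕ → ℂ} {r : ℂ} (hz : Tendsto z atTop (nhds r)) :
    (fun n : ℕ => 2 * Real.pi * n + z n / (2 * Real.pi * n) -
      (2 * Real.pi * n + r / (2 * Real.pi * n))) =o[atTop] (fun n : ℕ => 1 / (n : ℝ)) := by
  have h1 : (fun n => (z n - r) / (2 * Real.pi)) =o[atTop] (fun _ => (1 : ℝ)) := by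
    rw [isLittleO_one_iff]
    simpa using (hz.sub_const r).div_const (2 * Real.pi : ℂ)
  have h2 : (fun n : ℕ => ((1 / (n : ℝ) : ℝ) : ℂ)) =O[atTop] (fun n : ℕ => 1 / (n : ℝ)) :=
    IsBigO.of_bound 1 (Eventually.of_forall fun n => by
      rw [Complex.norm_real, one_mul])
  have h3 := h1.mul_isBigO h2
  simp only [one_mul] at h3
  refine h3.congr_left fun n => ?_
  push_cast
  ring

/-! ### The eigenfunctions for large eigenvalues -/

theorem norm_toL2_le (u : CI) : ‖toL2 u‖ ≤ ‖u‖ := by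
  have h := Lp.norm_le_of_ae_bound (f := toL2 u) (norm_nonneg u) (by
    filter_upwards [coeFn_toL2 u] with x hx
    rw [hx]
    exact norm_extend_le u x)
  simpa [measureUnivNNReal] using h

theorem toL2_sub (u v : CI) : toL2 (u - v) = toL2 u - toL2 v := by
  rw [sub_eq_add_neg, ← neg_one_smul ℂ v, toL2_add, toL2_smul]
  module

/-- The function `cos (2πnx)` on `[0,1]`. -/
def cosCI (n : ℕ) : CI := CI.mk (fun x => (Real.cos (2 * Real.pi * n * x) : ℂ)) (by fun_prop)

theorem norm_toL2_cosCI {n : ℕ} (hn : n ≠ 0) : ‖toL2 (cosCI n)‖ ^ 2 = 1 / 2 := by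
  have hc : conjCI (cosCI n) = cosCI n := by
    ext x
    exact Complex.conj_ofReal _
  have h := inner_toL2_conjCI (cosCI n) (toL2 (cosCI n))
  rw [hc, inner_self_eq_norm_sq_to_K] at h
  have h1 : ∫ x in Icc (0 : ℝ) 1, toL2 (cosCI n) x * extend (cosCI n) x =
      ((∫ x in (0 : ℝ)..1, Real.cos (2 * Real.pi * n * x) ^ 2 : ℝ) : ℂ) := by
    rw [intervalIntegral.integral_of_le zero_le_one, ← integral_Icc_eq_integral_Ioc,
      ← integral_complex_ofReal]
    refine integral_congr_ae ?_
    filter_upwards [coeFn_toL2 (cosCI n), ae_restrict_mem measurableSet_Icc] with x hx hx1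
    rw [hx, extend_apply _ hx1, Complex.ofReal_pow, sq]
    rfl
  have hpos : (2 * Real.pi * n : ℝ) ≠ 0 := by
    have := Real.pi_ne_zero
    positivity
  have h2 : ∫ x in (0 : ℝ)..1, Real.cos (2 * Real.pi * n * x) ^ 2 = 1 / 2 := by
    rw [intervalIntegral.integral_comp_mul_left (fun y => Real.cos y ^ 2) hpos, integral_cos_sq,
      mul_one, mul_zero, Real.sin_zero, mul_zero,
      show 2 * Real.pi * n = 0 + n * (2 * Real.pi) by ring, Real.sin_add_nat_mul_two_pi,
      Real.sin_zero, smul_eq_mul]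
    rw [zero_add]
    field_simp
    ring
  rw [h1, h2] at h
  exact Complex.ofReal_injective ((Complex.ofReal_pow _ _).trans h)

/-- When the coefficient of the initial slope in the first boundary condition does not vanish, the
eigenfunction may be normalized by `y 0 = 1`. -/
theorem toL2_sol_mem_kerPow_one {β₁ β₂ lam : ℂ} {q : ℝ → ℂ} {p : CI}
    (hpq : EqOn q (extend p) (Icc 0 1)) (h0 : charFun β₁ β₂ p lam = 0)
    (hm : 1 + β₁ * dsol p lam 0 1 0 1 + β₂ * sol p lam 0 1 0 1 ≠ 0) :
    toL2 (sol p lam 1 (-(β₁ * dsol p lam 1 0 0 1 + β₂ * sol p lam 1 0 0 1) /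
      (1 + β₁ * dsol p lam 0 1 0 1 + β₂ * sol p lam 0 1 0 1)) 0) ∈ kerPow (T β₁ β₂ q) lam 1 := by
  rw [charFun_eq_det] at h0
  have h2 : ∀ x s n m : ℂ, m ≠ 0 → x * m + s * n = 0 → x * 1 + -s * (-n / m) = 0 := by
    intro x s n m hm h
    field_simp
    linear_combination h
  exact (mem_kerPow_one hpq).2 ⟨_, _, rfl, by field_simp; ring, h2 _ _ _ _ hm h0⟩

theorem tendsto_div_norm_pow {α : Type*} {l : Filter α} {f : α → ℂ} {μ : α → ℂ} {B : ℝ} {k : ℕ}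
    (hk : k ≠ 0) (hμ : Tendsto (fun x => ‖μ x‖) l atTop) (hf : ∀ᶠ x in l, ‖f x‖ ≤ B / ‖μ x‖ ^ k) :
    Tendsto f l (nhds 0) :=
  squeeze_zero_norm' hf (Tendsto.const_div_atTop ((tendsto_pow_atTop hk).comp hμ) B)

/-- The eigenfunctions for the eigenvalues near `(2πn) ^ 2` are uniformly close to `cos (2πnx)`. -/
theorem exists_eigenfunction_near_cos {β₁ β₂ : ℂ} (hβ' : β₁ ≠ -1) {q : ℝ → ℂ} {p : CI}
    (hpq : EqOn q (extend p) (Icc 0 1))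
    (hac : AbsolutelyContinuousOnInterval (extend p) 0 1)
    (hmean : ∫ t in (0 : ℝ)..1, extend p t = 0) {ζ : ℕ → ℂ} {ρ : ℝ}
    (hζ : ∀ᶠ n in atTop, ‖ζ n‖ ≤ ρ)
    (h0 : ∀ᶠ n : ℕ in atTop,
      charFun β₁ β₂ p ((2 * Real.pi * n + ζ n / (2 * Real.pi * n)) ^ 2) = 0) :
    ∃ u : ℕ → CI, (∀ᶠ n : ℕ in atTop, toL2 (u n) ∈
        kerPow (T β₁ β₂ q) ((2 * Real.pi * n + ζ n / (2 * Real.pi * n)) ^ 2) 1) ∧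
      Tendsto (fun n => ‖u n - cosCI n‖) atTop (nhds 0) := by
  obtain ⟨C₁, hC₁, h₁⟩ :=
    exists_cosine_asymptotics (continuous_extend p) (norm_extend_le p) hac hmean
  obtain ⟨C₂, hC₂, h₂⟩ := exists_sine_asymptotics (continuous_extend p) (norm_extend_le p) hac hmean
  obtain ⟨C₃, hC₃, h₃⟩ := exists_norm_sinIntegral_le hac
  set h : ℕ → ℂ := fun n => ζ n / (2 * Real.pi * n) with hh
  set μ : ℕ → ℂ := fun n => 2 * Real.pi * n + h n with hμ
  have hh0 : Tendsto h atTop (nhds 0) := tendsto_div_two_pi_mul tendsto_id hζ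
  have hμtop : Tendsto (fun n => ‖μ n‖) atTop atTop := tendsto_norm_two_pi_mul_add tendsto_id hζ
  have hsmall : ∀ᶠ n in atTop, ‖h n‖ ≤ 1 :=
    hh0.norm.eventually (ge_mem_nhds (show ‖(0 : ℂ)‖ < 1 by simp))
  have hcosμ : ∀ n, Complex.cos (μ n) = Complex.cos (h n) := fun n => by
    rw [show μ n = h n + n * (2 * Real.pi) by simp only [hμ]; ring, Complex.cos_add_nat_mul_two_pi]
  have hsinμ : ∀ n, Complex.sin (μ n) = Complex.sin (h n) := fun n => by
    rw [show μ n = h n + n * (2 * Real.pi) by simp only [hμ]; ring, Complex.sin_add_nat_mul_two_pi]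
  have herr : ∀ᶠ n in atTop, ∀ k : ℕ, ∀ x ∈ Icc (0 : ℝ) 1,
      errScale (μ n) k x ≤ 3 / ‖μ n‖ ^ k := by
    filter_upwards [hsmall] with n hn k x hx
    rw [errScale]
    gcongr
    have h1 : |(μ n).im| ≤ 1 := (abs_im_two_pi_mul_add_le n (h n)).trans hn
    have h2 : |(μ n).im| * x ≤ 1 := mul_le_one₀ h1 hx.1 hx.2
    linarith [Real.exp_le_exp.2 h2, Real.exp_one_lt_d9]
  have hone : (1 : ℝ) ∈ Icc (0 : ℝ) 1 := right_mem_Icc.2 zero_le_one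
  have hlarge : ∀ᶠ n in atTop, 0 < ‖μ n‖ ∧ 2 * ‖p‖ ≤ ‖μ n‖ :=
    (hμtop.eventually_gt_atTop 0).and (hμtop.eventually_ge_atTop _)
  set c : ℕ → CI := fun n => sol p (μ n ^ 2) 1 0 0 with hc
  set dc : ℕ → CI := fun n => dsol p (μ n ^ 2) 1 0 0 with hdc
  set s : ℕ → CI := fun n => sol p (μ n ^ 2) 0 1 0 with hs
  set ds : ℕ → CI := fun n => dsol p (μ n ^ 2) 0 1 0 with hds
  have hcos : ∀ᶠ n in atTop,
      (∀ x ∈ Icc (0 : ℝ) 1, ‖extend (c n) x - Complex.cos (μ n * x)‖ ≤ C₁ * (3 / ‖μ n‖ ^ 1)) ∧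
        ‖dc n 1 + μ n * Complex.sin (μ n)‖ ≤ C₁ * 3 := by
    filter_upwards [herr, hlarge] with n he hl
    obtain ⟨a1, -, a3⟩ := h₁ (μ n) (norm_pos_iff.1 hl.1) hl.2 _ _ (isSol_extend_sol p _ 1 0)
      (continuous_extend _) (by rw [extend_zero, sol_zero_apply])
      (by rw [extend_zero, dsol_zero_apply])
    rw [extend_one] at a3
    refine ⟨fun x hx => (a1 x hx).trans ?_, a3.trans ?_⟩
    · gcongr; exact he 1 x hx
    · gcongr; simpa using he 0 1 hone
  have hsin : ∀ᶠ n in atTop, (∀ x ∈ Icc (0 : ℝ) 1, ‖extend (s n) x‖ ≤ 2 * (3 / ‖μ n‖ ^ 1)) ∧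
      ‖ds n 1 - (Complex.cos (μ n) - sinIntegral (extend p) (μ n) / (2 * μ n))‖ ≤
        C₂ * (3 / ‖μ n‖ ^ 3) := by
    filter_upwards [herr, hlarge] with n he hl
    obtain ⟨a1, -, a3⟩ := h₂ (μ n) (norm_pos_iff.1 hl.1) hl.2 _ _ (isSol_extend_sol p _ 0 1)
      (continuous_extend _) (by rw [extend_zero, sol_zero_apply])
      (by rw [extend_zero, dsol_zero_apply])
    rw [extend_one] at a3
    refine ⟨fun x hx => (a1 x hx).trans ?_, a3.trans ?_⟩
    · gcongr; exact he 1 x hx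
    · gcongr; exact he 3 1 hone
  have hcosh : Tendsto (fun n => Complex.cos (h n)) atTop (nhds 1) := by
    have := (Complex.continuous_cos.tendsto 0).comp hh0
    rwa [Complex.cos_zero] at this
  have hs1 : Tendsto (fun n => s n 1) atTop (nhds 0) := by
    refine tendsto_div_norm_pow one_ne_zero hμtop (B := 2 * 3) ?_
    filter_upwards [hsin] with n hn
    have := hn.1 1 hone
    rwa [extend_one, ← mul_div_assoc] at this
  have hds1 : Tendsto (fun n => ds n 1) atTop (nhds 1) := by
    have t1 : Tendsto (fun n => ds n 1 -
        (Complex.cos (μ n) - sinIntegral (extend p) (μ n) / (2 * μ n))) atTop (nhds 0) := by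
      refine tendsto_div_norm_pow three_ne_zero hμtop (B := C₂ * 3) ?_
      filter_upwards [hsin] with n hn
      rw [mul_div_assoc]
      exact hn.2
    have t2 : Tendsto (fun n => sinIntegral (extend p) (μ n) / (2 * μ n)) atTop (nhds 0) := by
      refine tendsto_div_norm_pow two_ne_zero hμtop (B := C₃ * 3) ?_
      filter_upwards [herr, hlarge] with n he hl
      have h5 := (h₃ (μ n) (norm_pos_iff.1 hl.1)).trans
        (mul_le_mul_of_nonneg_left (he 1 1 hone) hC₃)
      have h6 := hl.1
      rw [norm_div, norm_mul, Complex.norm_ofNat]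
      calc ‖sinIntegral (extend p) (μ n)‖ / (2 * ‖μ n‖)
          ≤ C₃ * (3 / ‖μ n‖ ^ 1) / (1 * ‖μ n‖) := by
            gcongr
            norm_num
        _ = C₃ * 3 / ‖μ n‖ ^ 2 := by field_simp
    have t3 := (t1.add (hcosh.sub t2))
    rw [sub_zero, zero_add] at t3
    refine t3.congr fun n => ?_
    rw [hcosμ]
    ring
  have hm12 : Tendsto (fun n => 1 + β₁ * ds n 1 + β₂ * s n 1) atTop (nhds (1 + β₁)) := by
    have := ((hds1.const_mul β₁).const_add 1).add (hs1.const_mul β₂)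
    rwa [mul_one, mul_zero, add_zero] at this
  have hβ1 : 1 + β₁ ≠ 0 := fun hc => hβ' (by linear_combination hc)
  have hμh : ∀ᶠ n in atTop, ‖μ n * Complex.sin (h n)‖ ≤ (ρ + 1) * 2 := by
    have hd : ∀ᶠ n in atTop, ‖dslope Complex.sin 0 (h n)‖ ≤ 2 :=
      (tendsto_sin_div.comp hh0).norm.eventually (ge_mem_nhds (by norm_num))
    filter_upwards [hd, hζ, hsmall, eventually_ne_atTop 0] with n h1 h2 h3 h4
    have e : μ n * Complex.sin (h n) = (ζ n + h n * h n) * dslope Complex.sin 0 (h n) := by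
      have h5 := two_pi_mul_ne_zero h4
      rw [sin_eq_mul_dslope (h n), ← mul_assoc]
      congr 1
      simp only [hμ, hh]
      field_simp
    rw [e, norm_mul]
    have h6 := norm_add_le (ζ n) (h n * h n)
    rw [norm_mul (h n)] at h6
    have h7 : ‖h n‖ * ‖h n‖ ≤ 1 := mul_le_one₀ h3 (norm_nonneg _) h3
    have h8 : 0 ≤ ρ + 1 := by linarith [norm_nonneg (ζ n)]
    gcongr
    linarith
  set b : ℕ → ℂ := fun n => -(β₁ * dc n 1 + β₂ * c n 1) / (1 + β₁ * ds n 1 + β₂ * s n 1) with hb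
  -- the slope of the normalized eigenfunction at `0` is bounded
  obtain ⟨B, hB⟩ : ∃ B, ∀ᶠ n in atTop, ‖b n‖ ≤ B := by
    have hc1 : ∀ᶠ n in atTop, ‖c n 1‖ ≤ C₁ * 3 + 2 := by
      have h9 : ∀ᶠ n in atTop, ‖Complex.cos (h n)‖ ≤ 2 :=
        hcosh.norm.eventually (ge_mem_nhds (by norm_num))
      filter_upwards [hcos, h9, hμtop.eventually_ge_atTop 1] with n h1 h2 h3
      have h4 := h1.1 1 hone
      rw [extend_one, Complex.ofReal_one, mul_one, hcosμ, pow_one] at h4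
      have h5 : C₁ * (3 / ‖μ n‖) ≤ C₁ * 3 := by
        gcongr
        exact div_le_self (by norm_num) h3
      linarith [norm_sub_norm_le (c n 1) (Complex.cos (h n))]
    have hm : ∀ᶠ n in atTop, ‖1 + β₁‖ / 2 ≤ ‖1 + β₁ * ds n 1 + β₂ * s n 1‖ :=
      hm12.norm.eventually (le_mem_nhds (half_lt_self (norm_pos_iff.2 hβ1)))
    have hβ2 : 0 < ‖1 + β₁‖ / 2 := half_pos (norm_pos_iff.2 hβ1)
    refine ⟨(‖β₁‖ * (C₁ * 3 + (ρ + 1) * 2) + ‖β₂‖ * (C₁ * 3 + 2)) / (‖1 + β₁‖ / 2), ?_⟩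
    filter_upwards [hc1, hm, hcos, hμh] with n h1 h2 h3 h4
    simp only [hb, norm_div, norm_neg]
    have h5 : ‖dc n 1‖ ≤ C₁ * 3 + (ρ + 1) * 2 := by
      have h6 := h3.2
      rw [hsinμ] at h6
      have := norm_sub_le (dc n 1 + μ n * Complex.sin (h n)) (μ n * Complex.sin (h n))
      rw [add_sub_cancel_right] at this
      linarith
    have h7 : ‖β₁ * dc n 1 + β₂ * c n 1‖ ≤
        ‖β₁‖ * (C₁ * 3 + (ρ + 1) * 2) + ‖β₂‖ * (C₁ * 3 + 2) := by
      refine (norm_add_le _ _).trans ?_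
      rw [norm_mul, norm_mul]
      gcongr
    exact div_le_div₀ ((norm_nonneg _).trans h7) h7 hβ2 h2
  refine ⟨fun n => sol p (μ n ^ 2) 1 (b n) 0, ?_, ?_⟩
  · filter_upwards [h0, hm12.eventually_ne hβ1] with n h1 h2
    exact toL2_sol_mem_kerPow_one hpq h1 h2
  · have hlim : Tendsto (fun n => C₁ * (3 / ‖μ n‖ ^ 1) + B * (2 * (3 / ‖μ n‖ ^ 1)) + 3 * ‖h n‖)
        atTop (nhds 0) := by
      have t1 : Tendsto (fun n => 3 / ‖μ n‖ ^ 1) atTop (nhds 0) :=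
        Tendsto.const_div_atTop ((tendsto_pow_atTop one_ne_zero).comp hμtop) 3
      simpa using ((t1.const_mul C₁).add ((t1.const_mul 2).const_mul B)).add (hh0.norm.const_mul 3)
    refine squeeze_zero' (Eventually.of_forall fun n => norm_nonneg _) ?_ hlim
    filter_upwards [hB, hcos, hsin, hsmall] with n h1 h2 h3 h4
    have hB0 : 0 ≤ B := (norm_nonneg _).trans h1
    refine (CI.norm_le (by positivity)).2 fun x => ?_
    have e1 : (sol p (μ n ^ 2) 1 (b n) 0 - cosCI n) x =
        (c n x - Complex.cos (μ n * x)) + b n * s n x +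
          (Complex.cos (2 * Real.pi * n * x + h n * x) - Complex.cos (2 * Real.pi * n * x)) := by
      rw [sol_linear p (μ n ^ 2) 1 (b n) 0, sol_zero_zero_zero]
      simp only [CI.sub_apply, CI.add_apply, CI.smul_apply, CI.zero_apply, cosCI, CI.mk_apply, hμ]
      push_cast
      rw [add_mul (2 * Real.pi * n : ℂ)]
      simp only [hc, hs, hμ]
      ring
    rw [e1]
    have h5 := h2.1 x x.2
    have h6 := h3.1 x x.2
    rw [extend_coe] at h5 h6
    have h8 : ‖h n * ((x : ℝ) : ℂ)‖ ≤ ‖h n‖ := by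
      rw [norm_mul, Complex.norm_real, Real.norm_eq_abs, abs_of_nonneg x.2.1]
      exact mul_le_of_le_one_right (norm_nonneg _) x.2.2
    have h7 := norm_cos_sub_cos_le (A := 2 * Real.pi * n * ((x : ℝ) : ℂ)) (h := h n * ((x : ℝ) : ℂ))
      (by
        rw [show (2 * Real.pi * n * ((x : ℝ) : ℂ)) = ((2 * Real.pi * n * x : ℝ) : ℂ) by
          push_cast; ring, Complex.ofReal_im]) (h8.trans h4)
    refine (norm_add₃_le).trans ?_
    rw [norm_mul (b n)]
    refine add_le_add (add_le_add h5 ?_) (h7.trans (by gcongr))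
    gcongr

/-! ### Nearly parallel eigenfunctions -/

/-- A Riesz basis of root functions contains a multiple of the eigenfunction of every simple
eigenvalue. -/
theorem exists_eq_smul_of_isRieszBasis {β₁ β₂ lam : ℂ} {q : ℝ → ℂ} {p : CI}
    (hpq : EqOn q (extend p) (Icc 0 1)) (h0 : charFun β₁ β₂ p lam = 0)
    (h1 : deriv (charFun β₁ β₂ p) lam ≠ 0) {ι : Type*} {φ : ι → L2}
    (hφ : ∀ i, IsRootFunction (T β₁ β₂ q) (φ i)) (hR : IsRieszBasis φ) {f : L2} (hf : f ≠ 0)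
    (hfm : f ∈ kerPow (T β₁ β₂ q) lam 1) : ∃ (i : ι) (s : ℂ), s ≠ 0 ∧ φ i = s • f := by
  obtain ⟨i, k, hk⟩ := exists_mem_kerPow hpq h0 hφ hR
  have hi := kerPow_le_one (kerPow_two_le hpq h0 h1) k hk
  obtain ⟨g, -, hg⟩ := exists_span_kerPow_one hpq h0 h1
  rw [hg, Submodule.mem_span_singleton] at hi hfm
  obtain ⟨a, ha⟩ := hi
  obtain ⟨b, hb⟩ := hfm
  have hb0 : b ≠ 0 := by
    rintro rfl
    exact hf (by rw [← hb, zero_smul])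
  have ha0 : a ≠ 0 := by
    rintro rfl
    exact (hφ i).1 (by rw [← ha, zero_smul])
  exact ⟨i, a / b, div_ne_zero ha0 hb0, by rw [← hb, ← ha, smul_smul, div_mul_cancel₀ _ hb0]⟩

theorem eq_zero_of_mem_kerPow_one {β₁ β₂ lam lam' : ℂ} {q : ℝ → ℂ} (hne : lam ≠ lam') {f : L2}
    (h : f ∈ kerPow (T β₁ β₂ q) lam 1) (h' : f ∈ kerPow (T β₁ β₂ q) lam' 1) : f = 0 := by
  obtain ⟨g, hg, e⟩ := mem_kerPow_succ.1 h
  obtain ⟨g', hg', e'⟩ := mem_kerPow_succ.1 h'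
  obtain ⟨_, rfl⟩ := mem_graph_iff_T.2 hg
  obtain ⟨_, rfl⟩ := mem_graph_iff_T.2 hg'
  simp only [kerPow, Submodule.mem_bot, sub_eq_zero] at e e'
  rw [e, ← sub_eq_zero, ← sub_smul] at e'
  exact (smul_eq_zero.1 e').resolve_left (sub_ne_zero.2 hne)

/-- A system of root functions is not a Riesz basis if there are two sequences of different simple
eigenvalues whose eigenfunctions both approach `cos (2πnx)`, which has norm `1 / √2`. -/
theorem not_isRieszBasis_of_tendsto {β₁ β₂ : ℂ} {q : ℝ → ℂ} {p : CI}
    (hpq : EqOn q (extend p) (Icc 0 1)) {lam : Fin 2 → ℕ → ℂ} {u : Fin 2 → ℕ → CI}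
    (h0 : ∀ i, ∀ᶠ n in atTop, charFun β₁ β₂ p (lam i n) = 0)
    (h1 : ∀ i, ∀ᶠ n in atTop, deriv (charFun β₁ β₂ p) (lam i n) ≠ 0)
    (hne : ∀ᶠ n in atTop, lam 0 n ≠ lam 1 n)
    (hu : ∀ i, ∀ᶠ n in atTop, toL2 (u i n) ∈ kerPow (T β₁ β₂ q) (lam i n) 1)
    (hlim : ∀ i, Tendsto (fun n => ‖u i n - cosCI n‖) atTop (nhds 0)) {ι : Type*} {φ : ι → L2}
    (hφ : ∀ i, IsRootFunction (T β₁ β₂ q) (φ i)) : ¬ IsRieszBasis φ := by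
  intro hR
  obtain ⟨C, hC⟩ := hR.exists_norm_le
  -- with this `ε`, two eigenfunctions `ε`-close to the cosine have norm at least `3 / 8`, but the
  -- bound for Riesz bases makes this norm at most `C * (2 ε) ≤ 1 / 4`
  set ε : ℝ := 1 / (8 * (|C| + 1)) with hε
  have hC0 := abs_nonneg C
  have hε0 : 0 < ε := by positivity
  have hev : ∀ i, ∀ᶠ n in atTop, ‖u i n - cosCI n‖ ≤ ε := fun i =>
    (hlim i).eventually (ge_mem_nhds hε0)
  obtain ⟨n, a0, a1, b0, b1, c, d0, d1, e0, e1, hn⟩ := ((h0 0).and <| (h0 1).and <| (h1 0).and <|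
    (h1 1).and <| hne.and <| (hu 0).and <| (hu 1).and <| (hev 0).and <| (hev 1).and <|
    eventually_ne_atTop 0).exists
  have hcos : 1 / 2 ≤ ‖toL2 (cosCI n)‖ := by
    have := norm_toL2_cosCI hn
    nlinarith [norm_nonneg (toL2 (cosCI n))]
  have hεle : ε ≤ 1 / 8 := by
    rw [hε]
    exact one_div_le_one_div_of_le (by norm_num) (by linarith)
  have hlow : ∀ i, ‖u i n - cosCI n‖ ≤ ε → 3 / 8 ≤ ‖toL2 (u i n)‖ := fun i hi => by
    have h2 := (norm_toL2_le _).trans hi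
    rw [toL2_sub, norm_sub_rev] at h2
    linarith [norm_sub_norm_le (toL2 (cosCI n)) (toL2 (u i n))]
  have hne0 : ∀ i, ‖u i n - cosCI n‖ ≤ ε → toL2 (u i n) ≠ 0 := fun i hi h => by
    have := hlow i hi
    rw [h, norm_zero] at this
    linarith
  obtain ⟨i, s, hs, hi⟩ := exists_eq_smul_of_isRieszBasis hpq a0 b0 hφ hR (hne0 0 e0) d0
  obtain ⟨j, t, ht, hj⟩ := exists_eq_smul_of_isRieszBasis hpq a1 b1 hφ hR (hne0 1 e1) d1
  have hij : i ≠ j := by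
    rintro rfl
    have m0 : φ i ∈ kerPow (T β₁ β₂ q) (lam 0 n) 1 := by
      rw [hi]; exact Submodule.smul_mem _ _ d0
    have m1 : φ i ∈ kerPow (T β₁ β₂ q) (lam 1 n) 1 := by
      rw [hj]; exact Submodule.smul_mem _ _ d1
    exact (hφ i).1 (eq_zero_of_mem_kerPow_one c m0 m1)
  have hfin := hC i j hij _ _ s t hi hj hs ht
  have hdiff : ‖toL2 (u 0 n) - toL2 (u 1 n)‖ ≤ 2 * ε := by
    rw [← toL2_sub, ← sub_sub_sub_cancel_right _ _ (cosCI n)]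
    refine (norm_toL2_le _).trans ((norm_sub_le _ _).trans ?_)
    linarith
  have h2 : C * ‖toL2 (u 0 n) - toL2 (u 1 n)‖ ≤ (|C| + 1) * (2 * ε) := by
    gcongr
    linarith [le_abs_self C]
  have h3 : (|C| + 1) * (2 * ε) = 1 / 4 := by
    rw [hε]
    field_simp
    norm_num
  linarith [hlow 0 e0]

theorem exists_extend_eqOn {q : ℝ → ℂ} (hq : AbsolutelyContinuousOnInterval q 0 1) :
    ∃ p : CI, EqOn q (extend p) (Icc 0 1) := by
  have hc : ContinuousOn q (Icc 0 1) := by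
    have := hq.continuousOn
    rwa [uIcc_of_le zero_le_one] at this
  refine ⟨CI.mk (fun x => q x) (continuousOn_iff_continuous_domRestrict.1 hc), fun x hx => ?_⟩
  rw [extend_apply _ hx]
  rfl

end SturmLiouville

/-- (a) All large eigenvalues are simple, and for either square root `w` of the discriminant their
square roots with nonnegative real part are enumerated without repetition by two sequences
with the stated asymptotics. (b) No system of root functions (with any choice of the functions
in the root subspaces and any normalization) is a Riesz basis. -/
theorem theorem2 (β₁ β₂ : ℂ) (q : ℝ → ℂ)
    (hβ : β₁ ≠ 1) (hβ' : β₁ ≠ -1)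
    (hq : AbsolutelyContinuousOnInterval q 0 1)
    (hmean : ∫ x in (0 : ℝ)..1, q x = 0)
    (hne : q 0 - q 1 ≠ 2 * β₂ ^ 2 / (1 - β₁ ^ 2)) :
    ((∃ R : ℝ, ∀ lam : ℂ, R < ‖lam‖ →
        SturmLiouville.IsEigenvalue (SturmLiouville.T β₁ β₂ q) lam →
        SturmLiouville.IsSimpleEigenvalue (SturmLiouville.T β₁ β₂ q) lam) ∧
      (∀ w : ℂ, w ^ 2 = 2 * (1 - β₁ ^ 2) * (q 0 - q 1) - (2 * β₂) ^ 2 →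
        ∃ μ : Fin 2 → ℕ → ℂ,
          (∃ (N : ℕ) (R : ℝ),
            BijOn (fun p : Fin 2 × ℕ => μ p.1 p.2) {p | N ≤ p.2}
              {z : ℂ | 0 ≤ z.re ∧ R < ‖z‖ ∧
                SturmLiouville.IsEigenvalue (SturmLiouville.T β₁ β₂ q) (z ^ 2)}) ∧
          (fun n : ℕ => μ 0 n - (2 * Real.pi * n +
              (2 * β₂ - Complex.I * w) / (4 * (β₁ - 1) * Real.pi * n)))
            =o[atTop] (fun n : ℕ => 1 / (n : ℝ)) ∧
          (fun n : ℕ => μ 1 n - (2 * Real.pi * n +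
              (2 * β₂ + Complex.I * w) / (4 * (β₁ - 1) * Real.pi * n)))
            =o[atTop] (fun n : ℕ => 1 / (n : ℝ)))) ∧
    (∀ (ι : Type) (φ : ι → SturmLiouville.L2),
      (∀ i, SturmLiouville.IsRootFunction (SturmLiouville.T β₁ β₂ q) (φ i)) →
        ¬ SturmLiouville.IsRieszBasis φ) := by
  open SturmLiouville in
  obtain ⟨p, hpq⟩ := exists_extend_eqOn hq
  have hq0 : q 0 = extend p 0 := hpq (left_mem_Icc.2 zero_le_one)
  have hq1 : q 1 = extend p 1 := hpq (right_mem_Icc.2 zero_le_one)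
  have hpq' : EqOn (extend p) q (uIcc 0 1) := by
    rw [uIcc_of_le zero_le_one]; exact hpq.symm
  have hac : AbsolutelyContinuousOnInterval (extend p) 0 1 :=
    absolutelyContinuous_of_dist_le hq fun x hx y hy => by rw [hpq' hx, hpq' hy]
  have hmean' : ∫ t in (0 : ℝ)..1, extend p t = 0 := by
    rw [intervalIntegral.integral_congr hpq', hmean]
  have hβ1 : β₁ - 1 ≠ 0 := sub_ne_zero.2 hβ
  have hβ2 : 1 - β₁ ^ 2 ≠ 0 := by
    rw [show 1 - β₁ ^ 2 = -((β₁ - 1) * (β₁ - -1)) by ring]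
    exact neg_ne_zero.2 (mul_ne_zero hβ1 (sub_ne_zero.2 hβ'))
  have key : ∀ w : ℂ, w ^ 2 = 2 * (1 - β₁ ^ 2) * (q 0 - q 1) - (2 * β₂) ^ 2 →
      ∃ z : Fin 2 → ℕ → ℂ,
        (Tendsto (z 0) atTop (nhds ((2 * β₂ - Complex.I * w) / (2 * (β₁ - 1)))) ∧
          Tendsto (z 1) atTop (nhds ((2 * β₂ + Complex.I * w) / (2 * (β₁ - 1))))) ∧
        ∃ (N : ℕ) (R : ℝ), 0 ≤ R ∧
          (∀ i n, N ≤ n → 0 < (2 * Real.pi * n + z i n / (2 * Real.pi * n)).re ∧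
            deriv (charFun β₁ β₂ p) ((2 * Real.pi * n + z i n / (2 * Real.pi * n)) ^ 2) ≠ 0) ∧
          BijOn (fun x : Fin 2 × ℕ => 2 * Real.pi * x.2 + z x.1 x.2 / (2 * Real.pi * x.2))
            {x | N ≤ x.2} {z : ℂ | 0 ≤ z.re ∧ R < ‖z‖ ∧ charFun β₁ β₂ p (z ^ 2) = 0} := by
    intro w hw
    -- the discriminant of the limit polynomial does not vanish
    have hw0 : w ≠ 0 := by
      rintro rfl
      refine hne ?_
      rw [eq_div_iff hβ2]
      linear_combination -(1 / 2 : ℂ) * hw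
    obtain ⟨z, hz, h⟩ := exists_zero_sequences β₁ β₂ hβ hac hmean'
      (r := ![(2 * β₂ - Complex.I * w) / (2 * (β₁ - 1)),
        (2 * β₂ + Complex.I * w) / (2 * (β₁ - 1))])
      (fun h => by
        have h' : (2 * β₂ - Complex.I * w) / (2 * (β₁ - 1)) =
          (2 * β₂ + Complex.I * w) / (2 * (β₁ - 1)) := h
        rw [div_left_inj' (mul_ne_zero two_ne_zero hβ1)] at h'
        have h2 : Complex.I * w = 0 := by linear_combination -(1 / 2 : ℂ) * h'
        exact hw0 ((mul_eq_zero.1 h2).resolve_left Complex.I_ne_zero))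
      (fun ζ => localPoly_eq β₂ _ hβ (by rw [← hq0, ← hq1, hw]) ζ)
    exact ⟨z, ⟨hz 0, hz 1⟩, h⟩
  obtain ⟨w₀, hw₀⟩ := IsAlgClosed.exists_pow_nat_eq
    (2 * (1 - β₁ ^ 2) * (q 0 - q 1) - (2 * β₂) ^ 2) two_pos
  obtain ⟨z, ⟨hz0, hz1⟩, N, R, hR, hN, hbij⟩ := key w₀ hw₀
  refine ⟨⟨⟨R ^ 2, fun lam hlam hev => ?_⟩, fun w hw => ?_⟩, fun ι φ hφ => ?_⟩
  · rw [isEigenvalue_iff hpq] at hev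
    obtain ⟨s, hs0, hs⟩ : ∃ s : ℂ, 0 ≤ s.re ∧ s ^ 2 = lam := by
      obtain ⟨s, hs⟩ := IsAlgClosed.exists_pow_nat_eq lam two_pos
      rcases le_total 0 s.re with h | h
      · exact ⟨s, h, hs⟩
      · exact ⟨-s, by simpa using h, by rw [neg_sq, hs]⟩
    have hsR : R < ‖s‖ := by
      rw [← hs, norm_pow] at hlam
      exact lt_of_pow_lt_pow_left₀ 2 (norm_nonneg _) hlam
    obtain ⟨⟨i, n⟩, hn, e⟩ := hbij.surjOn ⟨hs0, hsR, by rw [hs]; exact hev⟩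
    refine isSimpleEigenvalue hpq hev ?_
    rw [← hs, ← e]
    exact (hN i n hn).2
  · obtain ⟨z, ⟨hz0, hz1⟩, N, R, -, -, hbij⟩ := key w hw
    refine ⟨fun i n => 2 * Real.pi * n + z i n / (2 * Real.pi * n), ⟨N, R, ?_⟩, ?_, ?_⟩
    · simp only [isEigenvalue_iff hpq]
      exact hbij
    · refine (isLittleO_sub_of_tendsto hz0).congr_left fun n => ?_
      rw [div_div]
      congr 3
      ring
    · refine (isLittleO_sub_of_tendsto hz1).congr_left fun n => ?_
      rw [div_div]
      congr 3
      ring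
  · have hlim : ∀ i, ∃ r, Tendsto (z i) atTop (nhds r) := fun i => by
      fin_cases i
      · exact ⟨_, hz0⟩
      · exact ⟨_, hz1⟩
    have hzero : ∀ i, ∀ᶠ n : ℕ in atTop,
        charFun β₁ β₂ p ((2 * Real.pi * n + z i n / (2 * Real.pi * n)) ^ 2) = 0 := fun i => by
      filter_upwards [eventually_ge_atTop N] with n hn
      exact (hbij.mapsTo (x := (i, n)) hn).2.2
    have hu : ∀ i, ∃ u : ℕ → CI, (∀ᶠ n : ℕ in atTop, toL2 (u n) ∈
        kerPow (T β₁ β₂ q) ((2 * Real.pi * n + z i n / (2 * Real.pi * n)) ^ 2) 1) ∧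
        Tendsto (fun n => ‖u n - cosCI n‖) atTop (nhds 0) := fun i => by
      obtain ⟨r, hr⟩ := hlim i
      have hb : ∀ᶠ n in atTop, ‖z i n‖ ≤ ‖r‖ + 1 := hr.norm.eventually (ge_mem_nhds (lt_add_one _))
      exact exists_eigenfunction_near_cos hβ' hpq hac hmean' hb (hzero i)
    choose u hu1 hu2 using hu
    refine not_isRieszBasis_of_tendsto hpq
      (lam := fun i n => (2 * Real.pi * n + z i n / (2 * Real.pi * n)) ^ 2)
      hzero (fun i => ?_) ?_ hu1 hu2 hφ
    · filter_upwards [eventually_ge_atTop N] with n hn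
      exact (hN i n hn).2
    · filter_upwards [eventually_ge_atTop N] with n hn he
      -- both square roots lie in the open right half-plane
      rcases sq_eq_sq_iff_eq_or_eq_neg.1 he with h | h
      · have h2 := hbij.injOn (show ((0 : Fin 2), n) ∈ {x : Fin 2 × ℕ | N ≤ x.2} from hn)
          (show ((1 : Fin 2), n) ∈ {x : Fin 2 × ℕ | N ≤ x.2} from hn) h
        exact zero_ne_one (congrArg Prod.fst h2)
      · have h1 := (hN 0 n hn).1
        rw [h, Complex.neg_re] at h1
        linarith [(hN 1 n hn).1]

end
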